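/- **Setting.** Let $V=\mathbb R^4$ with basis $(x_1,x_2,y_1,y_2)$ and $\omega=x_1^*\wedge y_1^*+x_2^*\wedge y_2^*$, let $\mathcal Q=S^2V^*$ be the space of symmetric bilinear forms on $V$, and call $q\in\mathcal Q$ positive if it is positive definite. A plane $P\subset\mathcal Q$ is *mixed* if some positive definite symmetric tensor $p\in S^2V$ satisfies $\mathrm{Tr}(qp)=0$ for all $q\in P$. It is *maximal*, $P\in\mathrm{Gr}_2^{\max}(\mathcal Q)$, if every nonzero $q\in P$ is positive on some Lagrangian and negative on some Lagrangian and, for some orientation of $P$, there is a continuous map $\xi$ from the circle $\mathbb SP=(P\setminus 0)/\mathbb R_{>0}$ to the space of Lagrangians such that $q>0$ on $\xi([q])$, which is freely homotopic to $2[\tau]$, where $\tau(\theta)=\langle\cos(\theta/2)x_1+\sin(\theta/2)y_1,\,x_2\rangle$. A *fitting immersion* of a surface $S$ is a smooth immersion $f$ of $S$ into the space of mixed planes of $\mathcal Q$ such that for every nonzero $v\in T_xS$ the image of $df(v)\in\mathrm{Hom}(f(x),\mathcal Q/f(x))$ contains the class of a positive $q\in\mathcal Q$. A *fitting flow* for $f$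 is a continuous flow $(\Phi_t)_{t\in\mathbb R}$ on the circle bundle $\mathbb Sf^*\mathcal E=\{(x,[q]) : 0\ne q\in f(x),\ [q]=\mathbb R_{>0}q\}$ such that for all $t>0$ and all $(x,[q])$, with $\Phi_t(x,[q])=(y,[q'])$, the representative $q'$ can be chosen so that $q'-q$ is positive. Let $\mathbb R^{2,3}=\{\alpha\in\Lambda^2\mathbb R^4:\omega(\alpha)=0\}$ with the $\mathrm{Sp}(4,\mathbb R)$-invariant form $\langle\cdot,\cdot\rangle$ of signature $(2,3)$ whose quadratic form is minus the Pfaffian, and $\mathbb H^{2,2}=\{p\in\mathbb R^{2,3}:\langle p,p\rangle=-1\}$. An isotropic line of $\mathbb R^{2,3}$ (a point of $\partial\mathbb H^{2,2}$) is $\Lambda^2\ell$ for a unique Lagrangian $\ell$. For transverse Lagrangians $\ell_1,\ell_2$ with projections $\pi_1,\pi_2$ of $V=\ell_1\oplus\ell_2$, let $q_{\ell_1,\ell_2}\in\mathcal Q$ be defined by $q_{\ell_1,\ell_2}(v,v)=\omega(\pi_1v,\pi_2v)$. A triple of Lagrangians is *maximal* if in some symplectic basis it is $(\langle x_1,x_2\rangle,\langle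 x_1+y_1,x_2+y_2\rangle,\langle y_1,y_2\rangle)$. Let $u:S\to\mathbb H^{2,2}$ be a smooth spacelike immersion of a (Hausdorff) smooth surface. For a unit tangent vector $w\in T_xS$ let $\ell_w$ be the Lagrangian of the isotropic line spanned by $u(x)+du(w)$, i.e. of the endpoint of the geodesic ray of $\mathbb H^{2,2}$ with initial velocity $du(w)$. The *Gauss map* is $\mathcal Gu(x)=\mathrm{span}\{q_{\ell_w,\ell_{-w}} : w\in T_xS,\ \|w\|=1\}$. **Theorem B.1.** Suppose that the second fundamental form of $u$ satisfies $\|\mathrm{II}_u(v,v)\|<\|v\|^2$ for all nonzero $v\in TS$ (equivalently $\|\mathrm{II}_u(v,v)\|<1$ for all unit $v$), where the norm of a vector $n$ in the negative definite normal bundle is $\sqrt{-\langle n,n\rangle}$. Then: 1. $\mathcal Gu(x)\in\mathrm{Gr}_2^{\max}(\mathcal Q)$ for all $x\in S$, and $\mathcal Gu$ is a fitting immersion. 2. For every unit tangent vector $w\in T_xS$ there is exactly one quadric $q_w$ of the form $q_w=q_{\ell_{n},\ell_{-n}}$ with $n\in T_xS$ a unit vector orthogonal to $w$ such that $(\ell_{-n},\ell_w,\ell_{n})$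 is maximal, and $w\mapsto[q_w]$ is a bijection from $T^1_xS$ to $\mathbb S(\mathcal Gu(x))$. 3. The geodesic flow of the induced metric, transported to $\mathbb S(\mathcal Gu)^*\mathcal E$ by $w\mapsto[q_w]$, is fitting: for every unit speed geodesic $\gamma$ of $S$ defined on an open interval, and all $s<t$ in this interval, $q_{\gamma'(t)}-q_{\gamma'(s)}$ is positive; and if the induced metric is geodesically complete, the geodesic flow, which is then defined for all times, is a fitting flow for $\mathcal Gu$. -/

import Mathlib

open Set Topology
open scoped Manifold ContDiff

noncomputable section

/-! ### Quadrics on the symplectic vector space `ℝ⁴` -/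

/-- The vector space `V = ℝ⁴`, with its standard basis ordered as `(x₁, x₂, y₁, y₂)`. -/
abbrev V4 : Type := Fin 4 → ℝ

/-- The symplectic form `ω = x₁* ∧ y₁* + x₂* ∧ y₂*` on `ℝ⁴`. -/
def omega (v w : V4) : ℝ := v 0 * w 2 - v 2 * w 0 + (v 1 * w 3 - v 3 * w 1)

/-- The symmetric `4 × 4` arrays, in the space of all arrays. -/
def symForms : Submodule ℝ (Fin 4 → Fin 4 → ℝ) where
  carrier := {q | ∀ i j, q i j = q j i}
  add_mem' ha hb i j := congrArg₂ (· + ·) (ha i j) (hb i j)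
  zero_mem' _ _ := rfl
  smul_mem' c _ ha i j := congrArg (c * ·) (ha i j)

/-- The space `𝒬 = S²V*` of quadrics (symmetric bilinear forms) on `V = ℝ⁴`, represented by their Gram
matrices in the standard basis. -/
abbrev Quadric : Type := symForms

/-- The value `q(v, w)` of a quadric, seen as a symmetric bilinear form. -/
def Quadric.eval (q : Quadric) (v w : V4) : ℝ := ∑ i, ∑ j, q.1 i j * v i * w j

/-- A quadric is positive if it is positive definite. -/
def Quadric.IsPositive (q : Quadric) : Prop := ∀ v : V4, v ≠ 0 → 0 < q.eval v v

/-- `q` is positive on the subspace `ℓ`. -/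
def Quadric.IsPositiveOn (q : Quadric) (ℓ : Submodule ℝ V4) : Prop :=
  ∀ v ∈ ℓ, v ≠ 0 → 0 < q.eval v v

/-! ### Lagrangians -/

/-- Lagrangians of `(ℝ⁴, ω)`. -/
def IsLagrangian (ℓ : Submodule ℝ V4) : Prop :=
  Module.finrank ℝ ℓ = 2 ∧ ∀ v ∈ ℓ, ∀ w ∈ ℓ, omega v w = 0

/-- `(x₁, x₂, y₁, y₂)` is a symplectic basis. -/
def IsSymplecticBasis (x y : Fin 2 → V4) : Prop :=
  (∀ i j, omega (x i) (x j) = 0) ∧ (∀ i j, omega (y i) (y j) = 0) ∧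
    ∀ i j, omega (x i) (y j) = if i = j then 1 else 0

/-- Maximal triples of Lagrangians, i.e. triples of Maslov index `2`: in some symplectic basis they
are `⟨xᵢ⟩`, `⟨xᵢ + yᵢ⟩`, `⟨yᵢ⟩`. -/
def IsMaximalTriple (ℓ₁ ℓ₂ ℓ₃ : Submodule ℝ V4) : Prop :=
  ∃ x y : Fin 2 → V4, IsSymplecticBasis x y ∧
    ℓ₁ = Submodule.span ℝ (range x) ∧
    ℓ₂ = Submodule.span ℝ (range fun i => x i + y i) ∧
    ℓ₃ = Submodule.span ℝ (range y)

/-- `q` is the quadric `q_{ℓ₁,ℓ₂}` of a pair of transverse Lagrangians: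
`q(v, v) = ω(π₁ v, π₂ v)` for the projections `π₁, π₂` of the sum `V = ℓ₁ ⊕ ℓ₂`.
This determines `q`. -/
def IsLagrangianQuadric (ℓ₁ ℓ₂ : Submodule ℝ V4) (q : Quadric) : Prop :=
  IsLagrangian ℓ₁ ∧ IsLagrangian ℓ₂ ∧ IsCompl ℓ₁ ℓ₂ ∧
    ∀ a ∈ ℓ₁, ∀ c ∈ ℓ₂, q.eval (a + c) (a + c) = omega a c

/-- Continuity of a family of planes in `ℝ⁴`, i.e. of a map to the Grassmannian `Gr₂(ℝ⁴)`:
it admits local continuous frames. -/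
def IsContinuousPlaneFamily {X : Type*} [TopologicalSpace X] (f : X → Submodule ℝ V4) : Prop :=
  ∀ x, ∃ U ∈ 𝓝 x, ∃ e : Fin 2 → X → V4, (∀ i, ContinuousOn (e i) U) ∧
    ∀ y ∈ U, LinearIndependent ℝ (fun i => e i y) ∧ Submodule.span ℝ (range fun i => e i y) = f y

/-- A loop of Lagrangians, as a `2π`-periodic continuous map from `ℝ`. -/
def IsLagrangianLoop (ξ : ℝ → Submodule ℝ V4) : Prop :=
  (∀ θ, IsLagrangian (ξ θ)) ∧ IsContinuousPlaneFamily ξ ∧ ∀ θ, ξ (θ + 2 * Real.pi) = ξ θ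

/-- Free homotopy of loops of Lagrangians. -/
def AreFreelyHomotopic (ξ₀ ξ₁ : ℝ → Submodule ℝ V4) : Prop :=
  ∃ H : unitInterval × ℝ → Submodule ℝ V4, IsContinuousPlaneFamily H ∧
    (∀ s, IsLagrangianLoop fun θ => H (s, θ)) ∧
    (∀ θ, H (0, θ) = ξ₀ θ) ∧ ∀ θ, H (1, θ) = ξ₁ θ

/-- The generator `τ` of the fundamental group of the space of Lagrangians,
`τ(θ) = ⟨cos(θ/2) x₁ + sin(θ/2) y₁, x₂⟩`. -/
def tauLoop (θ : ℝ) : Submodule ℝ V4 :=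
  Submodule.span ℝ {![Real.cos (θ / 2), 0, Real.sin (θ / 2), 0], ![0, 1, 0, 0]}

/-! ### Pencils of quadrics -/

/-- Mixed pencils: the annihilator `P° ⊆ S²V`, for the pairing `Tr(q p)`, contains a
positive tensor. -/
def IsMixedPencil (P : Submodule ℝ Quadric) : Prop :=
  ∃ p : Matrix (Fin 4) (Fin 4) ℝ, p.PosDef ∧
    ∀ q ∈ P, ∑ i, ∑ j, p i j * q.1 i j = 0

/-- `ω`-regular quadrics: positive on some Lagrangian and negative on some Lagrangian. -/
def IsOmegaRegular (q : Quadric) : Prop :=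
  (∃ ℓ, IsLagrangian ℓ ∧ q.IsPositiveOn ℓ) ∧ ∃ ℓ, IsLagrangian ℓ ∧ (-q).IsPositiveOn ℓ

/-- The set `Gr₂^max(𝒬)`: two-dimensional pencils whose nonzero elements are `ω`-regular and which,
for some orientation, given here by a basis `(a, b)`, have a boundary map `ξ : 𝕊P → 𝓛₂`
(so `q` is positive on `ξ([q])`) freely homotopic to `2[τ]`. -/
def IsMaximalPencil (P : Submodule ℝ Quadric) : Prop :=
  Module.finrank ℝ P = 2 ∧ (∀ q ∈ P, q ≠ 0 → IsOmegaRegular q) ∧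
    ∃ a b : Quadric, P = Submodule.span ℝ {a, b} ∧
      ∃ ξ : ℝ → Submodule ℝ V4, IsLagrangianLoop ξ ∧
        (∀ θ, (Real.cos θ • a + Real.sin θ • b).IsPositiveOn (ξ θ)) ∧
        AreFreelyHomotopic ξ fun θ => tauLoop (2 * θ)

/-! ### Fitting immersions of surfaces -/

section Surface

variable {S : Type*} [TopologicalSpace S] [ChartedSpace (EuclideanSpace ℝ (Fin 2)) S]

/-- Smoothness of a map from a surface to the Grassmannian `Gr₂(𝒬)`: it admits local smooth
frames. -/
def IsSmoothPencilMap (f : S → Submodule ℝ Quadric) : Prop :=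
  ∀ x, ∃ U ∈ 𝓝 x, ∃ e : Fin 2 → S → Quadric,
    (∀ i, ContMDiffOn (𝓡 2) 𝓘(ℝ, Quadric) ∞ (e i) U) ∧
    ∀ y ∈ U, LinearIndependent ℝ (fun i => e i y) ∧ Submodule.span ℝ (range fun i => e i y) = f y

/-- `A` is the differential at `x` of a smooth map `f` to `Gr₂(𝒬)`, where the tangent space to the
Grassmannian at `P` is identified with `Hom(P, 𝒬/P)`: for every local section `s` of the family of
subspaces, `A v` maps `s(x)` to the class of the derivative of `s` along `v`. -/
def IsPencilDifferentialAt (f : S → Submodule ℝ Quadric) (x : S)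
    (A : TangentSpace (𝓡 2) x →ₗ[ℝ] (f x →ₗ[ℝ] Quadric ⧸ f x)) : Prop :=
  ∀ s : S → Quadric, MDifferentiableAt (𝓡 2) 𝓘(ℝ, Quadric) s x → (∀ᶠ y in 𝓝 x, s y ∈ f y) →
    ∀ (h : s x ∈ f x) (v : TangentSpace (𝓡 2) x),
      A v ⟨s x, h⟩ = (f x).mkQ (mfderiv (𝓡 2) 𝓘(ℝ, Quadric) s x v : Quadric)

/-- A tangent vector to the Grassmannian at `P`, seen in `Hom(P, 𝒬/P)`, is fitting if its image
contains the class of a positive quadric. -/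
def IsFittingDirection {P : Submodule ℝ Quadric} (v : P →ₗ[ℝ] Quadric ⧸ P) : Prop :=
  ∃ q : Quadric, q.IsPositive ∧ P.mkQ q ∈ LinearMap.range v

/-- Fitting immersions `S → Gr₂^mix(𝒬)`: smooth immersions all of whose nonzero tangent directions
are fitting. -/
def IsFittingImmersion (f : S → Submodule ℝ Quadric) : Prop :=
  (∀ x, IsMixedPencil (f x)) ∧ IsSmoothPencilMap f ∧
    ∀ x, ∃ A : TangentSpace (𝓡 2) x →ₗ[ℝ] (f x →ₗ[ℝ] Quadric ⧸ f x),
      IsPencilDifferentialAt f x A ∧ Function.Injective A ∧ ∀ v, v ≠ 0 → IsFittingDirection (A v)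

/-! ### The sphere bundle of a family of pencils and fitting flows -/

/-- The complement of the zero section in the bundle `f*𝓔`. -/
abbrev NonzeroBundle {M : Type*} (f : M → Submodule ℝ Quadric) : Type _ :=
  {p : M × Quadric // p.2 ∈ f p.1 ∧ p.2 ≠ 0}

/-- Two nonzero vectors of `f*𝓔` are identified if they differ by a positive scalar. -/
instance sphereSetoid {M : Type*} (f : M → Submodule ℝ Quadric) : Setoid (NonzeroBundle f) where
  r p p' := p.1.1 = p'.1.1 ∧ ∃ c : ℝ, 0 < c ∧ p'.1.2 = c • p.1.2
  iseqv := by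
    refine ⟨fun p => ⟨rfl, 1, one_pos, by simp⟩, ?_, ?_⟩
    · rintro p p' ⟨h, c, hc, hp⟩
      exact ⟨h.symm, c⁻¹, inv_pos.2 hc, by rw [hp, smul_smul, inv_mul_cancel₀ hc.ne', one_smul]⟩
    · rintro p p' p'' ⟨h, c, hc, hp⟩ ⟨h', c', hc', hp'⟩
      exact ⟨h.trans h', c' * c, mul_pos hc' hc, by rw [hp', hp, smul_smul]⟩

/-- The sphere bundle `𝕊f*𝓔`, with the quotient topology. -/
abbrev SphereBundle {M : Type*} (f : M → Submodule ℝ Quadric) : Type _ :=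
  Quotient (sphereSetoid f)

/-- A fitting flow for `f`: a continuous flow `Φ` on `𝕊f*𝓔` such that, for all `t > 0` and every
representative `q` of a point of `𝕊f*𝓔`, some representative `q'` of its image by `Φ t` is such
that `q' - q` is positive. -/
def IsFittingFlow {M : Type*} [TopologicalSpace M] (f : M → Submodule ℝ Quadric)
    (Φ : ℝ → SphereBundle f → SphereBundle f) : Prop :=
  Continuous (fun p : ℝ × SphereBundle f => Φ p.1 p.2) ∧
    (∀ e, Φ 0 e = e) ∧ (∀ s t e, Φ (s + t) e = Φ s (Φ t e)) ∧
    ∀ t, 0 < t → ∀ p : NonzeroBundle f, ∃ p' : NonzeroBundle f,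
      Φ t (Quotient.mk _ p) = Quotient.mk _ p' ∧ (p'.1.2 - p.1.2).IsPositive

/-! ### The pseudo-hyperbolic space `ℍ^{2,2}` -/

/-- The vector space underlying `ℝ^{2,3}`. -/
abbrev R23 : Type := Fin 5 → ℝ

/-- The bilinear form of signature `(2, 3)` of `ℝ^{2,3}`. -/
def form23 : LinearMap.BilinForm ℝ R23 :=
  Matrix.toBilin' (Matrix.diagonal ![1, 1, -1, -1, -1])

/-- `ℍ^{2,2}` is the set of vectors of norm `-1` in `ℝ^{2,3}`. -/
def H22 : Set R23 := {p | form23 p p = -1}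

/-- The linear identification of `ℝ^{2,3}` with the five-dimensional `Sp(4, ℝ)`-invariant subspace
of `Λ²ℝ⁴` of bivectors on which `ω` vanishes. A bivector is represented by a skew-symmetric matrix,
`a ∧ b` being `a bᵀ - b aᵀ`. -/
def bivector : R23 →ₗ[ℝ] Matrix (Fin 4) (Fin 4) ℝ where
  toFun v := !![0, v 0 + v 2, v 4, v 1 + v 3;
    -(v 0 + v 2), 0, v 3 - v 1, -v 4;
    -v 4, -(v 3 - v 1), 0, v 2 - v 0;
    -(v 1 + v 3), v 4, -(v 2 - v 0), 0]
  map_add' v w := by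
    ext i j
    fin_cases i <;> fin_cases j <;> simp <;> ring
  map_smul' c v := by
    ext i j
    fin_cases i <;> fin_cases j <;> simp <;> ring

/-- The image of `bivector` is the space of bivectors annihilated by `ω`. -/
theorem range_bivector : (LinearMap.range bivector : Set (Matrix (Fin 4) (Fin 4) ℝ)) =
    {A | A.transpose = -A ∧ A 0 2 + A 1 3 = 0} := by
  ext A
  constructor
  · rintro ⟨v, rfl⟩
    refine ⟨?_, by simp [bivector]⟩
    ext i j
    fin_cases i <;> fin_cases j <;> simp [bivector]
  · rintro ⟨h, h'⟩
    have hs : ∀ i j, A j i = -A i j := fun i j => by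
      have := congrFun (congrFun h i) j
      simpa using this
    refine ⟨![(A 0 1 - A 2 3) / 2, (A 0 3 - A 1 2) / 2, (A 0 1 + A 2 3) / 2, (A 0 3 + A 1 2) / 2,
      A 0 2], ?_⟩
    ext i j
    fin_cases i <;> fin_cases j <;> simp [bivector] <;>
      linarith [hs 0 0, hs 1 1, hs 2 2, hs 3 3, hs 0 1, hs 0 2, hs 0 3, hs 1 2, hs 1 3, hs 2 3]

/-- In terms of bivectors, the quadratic form of `ℝ^{2,3}` is the opposite of the Pfaffian, hence
it is preserved by `Sp(4, ℝ)`. -/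
theorem form23_eq_neg_pfaffian (v : R23) : form23 v v =
    -(bivector v 0 1 * bivector v 2 3 - bivector v 0 2 * bivector v 1 3
      + bivector v 0 3 * bivector v 1 2) := by
  simp [form23, bivector, Matrix.toBilin'_apply, Fin.sum_univ_succ, Matrix.diagonal_apply]
  ring

/-- The Lagrangian corresponding to the isotropic line of `ℝ^{2,3}` spanned by a nonzero isotropic
vector `v`: the plane `ℓ` such that `Λ²ℓ` is the line spanned by `v`, that is the image of the
skew-symmetric map `V* → V` defined by `v`. -/
def lagrangianOf (v : R23) : Submodule ℝ V4 := LinearMap.range (bivector v).mulVecLin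

/-! ### Spacelike immersions in `ℍ^{2,2}` -/

/-- The differential of `u` at `x`, as a linear map to `ℝ^{2,3}`. -/
def diffAt (u : S → R23) (x : S) : TangentSpace (𝓡 2) x →ₗ[ℝ] R23 :=
  (mfderiv (𝓡 2) 𝓘(ℝ, R23) u x : TangentSpace (𝓡 2) x →L[ℝ] R23).toLinearMap

/-- Spacelike immersions `u : S → ℍ^{2,2}`: smooth maps such that the form of `ℝ^{2,3}` induces a
positive definite metric on `S`. -/
structure IsSpacelikeImmersion (u : S → R23) : Prop where
  smooth : ContMDiff (𝓡 2) 𝓘(ℝ, R23) ∞ u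
  mem : ∀ x, u x ∈ H22
  spacelike : ∀ x (v : TangentSpace (𝓡 2) x), v ≠ 0 → 0 < form23 (diffAt u x v) (diffAt u x v)

/-- The second derivative of `u` at `x` in the preferred chart at `x`. The tangent space at `x` is
identified with the model space `ℝ²` by means of the same chart. -/
def secondDerivAt (u : S → R23) (x : S) (v w : TangentSpace (𝓡 2) x) : R23 :=
  fderiv ℝ (fderiv ℝ (u ∘ (extChartAt (𝓡 2) x).symm)) (extChartAt (𝓡 2) x x)
    (v : EuclideanSpace ℝ (Fin 2)) (w : EuclideanSpace ℝ (Fin 2))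

/-- `n` is the value `II_u(v, w)` of the second fundamental form of `u : S → ℍ^{2,2}`: the component
of the second derivative of `u` that is normal to `S` in `T_{u(x)} ℍ^{2,2} = u(x)^⊥`, for the
orthogonal decomposition `ℝ^{2,3} = ℝ u(x) ⊕ du(T_x S) ⊕ N_x`. This determines `n` for a spacelike
immersion. -/
def IsSecondFundamentalForm (u : S → R23) (x : S) (v w : TangentSpace (𝓡 2) x) (n : R23) : Prop :=
  form23 n (u x) = 0 ∧ (∀ z, form23 n (diffAt u x z) = 0) ∧
    secondDerivAt u x v w - n ∈ Submodule.span ℝ {u x} ⊔ LinearMap.range (diffAt u x)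

/-- `w` is a unit vector of `du(T_x S)`. -/
def IsUnitTangent (u : S → R23) (x : S) (w : R23) : Prop :=
  w ∈ LinearMap.range (diffAt u x) ∧ form23 w w = 1

/-- The Gauss map of a spacelike immersion in `ℍ^{2,2}`: the span of the quadrics `q_{ℓ₁,ℓ₂}`, where
`ℓ₁, ℓ₂` are the Lagrangians corresponding to the endpoints in `∂ℍ^{2,2}` of a geodesic through `u(x)`
of the totally geodesic plane tangent to `du(T_x S)`. The geodesic with unit initial velocity `w` is
`cosh(t) u(x) + sinh(t) w`, and its endpoints are the lines spanned by `u(x) + w` and `u(x) - w`. -/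
def gaussMap (u : S → R23) (x : S) : Submodule ℝ Quadric :=
  Submodule.span ℝ {q | ∃ w, IsUnitTangent u x w ∧
    IsLagrangianQuadric (lagrangianOf (u x + w)) (lagrangianOf (u x - w)) q}

/-! ### The geodesic flow on the sphere bundle of the Gauss map -/

/-- `γ` is a unit speed geodesic, on the set `J`, of the metric on `S` induced by `u`. The Levi-Civita
connection of this metric is the tangential part of the flat connection of `ℝ^{2,3}`, so that the
acceleration of `u ∘ γ` has to be orthogonal to `S`. -/
structure IsUnitGeodesic (u : S → R23) (γ : ℝ → S) (J : Set ℝ) : Prop where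
  smooth : ContMDiffOn 𝓘(ℝ, ℝ) (𝓡 2) 2 γ J
  unit : ∀ t ∈ J, form23 (deriv (u ∘ γ) t) (deriv (u ∘ γ) t) = 1
  geodesic : ∀ t ∈ J, ∀ v, form23 (deriv (deriv (u ∘ γ)) t) (diffAt u (γ t) v) = 0

/-- The metric induced by `u` is geodesically complete. -/
def IsGeodesicallyComplete (u : S → R23) : Prop :=
  ∀ x w, IsUnitTangent u x w →
    ∃ γ : ℝ → S, IsUnitGeodesic u γ univ ∧ γ 0 = x ∧ deriv (u ∘ γ) 0 = w

/-- The identification between the unit tangent bundle and the sphere bundle of the Gauss map: the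
quadric `q` associated with a unit tangent vector `w` at `x` is `q_{V⁺,V⁻}`, where `V` is the unit
tangent vector at `x` orthogonal to `w`, the Lagrangians `V⁺`, `V⁻`, `w⁺` correspond to the endpoints
of the geodesic rays with initial velocities `V`, `-V`, `w`, and the sign of `V` is chosen such that
`(V⁻, w⁺, V⁺)` is a maximal triple. -/
def IsVelocityQuadric (u : S → R23) (x : S) (w : R23) (q : Quadric) : Prop :=
  ∃ V, IsUnitTangent u x V ∧ form23 V w = 0 ∧
    IsMaximalTriple (lagrangianOf (u x - V)) (lagrangianOf (u x + w)) (lagrangianOf (u x + V)) ∧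
    IsLagrangianQuadric (lagrangianOf (u x + V)) (lagrangianOf (u x - V)) q

/-- `Φ` is the geodesic flow of the metric induced by `u`, transported to the sphere bundle of the
Gauss map: every orbit is the curve of classes of the quadrics associated with the velocities of a
unit speed geodesic. -/
def IsGeodesicFlow (u : S → R23)
    (Φ : ℝ → SphereBundle (gaussMap u) → SphereBundle (gaussMap u)) : Prop :=
  ∀ e, Φ 0 e = e ∧ ∃ γ : ℝ → S, IsUnitGeodesic u γ univ ∧
    ∀ t, ∃ p : NonzeroBundle (gaussMap u), Φ t e = Quotient.mk _ p ∧ p.1.1 = γ t ∧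
      IsVelocityQuadric u (γ t) (deriv (u ∘ γ) t) p.1.2

end Surface

end

noncomputable section

/-! ### Clifford multiplication and the quadrics `a ∧ b` -/

/-! The space V is the spin module of ℝ^{2,3}: vectors act on V by ω-self-adjoint maps satisfying
the Clifford relation, so commutators of vectors are ω-skew, and pairing them with ω embeds
Λ²ℝ^{2,3} = 𝔰𝔭(4,ℝ) in 𝒬, as `wedgeQuadric`. For a unit tangent vector w at p = u(x), the endpoints
of its geodesic are the two eigenspaces of the involution pw, so q_{ℓ_w,ℓ_{-w}} = p ∧ w. Hence the
Gauss map is x ↦ u(x) ∧ du(T_xS), and the quadric attached to a velocity w is q_w = p ∧ Jw. Here J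
is the quarter turn for the orientation that every spacelike plane receives from its projection to
ℝ^{2,0} (`isMaximalTriple_iff`); no orientation of S has to be chosen.

Everything rests on two positivity statements. If (w, V) is a positively oriented spacelike pair,
then w ∧ V is positive definite (`wedgeQuadric_isPositive`). If the pair is orthonormal and n is
normal to p, w and V with ‖n‖ < 1, then w ∧ V + p ∧ n is still positive
(`wedgeQuadric_add_isPositive`). The first makes the pencils mixed, since w ∧ V is trace-orthogonal
to p ∧ T for T = ⟨w, V⟩. It also makes p ∧ V positive on the Lagrangian of p + w when (V, w) is
oriented, because p acts as -w there. This gives the boundary map; its homotopy class is computed by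
lifting the loop p + w to nonzero vectors of ℝ² and ℝ³ separately.

Modulo the pencil, the derivative of a section p ∧ W along v is v ∧ W + p ∧ II(v, W). For W = Jv
with v a unit vector it is positive by the second statement, since polarization turns the bound on
the diagonal of II into ‖II(v, W)‖ < 1 for orthonormal v, W (`neg_one_lt_form23_normalPart`). No
element of a pencil is positive, so the differential is injective and the immersion is fitting.
Along a geodesic with velocity w, the field V = Jw is parallel, so V' is II(w, V) plus a multiple of
u, and u ∧ V has the positive derivative w ∧ V + u ∧ II(w, V) (`exists_hasDerivAt_isPositive`).
Integration gives the monotonicity. In the complete case the geodesics define a flow on the bundle,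
whose joint continuity comes from the geodesic equation in charts. -/

theorem omega_add_left (v w z : V4) : omega (v + w) z = omega v z + omega w z := by
  simp only [omega, Pi.add_apply]; ring

theorem omega_add_right (v w z : V4) : omega v (w + z) = omega v w + omega v z := by
  simp only [omega, Pi.add_apply]; ring

theorem omega_smul_left (c : ℝ) (v w : V4) : omega (c • v) w = c * omega v w := by
  simp only [omega, Pi.smul_apply, smul_eq_mul]; ring

theorem omega_smul_right (c : ℝ) (v w : V4) : omega v (c • w) = c * omega v w := by
  simp only [omega, Pi.smul_apply, smul_eq_mul]; ring

theorem omega_neg_left (v w : V4) : omega (-v) w = -omega v w := by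
  simp only [omega, Pi.neg_apply]; ring

theorem omega_neg_right (v w : V4) : omega v (-w) = -omega v w := by
  simp only [omega, Pi.neg_apply]; ring

theorem omega_sub_left (v w z : V4) : omega (v - w) z = omega v z - omega w z := by
  simp only [omega, Pi.sub_apply]; ring

theorem omega_swap (v w : V4) : omega v w = -omega w v := by
  simp only [omega]; ring

theorem omega_self (v : V4) : omega v v = 0 := by
  simp only [omega]; ring

/-- The form of `ℝ^{2,3}` in coordinates. -/
theorem form23_apply (a b : R23) :
    form23 a b = a 0 * b 0 + a 1 * b 1 - a 2 * b 2 - a 3 * b 3 - a 4 * b 4 := by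
  simp [form23, Matrix.toBilin'_apply, Fin.sum_univ_succ, Matrix.diagonal_apply]
  ring

theorem form23_comm (a b : R23) : form23 a b = form23 b a := by
  simp only [form23_apply]; ring

/-- Clifford multiplication `ℝ^{2,3} × V → V`: a bivector, seen as a map `V* → V`, is composed with
the identification of `V` with `V*` given by `ω`. -/
def cliff : R23 →ₗ[ℝ] V4 →ₗ[ℝ] V4 :=
  LinearMap.mk₂ ℝ (fun a v => ![(a 0 + a 2) * v 3 - a 4 * v 0 - (a 1 + a 3) * v 1,
      -(a 0 + a 2) * v 2 - (a 3 - a 1) * v 0 + a 4 * v 1,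
      -a 4 * v 2 - (a 3 - a 1) * v 3 - (a 2 - a 0) * v 1,
      -(a 1 + a 3) * v 2 + a 4 * v 3 + (a 2 - a 0) * v 0])
    (fun a b v => by ext i; fin_cases i <;> simp <;> ring)
    (fun c a v => by ext i; fin_cases i <;> simp <;> ring)
    (fun a v w => by ext i; fin_cases i <;> simp <;> ring)
    (fun c a v => by ext i; fin_cases i <;> simp <;> ring)

theorem cliff_apply (a : R23) (v : V4) :
    cliff a v = ![(a 0 + a 2) * v 3 - a 4 * v 0 - (a 1 + a 3) * v 1,
      -(a 0 + a 2) * v 2 - (a 3 - a 1) * v 0 + a 4 * v 1,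
      -a 4 * v 2 - (a 3 - a 1) * v 3 - (a 2 - a 0) * v 1,
      -(a 1 + a 3) * v 2 + a 4 * v 3 + (a 2 - a 0) * v 0] := rfl

/-- The Clifford relation. Together with the self-adjointness `omega_cliff_left`, it replaces
coordinates in most of the identities about quadrics a ∧ b. -/
theorem cliff_cliff_add (a b : R23) (v : V4) :
    cliff a (cliff b v) + cliff b (cliff a v) = (-(2 * form23 a b)) • v := by
  rw [form23_apply]
  ext i
  fin_cases i <;> simp [cliff_apply] <;> ring

theorem cliff_cliff (a b : R23) (v : V4) :
    cliff a (cliff b v) = -cliff b (cliff a v) - (2 * form23 a b) • v := by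
  rw [eq_sub_iff_add_eq, ← sub_eq_iff_eq_add'.2 (cliff_cliff_add a b v).symm]
  module

theorem cliff_cliff_of_orthogonal {a b : R23} (h : form23 a b = 0) (v : V4) :
    cliff a (cliff b v) = -cliff b (cliff a v) := by
  rw [cliff_cliff, h]; simp

theorem cliff_sq (a : R23) (v : V4) : cliff a (cliff a v) = -form23 a a • v := by
  rw [form23_apply]
  ext i
  fin_cases i <;> simp [cliff_apply] <;> ring

/-- Self-adjointness of vectors makes their commutators ω-skew, that is, elements of 𝔰𝔭(4, ℝ); this
is the symmetry of `wedgeQuadric`. -/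
theorem omega_cliff_left (a : R23) (v w : V4) : omega (cliff a v) w = omega v (cliff a w) := by
  simp [omega, cliff_apply]; ring

theorem bivector_mulVec (a : R23) (v : V4) :
    (bivector a).mulVec v = cliff a ![-v 2, -v 3, v 0, v 1] := by
  ext i
  fin_cases i <;> simp [bivector, cliff_apply, Matrix.mulVec, dotProduct, Fin.sum_univ_four] <;> ring

/-- The bivector and the Clifford map differ by the isomorphism between V and V* given by ω, which
does not change the range. -/
theorem lagrangianOf_eq_range (a : R23) : lagrangianOf a = LinearMap.range (cliff a) := by
  ext z
  simp only [lagrangianOf, LinearMap.mem_range, Matrix.mulVecLin_apply, bivector_mulVec]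
  constructor
  · rintro ⟨y, rfl⟩
    exact ⟨_, rfl⟩
  · rintro ⟨y, rfl⟩
    refine ⟨![y 2, y 3, -y 0, -y 1], ?_⟩
    congr 1
    ext i
    fin_cases i <;> simp

/-- The quadric `a ∧ b` of `𝒬 = 𝔰𝔭(4, ℝ) = Λ²ℝ^{2,3}`. -/
def wedgeQuadric : R23 →ₗ[ℝ] R23 →ₗ[ℝ] Quadric :=
  LinearMap.mk₂ ℝ (fun a b => ⟨fun i j => -(1 / 4) * omega (cliff a (cliff b (Pi.single i 1))
      - cliff b (cliff a (Pi.single i 1))) (Pi.single j 1), fun i j => by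
        have h : ∀ v w : V4, omega (cliff a (cliff b v) - cliff b (cliff a v)) w =
            omega (cliff a (cliff b w) - cliff b (cliff a w)) v := fun v w => by
          rw [omega_sub_left, omega_sub_left, omega_cliff_left, omega_cliff_left b, omega_cliff_left b,
            omega_cliff_left a, omega_swap v, omega_swap v]
          ring
        simp only []
        rw [h]⟩)
    (fun a b c => by
      ext i j
      simp only [map_add, LinearMap.add_apply, Submodule.coe_add, Pi.add_apply, omega_sub_left,
        omega_add_left]
      ring)
    (fun r a b => by
      ext i j
      simp only [map_smul, LinearMap.smul_apply, Submodule.coe_smul, Pi.smul_apply, omega_sub_left,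
        omega_smul_left, smul_eq_mul]
      ring)
    (fun a b c => by
      ext i j
      simp only [map_add, LinearMap.add_apply, Submodule.coe_add, Pi.add_apply, omega_sub_left,
        omega_add_left]
      ring)
    (fun r a b => by
      ext i j
      simp only [map_smul, LinearMap.smul_apply, Submodule.coe_smul, Pi.smul_apply, omega_sub_left,
        omega_smul_left, smul_eq_mul]
      ring)

theorem wedgeQuadric_coe (a b : R23) (i j : Fin 4) : (wedgeQuadric a b).1 i j =
    -(1 / 4) * omega (cliff a (cliff b (Pi.single i 1)) - cliff b (cliff a (Pi.single i 1)))
      (Pi.single j 1) := rfl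

theorem omega_sum_right {ι : Type*} (s : Finset ι) (v : V4) (w : ι → V4) :
    omega v (∑ i ∈ s, w i) = ∑ i ∈ s, omega v (w i) :=
  map_sum (AddMonoidHom.mk' (omega v) (omega_add_right v)) w s

theorem omega_sum_left {ι : Type*} (s : Finset ι) (v : V4) (w : ι → V4) :
    omega (∑ i ∈ s, w i) v = ∑ i ∈ s, omega (w i) v :=
  map_sum (AddMonoidHom.mk' (fun z => omega z v) fun x y => omega_add_left x y v) w s

theorem eval_wedgeQuadric (a b : R23) (v w : V4) : (wedgeQuadric a b).eval v w =
    -(1 / 4) * omega (cliff a (cliff b v) - cliff b (cliff a v)) w := by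
  have h : ∀ z : V4, z = ∑ i, z i • (Pi.single i 1 : V4) := fun z => by
    ext j; simp [Finset.sum_apply, Pi.single_apply]
  have hv : cliff a (cliff b v) - cliff b (cliff a v) = ∑ i, v i •
      (cliff a (cliff b (Pi.single i 1)) - cliff b (cliff a (Pi.single i 1))) := by
    conv_lhs => rw [h v]
    simp only [map_sum, map_smul, ← Finset.sum_sub_distrib, smul_sub]
  rw [hv, h w, omega_sum_left, Quadric.eval, Finset.mul_sum, ← h w]
  refine Finset.sum_congr rfl fun i _ => ?_
  conv_rhs => rw [h w, omega_sum_right, Finset.mul_sum]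
  refine Finset.sum_congr rfl fun j _ => ?_
  rw [omega_smul_left, omega_smul_right, wedgeQuadric_coe]
  ring

/-- By self-adjointness and skew-symmetry of ω, the two halves of the commutator contribute equally
on the diagonal. -/
theorem eval_wedgeQuadric_self (a b : R23) (v : V4) :
    (wedgeQuadric a b).eval v v = -(1 / 2) * omega (cliff a (cliff b v)) v := by
  rw [eval_wedgeQuadric, omega_sub_left, omega_cliff_left b, omega_swap (cliff a v),
    ← omega_cliff_left a]
  ring

theorem wedgeQuadric_swap (a b : R23) : wedgeQuadric a b = -wedgeQuadric b a := by
  ext i j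
  rw [wedgeQuadric_coe, Submodule.coe_neg, Pi.neg_apply, Pi.neg_apply, wedgeQuadric_coe,
    omega_sub_left, omega_sub_left]
  ring

theorem wedgeQuadric_self (a : R23) : wedgeQuadric a a = 0 := by
  ext i j
  rw [wedgeQuadric_coe, sub_self]
  simp [omega]

/-! ### Quadrics as forms -/

theorem Quadric.eval_add (q q' : Quadric) (v w : V4) :
    (q + q').eval v w = q.eval v w + q'.eval v w := by
  simp [Quadric.eval, add_mul, Finset.sum_add_distrib]

theorem Quadric.eval_smul (c : ℝ) (q : Quadric) (v w : V4) :
    (c • q).eval v w = c * q.eval v w := by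
  simp [Quadric.eval, Finset.mul_sum, mul_assoc]

theorem Quadric.eval_neg (q : Quadric) (v w : V4) : (-q).eval v w = -q.eval v w := by
  simp [Quadric.eval]

theorem Quadric.eval_sub (q q' : Quadric) (v w : V4) :
    (q - q').eval v w = q.eval v w - q'.eval v w := by
  rw [sub_eq_add_neg, Quadric.eval_add, Quadric.eval_neg, sub_eq_add_neg]

theorem Quadric.eval_add_left (q : Quadric) (v v' w : V4) :
    q.eval (v + v') w = q.eval v w + q.eval v' w := by
  simp [Quadric.eval, mul_add, add_mul, Finset.sum_add_distrib]

theorem Quadric.eval_add_right (q : Quadric) (v w w' : V4) :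
    q.eval v (w + w') = q.eval v w + q.eval v w' := by
  simp [Quadric.eval, mul_add, Finset.sum_add_distrib]

theorem Quadric.eval_smul_left (q : Quadric) (c : ℝ) (v w : V4) :
    q.eval (c • v) w = c * q.eval v w := by
  simp only [Quadric.eval, Finset.mul_sum, Pi.smul_apply, smul_eq_mul]
  exact Finset.sum_congr rfl fun i _ => Finset.sum_congr rfl fun j _ => by ring

theorem Quadric.eval_smul_right (q : Quadric) (c : ℝ) (v w : V4) :
    q.eval v (c • w) = c * q.eval v w := by
  simp only [Quadric.eval, Finset.mul_sum, Pi.smul_apply, smul_eq_mul]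
  exact Finset.sum_congr rfl fun i _ => Finset.sum_congr rfl fun j _ => by ring

theorem Quadric.eval_comm (q : Quadric) (v w : V4) : q.eval v w = q.eval w v := by
  simp only [Quadric.eval]
  rw [Finset.sum_comm]
  exact Finset.sum_congr rfl fun i _ => Finset.sum_congr rfl fun j _ => by rw [q.2 j i]; ring

theorem Quadric.eval_single (q : Quadric) (i j : Fin 4) :
    q.eval (Pi.single i 1) (Pi.single j 1) = q.1 i j := by
  simp [Quadric.eval, Pi.single_apply]

theorem Quadric.ext_eval {q q' : Quadric} (h : ∀ v, q.eval v v = q'.eval v v) : q = q' := by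
  ext i j
  rw [← Quadric.eval_single, ← Quadric.eval_single]
  have := h (Pi.single i 1 + Pi.single j 1)
  simp only [Quadric.eval_add_left, Quadric.eval_add_right] at this
  rw [h (Pi.single i 1), h (Pi.single j 1), q.eval_comm (Pi.single j 1) (Pi.single i 1),
    q'.eval_comm (Pi.single j 1) (Pi.single i 1)] at this
  linarith

/-! ### Spacelike planes of `ℝ^{2,3}` -/

/-- The orientation form of spacelike planes: the determinant of the projection to `ℝ^{2,0}`. -/
def orient (a b : R23) : ℝ := a 0 * b 1 - a 1 * b 0

theorem gram_pos {a b : R23} (h : ∀ s t : ℝ, s ≠ 0 ∨ t ≠ 0 →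
    0 < form23 (s • a + t • b) (s • a + t • b)) :
    0 < form23 a a * form23 b b - form23 a b ^ 2 := by
  -- The norm of ⟨a,b⟩a - ⟨a,a⟩b is ⟨a,a⟩ times the Gram determinant.
  have h1 := h (form23 a b) (-form23 a a) (Or.inr (neg_ne_zero.2 ?_))
  · have h2 := h 1 0 (by simp)
    simp only [one_smul, zero_smul, add_zero] at h2
    simp only [map_add, map_smul, LinearMap.add_apply, LinearMap.smul_apply, smul_eq_mul,
      form23_comm b a] at h1
    have : 0 < form23 a a * (form23 a a * form23 b b - form23 a b ^ 2) := by linarith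
    exact (pos_iff_pos_of_mul_pos this).1 h2
  · have h2 := h 1 0 (by simp)
    simp only [one_smul, zero_smul, add_zero] at h2
    exact h2.ne'

/-- A positively oriented basis of a spacelike plane stays so after a perturbation by a map which is
dominated by the timelike part of the form. -/
theorem det_pos_of_dominated {w V : R23} (h : ∀ s t : ℝ, s ≠ 0 ∨ t ≠ 0 →
    0 < form23 (s • w + t • V) (s • w + t • V)) (ho : 0 < orient w V) {N : ℝ} (hN : 0 < N)
    (α β : R23 →ₗ[ℝ] ℝ)
    (hle : ∀ a : R23, α a ^ 2 + β a ^ 2 ≤ N ^ 2 * (a 2 ^ 2 + a 3 ^ 2 + a 4 ^ 2)) :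
    0 < (N * w 0 + α w) * (N * V 1 + β V) - (N * w 1 + β w) * (N * V 0 + α V) := by
  -- The perturbation is scaled by k. The determinant is N² times the orientation at k = 0, so it is
  -- enough that it never vanishes on [0, 1].
  set g : ℝ → ℝ := fun k => (N * w 0 + k * α w) * (N * V 1 + k * β V)
      - (N * w 1 + k * β w) * (N * V 0 + k * α V) with hg
  have hg0 : 0 < g 0 := by
    have : g 0 = N ^ 2 * orient w V := by simp only [hg, orient]; ring
    rw [this]; positivity
  have hne : ∀ k ∈ Icc (0 : ℝ) 1, g k ≠ 0 := by
    intro k hk h0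
    -- A nonzero kernel vector of the singular 2 × 2 matrix, given by the entries of one column up
    -- to sign.
    obtain ⟨s, t, hst, e0, e1⟩ : ∃ s t : ℝ, (s ≠ 0 ∨ t ≠ 0) ∧
        s * (N * w 0 + k * α w) + t * (N * V 0 + k * α V) = 0 ∧
        s * (N * w 1 + k * β w) + t * (N * V 1 + k * β V) = 0 := by
      by_cases hz : N * V 0 + k * α V = 0 ∧ N * V 1 + k * β V = 0
      · exact ⟨0, 1, by simp, by simp [hz.1], by simp [hz.2]⟩
      by_cases hz0 : N * V 0 + k * α V = 0
      · refine ⟨N * V 1 + k * β V, -(N * w 1 + k * β w), Or.inl fun h => hz ⟨hz0, h⟩, ?_, by ring⟩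
        linear_combination h0
      · refine ⟨N * V 0 + k * α V, -(N * w 0 + k * α w), Or.inl hz0, by ring, ?_⟩
        linear_combination -h0
    have hp := h s t hst
    set z : R23 := s • w + t • V with hz
    have hz0 : N * z 0 = -k * α z := by
      simp only [hz, map_add, map_smul, Pi.add_apply, Pi.smul_apply, smul_eq_mul]
      linear_combination e0
    have hz1 : N * z 1 = -k * β z := by
      simp only [hz, map_add, map_smul, Pi.add_apply, Pi.smul_apply, smul_eq_mul]
      linear_combination e1
    rw [form23_apply] at hp
    -- On the kernel the spacelike part of z is -k/N times (α z, β z), so it is no larger than the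
    -- timelike part, which contradicts ⟨z, z⟩ > 0.
    have h3 : N ^ 2 * (z 0 ^ 2 + z 1 ^ 2) = k ^ 2 * (α z ^ 2 + β z ^ 2) := by
      linear_combination (N * z 0 - k * α z) * hz0 + (N * z 1 - k * β z) * hz1
    have h4 : k ^ 2 * (α z ^ 2 + β z ^ 2) ≤ 1 * (α z ^ 2 + β z ^ 2) := by
      gcongr
      exact pow_le_one₀ hk.1 hk.2
    have h5 := mul_pos (pow_pos hN 2) hp
    have h6 := hle z
    have h7 : N ^ 2 * (z 0 * z 0 + z 1 * z 1 - z 2 * z 2 - z 3 * z 3 - z 4 * z 4) =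
      N ^ 2 * (z 0 ^ 2 + z 1 ^ 2) - N ^ 2 * (z 2 ^ 2 + z 3 ^ 2 + z 4 ^ 2) := by ring
    linarith
  have hg1 : 0 < g 1 := by
    by_contra hle1
    have hc : ContinuousOn g (Icc 0 1) := by
      simp only [hg]
      fun_prop
    obtain ⟨k, hk, hk0⟩ := intermediate_value_Icc' zero_le_one hc ⟨not_lt.1 hle1, hg0.le⟩
    exact hne k hk hk0
  simpa only [hg, one_mul] using hg1

/-- If `(w, V)` is a positively oriented spacelike pair, the quadric `w ∧ V` is positive. -/
theorem wedgeQuadric_isPositive {w V : R23} (h : ∀ s t : ℝ, s ≠ 0 ∨ t ≠ 0 →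
    0 < form23 (s • w + t • V) (s • w + t • V)) (ho : 0 < orient w V) :
    (wedgeQuadric w V).IsPositive := by
  intro v hv
  set N : ℝ := (v 0 ^ 2 + v 1 ^ 2 + v 2 ^ 2 + v 3 ^ 2) / 2 with hN
  have hNpos : 0 < N := by
    obtain ⟨i, hi⟩ := Function.ne_iff.1 hv
    have hi : 0 < v i ^ 2 := sq_pos_of_ne_zero hi
    have := Finset.single_le_sum (f := fun i => v i ^ 2) (fun i _ => sq_nonneg (v i))
      (Finset.mem_univ i)
    rw [Fin.sum_univ_four] at this
    rw [hN]
    linarith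
  -- The forms α and β are two rows of N times an orthogonal 3 × 3 matrix whose entries are
  -- quadratic in v. The third row is the square in the identity below, and dropping it gives the
  -- domination.
  let π : Fin 5 → R23 →ₗ[ℝ] ℝ := LinearMap.proj
  let α : R23 →ₗ[ℝ] ℝ := ((v 2 ^ 2 + v 3 ^ 2 - v 0 ^ 2 - v 1 ^ 2) / 2) • π 2
    + (v 0 * v 2 - v 1 * v 3) • π 3 - (v 1 * v 2 + v 0 * v 3) • π 4
  let β : R23 →ₗ[ℝ] ℝ := -(v 1 * v 3 + v 0 * v 2) • π 2
    + ((v 1 ^ 2 + v 2 ^ 2 - v 0 ^ 2 - v 3 ^ 2) / 2) • π 3 + (v 0 * v 1 - v 2 * v 3) • π 4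
  have hα : ∀ a, α a = (v 2 ^ 2 + v 3 ^ 2 - v 0 ^ 2 - v 1 ^ 2) / 2 * a 2
    + (v 0 * v 2 - v 1 * v 3) * a 3 - (v 1 * v 2 + v 0 * v 3) * a 4 := fun a => rfl
  have hβ : ∀ a, β a = -(v 1 * v 3 + v 0 * v 2) * a 2
    + (v 1 ^ 2 + v 2 ^ 2 - v 0 ^ 2 - v 3 ^ 2) / 2 * a 3 + (v 0 * v 1 - v 2 * v 3) * a 4 :=
    fun a => rfl
  have key := det_pos_of_dominated h ho hNpos α β fun a => by
    have : N ^ 2 * (a 2 ^ 2 + a 3 ^ 2 + a 4 ^ 2) = α a ^ 2 + β a ^ 2 +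
        ((v 1 * v 2 - v 0 * v 3) * a 2 + (v 0 * v 1 + v 2 * v 3) * a 3
          + (v 0 ^ 2 - v 1 ^ 2 + v 2 ^ 2 - v 3 ^ 2) / 2 * a 4) ^ 2 := by
      rw [hα, hβ, hN]
      ring
    rw [this]
    exact le_add_of_nonneg_right (sq_nonneg _)
  -- The value of w ∧ V at v, times N, is the determinant on (w, V) of the projection to ℝ^{2,0}
  -- perturbed by (α, β).
  have hdet : (N * w 0 + α w) * (N * V 1 + β V) - (N * w 1 + β w) * (N * V 0 + α V) =
      N * (wedgeQuadric w V).eval v v := by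
    rw [eval_wedgeQuadric_self, hα, hα, hβ, hβ, hN]
    simp [omega, cliff_apply]
    ring
  rw [hdet] at key
  exact (pos_iff_pos_of_mul_pos key).1 hNpos

/-! ### Orthonormal spacelike pairs -/

/-- `(w, V)` is an orthonormal basis of a spacelike plane. -/
structure IsSpacelikePair (w V : R23) : Prop where
  left : form23 w w = 1
  right : form23 V V = 1
  orthogonal : form23 w V = 0

namespace IsSpacelikePair

variable {w V : R23} (h : IsSpacelikePair w V)
include h

theorem form23_combination (s t : ℝ) : form23 (s • w + t • V) (s • w + t • V) = s ^ 2 + t ^ 2 := by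
  simp only [map_add, map_smul, LinearMap.add_apply, LinearMap.smul_apply, smul_eq_mul, h.left,
    h.right, h.orthogonal, form23_comm V w]
  ring

theorem pos (s t : ℝ) (hst : s ≠ 0 ∨ t ≠ 0) :
    0 < form23 (s • w + t • V) (s • w + t • V) := by
  rw [h.form23_combination]
  rcases hst with h | h
  · have := sq_nonneg t; positivity
  · have := sq_nonneg s; positivity

theorem symm : IsSpacelikePair V w := ⟨h.right, h.left, by rw [form23_comm, h.orthogonal]⟩

theorem neg_right : IsSpacelikePair w (-V) := ⟨h.left, by simp [h.right], by simp [h.orthogonal]⟩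

theorem neg_left : IsSpacelikePair (-w) V := ⟨by simp [h.left], h.right, by simp [h.orthogonal]⟩

end IsSpacelikePair

theorem orient_swap (a b : R23) : orient a b = -orient b a := by
  simp only [orient]; ring

theorem orient_neg_right (a b : R23) : orient a (-b) = -orient a b := by
  simp only [orient, Pi.neg_apply]; ring

theorem orient_neg_left (a b : R23) : orient (-a) b = -orient a b := by
  simp only [orient, Pi.neg_apply]; ring

/-- The projection of a spacelike plane to `ℝ^{2,0}` is injective. -/
theorem orient_ne_zero_of_spacelike {a b : R23} (h : ∀ s t : ℝ, s ≠ 0 ∨ t ≠ 0 →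
    0 < form23 (s • a + t • b) (s • a + t • b)) : orient a b ≠ 0 := by
  intro h0
  have key : ∀ s t : ℝ, s * a 0 + t * b 0 = 0 → s * a 1 + t * b 1 = 0 → ¬(s ≠ 0 ∨ t ≠ 0) := by
    intro s t e0 e1 hst
    have := h s t hst
    rw [form23_apply] at this
    simp only [Pi.add_apply, Pi.smul_apply, smul_eq_mul, e0, e1] at this
    linarith [mul_self_nonneg (s * a 2 + t * b 2), mul_self_nonneg (s * a 3 + t * b 3),
      mul_self_nonneg (s * a 4 + t * b 4)]
  simp only [orient] at h0
  have h1 := key (b 1) (-a 1) (by linear_combination h0) (by ring)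
  have h2 := key (b 0) (-a 0) (by ring) (by linear_combination -h0)
  push Not at h1 h2
  exact key 1 0 (by simpa using h2.2) (by simpa using h1.2) (by simp)

theorem IsSpacelikePair.orient_ne_zero {w V : R23} (h : IsSpacelikePair w V) : orient w V ≠ 0 :=
  orient_ne_zero_of_spacelike h.pos

/-- The orthogonal complement of a spacelike plane is negative definite. -/
theorem IsSpacelikePair.form23_neg {w V z : R23} (h : IsSpacelikePair w V) (hz : z ≠ 0)
    (hw : form23 z w = 0) (hV : form23 z V = 0) : form23 z z < 0 := by
  have ho := h.orient_ne_zero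
  -- By Cramer's rule, s and t are chosen so that z - (sw + tV) has no component in ℝ^{2,0}; its
  -- norm is therefore nonpositive, and it equals ⟨z, z⟩ + s² + t².
  set s : ℝ := (z 0 * V 1 - z 1 * V 0) / orient w V with hs
  set t : ℝ := (z 1 * w 0 - z 0 * w 1) / orient w V with ht
  have e0 : z 0 = s * w 0 + t * V 0 := by
    rw [hs, ht]; field_simp; simp only [orient]; ring
  have e1 : z 1 = s * w 1 + t * V 1 := by
    rw [hs, ht]; field_simp; simp only [orient]; ring
  have h1 : form23 (z - (s • w + t • V)) (z - (s • w + t • V)) = form23 z z + (s ^ 2 + t ^ 2) := by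
    rw [map_sub, map_sub, LinearMap.sub_apply, LinearMap.sub_apply, h.form23_combination,
      form23_comm (s • w + t • V) z]
    simp only [map_add, map_smul, hw, hV, smul_eq_mul]
    ring
  set y := z - (s • w + t • V) with hy
  have y0 : y 0 = 0 := by simp [hy, e0]
  have y1 : y 1 = 0 := by simp [hy, e1]
  rw [form23_apply y, y0, y1] at h1
  by_contra hn
  have h2 : y 2 * y 2 + y 3 * y 3 + y 4 * y 4 + s ^ 2 + t ^ 2 ≤ 0 := by linarith
  have hs2 := sq_nonneg s
  have ht2 := sq_nonneg t
  have h22 := mul_self_nonneg (y 2)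
  have h33 := mul_self_nonneg (y 3)
  have h44 := mul_self_nonneg (y 4)
  have hs0 : s = 0 := pow_eq_zero_iff two_ne_zero |>.1 (by linarith)
  have ht0 : t = 0 := pow_eq_zero_iff two_ne_zero |>.1 (by linarith)
  have hyz : y = z := by rw [hy, hs0, ht0]; simp
  apply hz
  rw [← hyz]
  ext i
  fin_cases i
  · exact y0
  · exact y1
  · exact mul_self_eq_zero.1 (by linarith : y 2 * y 2 = 0)
  · exact mul_self_eq_zero.1 (by linarith : y 3 * y 3 = 0)
  · exact mul_self_eq_zero.1 (by linarith : y 4 * y 4 = 0)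

theorem IsSpacelikePair.form23_nonpos {w V z : R23} (h : IsSpacelikePair w V)
    (hw : form23 z w = 0) (hV : form23 z V = 0) : form23 z z ≤ 0 := by
  by_cases hz : z = 0
  · simp [hz]
  · exact (h.form23_neg hz hw hV).le

/-! ### Positivity of `w ∧ V + p ∧ n` -/

theorem eval_wedgeQuadric_of_orthogonal {a b : R23} (h : form23 a b = 0) (v w : V4) :
    (wedgeQuadric a b).eval v w = -(1 / 2) * omega (cliff a (cliff b v)) w := by
  rw [eval_wedgeQuadric, cliff_cliff_of_orthogonal (form23_comm a b ▸ h : form23 b a = 0),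
    sub_neg_eq_add, omega_add_left]
  ring

/-- An infinitesimal rotation of a positively oriented spacelike plane plus a smaller
infinitesimal rotation of the orthogonal timelike plane is positive. -/
theorem wedgeQuadric_add_isPositive {p w V n : R23} (hwV : IsSpacelikePair w V)
    (ho : 0 < orient w V) (hpp : form23 p p = -1) (hpw : form23 p w = 0) (hpV : form23 p V = 0)
    (hnp : form23 n p = 0) (hnw : form23 n w = 0) (hnV : form23 n V = 0) (hn : -1 < form23 n n) :
    (wedgeQuadric w V + wedgeQuadric p n).IsPositive := by
  intro v hv
  have hpos := wedgeQuadric_isPositive hwV.pos ho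
  have hG := hpos v hv
  -- Let G be the positive form w ∧ V. The operator v ↦ x scales G by -⟨n,n⟩, and G(x, v) is the
  -- value of p ∧ n at v. Expanding G(x + v, x + v) ≥ 0 bounds that value below by -(1 - ⟨n,n⟩)/2 ·
  -- G(v, v), which leaves at least (1 + ⟨n,n⟩)/2 · G(v, v) in the sum.
  set x := -cliff w (cliff V (cliff p (cliff n v))) with hx
  have hpn : form23 p n = 0 := by rw [form23_comm, hnp]
  have hK : 0 ≤ (wedgeQuadric w V).eval (x + v) (x + v) := by
    by_cases h0 : x + v = 0
    · rw [h0]; simp [Quadric.eval]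
    · exact (hpos _ h0).le
  have hcomm : ∀ y, cliff w (cliff V (cliff p (cliff n y))) =
      cliff p (cliff n (cliff w (cliff V y))) := fun y => by
    rw [cliff_cliff_of_orthogonal (form23_comm p V ▸ hpV : form23 V p = 0),
      cliff_cliff_of_orthogonal (form23_comm n V ▸ hnV : form23 V n = 0), map_neg, map_neg, map_neg,
      neg_neg, cliff_cliff_of_orthogonal (form23_comm p w ▸ hpw : form23 w p = 0),
      cliff_cliff_of_orthogonal (form23_comm n w ▸ hnw : form23 w n = 0), map_neg, neg_neg]
  have hBB : ∀ y, cliff w (cliff V (cliff w (cliff V y))) = -y := fun y => by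
    rw [cliff_cliff_of_orthogonal (hwV.symm.orthogonal), map_neg, cliff_sq, cliff_sq, hwV.left,
      hwV.right]
    simp
  have hCC : ∀ y, cliff p (cliff n (cliff p (cliff n y))) = form23 n n • y := fun y => by
    rw [cliff_cliff_of_orthogonal hnp, map_neg, cliff_sq, cliff_sq, hpp]
    simp
  have hB : ∀ y z, omega (cliff w (cliff V y)) z = -omega y (cliff w (cliff V z)) := fun y z => by
    rw [omega_cliff_left, omega_cliff_left, cliff_cliff_of_orthogonal hwV.symm.orthogonal,
      omega_neg_right]
  have hC : ∀ y z, omega (cliff p (cliff n y)) z = -omega y (cliff p (cliff n z)) := fun y z => by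
    rw [omega_cliff_left, omega_cliff_left, cliff_cliff_of_orthogonal hnp, omega_neg_right]
  have e1 : (wedgeQuadric w V).eval x x = -form23 n n * (wedgeQuadric w V).eval v v := by
    rw [eval_wedgeQuadric_of_orthogonal hwV.orthogonal, eval_wedgeQuadric_of_orthogonal hwV.orthogonal,
      hx, map_neg, map_neg, omega_neg_left, omega_neg_right, hBB, omega_neg_left, hcomm, hC, hCC,
      omega_smul_right, hB]
    ring
  have e2 : (wedgeQuadric w V).eval x v = (wedgeQuadric p n).eval v v := by
    rw [eval_wedgeQuadric_of_orthogonal hwV.orthogonal, eval_wedgeQuadric_of_orthogonal hpn,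
      hx, map_neg, map_neg, omega_neg_left, hBB, omega_neg_left]
    ring
  rw [Quadric.eval_add_left, Quadric.eval_add_right, Quadric.eval_add_right, e1, e2,
    Quadric.eval_comm _ v x, e2] at hK
  rw [Quadric.eval_add]
  linarith [mul_pos (neg_lt_iff_pos_add.1 hn) hG]

/-! ### Lagrangians of isotropic vectors -/

theorem exists_form23_ne_zero {a : R23} (ha : a ≠ 0) : ∃ b, form23 a b ≠ 0 := by
  by_contra! h
  apply ha
  ext i
  have := h (Pi.single i 1)
  rw [form23_apply] at this
  fin_cases i <;> simpa using this

/-- An isotropic vector acts with square zero. Conversely, if it kills z, pairing it with some b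
such that ⟨a,b⟩ ≠ 0 in the Clifford relation exhibits z in its image. -/
theorem mem_lagrangianOf_iff {a : R23} (ha : a ≠ 0) (h0 : form23 a a = 0) (z : V4) :
    z ∈ lagrangianOf a ↔ cliff a z = 0 := by
  rw [lagrangianOf_eq_range]
  constructor
  · rintro ⟨y, rfl⟩
    rw [cliff_sq, h0]
    simp
  · intro hz
    obtain ⟨b, hb⟩ := exists_form23_ne_zero ha
    refine ⟨(-(2 * form23 a b))⁻¹ • cliff b z, ?_⟩
    have := cliff_cliff_add a b z
    rw [hz, map_zero, add_zero] at this
    rw [map_smul, this, smul_smul, inv_mul_cancel₀ (by simpa using hb), one_smul]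

theorem isLagrangian_lagrangianOf {a : R23} (ha : a ≠ 0) (h0 : form23 a a = 0) :
    IsLagrangian (lagrangianOf a) := by
  constructor
  · have h := LinearMap.finrank_range_add_finrank_ker (cliff a)
    have : LinearMap.ker (cliff a) = LinearMap.range (cliff a) := by
      ext z
      rw [LinearMap.mem_ker, ← mem_lagrangianOf_iff ha h0, lagrangianOf_eq_range]
    rw [this, Module.finrank_fin_fun] at h
    rw [lagrangianOf_eq_range]
    omega
  · rintro v hv w hw
    rw [lagrangianOf_eq_range] at hv
    obtain ⟨y, rfl⟩ := hv
    rw [omega_cliff_left, (mem_lagrangianOf_iff ha h0 w).1 hw]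
    simp [omega]

theorem lagrangianOf_smul {c : ℝ} (hc : c ≠ 0) (a : R23) :
    lagrangianOf (c • a) = lagrangianOf a := by
  rw [lagrangianOf_eq_range, lagrangianOf_eq_range, map_smul, LinearMap.range_smul _ _ hc]

/-! ### Endpoints of geodesics -/

/-- `w` is a unit spacelike vector tangent to `ℍ^{2,2}` at the point `p`. -/
structure IsUnitTangentAt (p w : R23) : Prop where
  point : form23 p p = -1
  unit : form23 w w = 1
  orthogonal : form23 p w = 0

namespace IsUnitTangentAt

variable {p w : R23} (h : IsUnitTangentAt p w)
include h

theorem neg : IsUnitTangentAt p (-w) :=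
  ⟨h.point, by simp [h.unit], by simp [h.orthogonal]⟩

theorem isotropic : form23 (p + w) (p + w) = 0 := by
  simp [h.point, h.unit, h.orthogonal, form23_comm w p]

theorem ne_zero : p + w ≠ 0 := fun h0 => by
  have : form23 p (p + w) = 0 := by rw [h0, map_zero]
  simp [h.point, h.orthogonal] at this

theorem isLagrangian : IsLagrangian (lagrangianOf (p + w)) :=
  isLagrangian_lagrangianOf h.ne_zero h.isotropic

/-- Since p squares to 1 and anticommutes with w, which squares to -1, the product pw is an
involution. The Lagrangians of the two endpoints are its eigenspaces for -1 and 1. -/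
theorem mem_iff (z : V4) : z ∈ lagrangianOf (p + w) ↔ cliff p (cliff w z) = -z := by
  rw [mem_lagrangianOf_iff h.ne_zero h.isotropic, map_add, LinearMap.add_apply]
  constructor
  · intro hz
    rw [eq_neg_of_add_eq_zero_right hz, map_neg, cliff_sq, h.point]
    simp
  · intro hz
    have := congrArg (cliff p) hz
    rw [cliff_sq, h.point, map_neg] at this
    simp only [neg_neg, one_smul] at this
    rw [this]
    simp

theorem mem_neg_iff (z : V4) : z ∈ lagrangianOf (p - w) ↔ cliff p (cliff w z) = z := by
  rw [sub_eq_add_neg, h.neg.mem_iff]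
  simp

theorem isLagrangianQuadric :
    IsLagrangianQuadric (lagrangianOf (p + w)) (lagrangianOf (p - w)) (wedgeQuadric p w) := by
  have hT : ∀ z, cliff p (cliff w (cliff p (cliff w z))) = z := fun z => by
    rw [cliff_cliff_of_orthogonal (form23_comm p w ▸ h.orthogonal : form23 w p = 0), map_neg,
      cliff_sq, cliff_sq, h.point, h.unit]
    simp
  refine ⟨h.isLagrangian, by rw [sub_eq_add_neg]; exact h.neg.isLagrangian, ⟨?_, ?_⟩, ?_⟩
  · rw [Submodule.disjoint_def]
    intro z hz hz'
    rw [h.mem_iff] at hz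
    rw [h.mem_neg_iff, hz] at hz'
    exact self_eq_neg.1 hz'.symm
  · rw [codisjoint_iff_le_sup]
    intro z _
    rw [Submodule.mem_sup]
    refine ⟨(1 / 2 : ℝ) • (z - cliff p (cliff w z)), ?_, (1 / 2 : ℝ) • (z + cliff p (cliff w z)), ?_, ?_⟩
    · rw [h.mem_iff, map_smul, map_smul, map_sub, map_sub, hT]
      module
    · rw [h.mem_neg_iff, map_smul, map_smul, map_add, map_add, hT]
      module
    · module
  · intro a ha c hc
    rw [h.mem_iff] at ha
    rw [h.mem_neg_iff] at hc
    rw [eval_wedgeQuadric_self, map_add, map_add, ha, hc]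
    simp only [omega_add_left, omega_add_right, omega_neg_left, omega_self]
    rw [omega_swap c a]
    ring

theorem isLagrangianQuadric_iff {q : Quadric} :
    IsLagrangianQuadric (lagrangianOf (p + w)) (lagrangianOf (p - w)) q ↔ q = wedgeQuadric p w := by
  constructor
  · intro hq
    refine Quadric.ext_eval fun v => ?_
    obtain ⟨a, ha, c, hc, rfl⟩ := Submodule.mem_sup.1
      (hq.2.2.1.sup_eq_top ▸ Submodule.mem_top : v ∈ _ ⊔ _)
    rw [hq.2.2.2 a ha c hc, h.isLagrangianQuadric.2.2.2 a ha c hc]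
  · rintro rfl
    exact h.isLagrangianQuadric

/-- On the Lagrangian of p + w, the vectors p and w act oppositely. This converts the indefinite
quadric p ∧ V into the quadric w ∧ V, whose sign is known. -/
theorem eval_of_mem {V : R23} (hV : form23 p V = 0) (hwV : form23 w V = 0) {z : V4}
    (hz : z ∈ lagrangianOf (p + w)) :
    (wedgeQuadric p V).eval z z = -(wedgeQuadric w V).eval z z := by
  rw [mem_lagrangianOf_iff h.ne_zero h.isotropic, map_add, LinearMap.add_apply] at hz
  rw [eval_wedgeQuadric_of_orthogonal hV, eval_wedgeQuadric_of_orthogonal hwV,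
    cliff_cliff_of_orthogonal hV, cliff_cliff_of_orthogonal hwV, eq_neg_of_add_eq_zero_left hz]
  simp only [map_neg, omega_neg_left]
  ring

end IsUnitTangentAt

/-! ### Maximal triples -/

theorem linearIndependent_of_pairing {x y : Fin 2 → V4}
    (hxy : ∀ i j, omega (x i) (y j) = if i = j then 1 else 0) : LinearIndependent ℝ x := by
  rw [Fintype.linearIndependent_iff]
  intro g hg j
  have h : omega (∑ i, g i • x i) (y j) = 0 := by rw [hg]; simp [omega]
  rw [omega_sum_left] at h
  simpa [omega_smul_left, hxy] using h

theorem span_eq_of_linearIndependent {ℓ : Submodule ℝ V4} (hℓ : Module.finrank ℝ ℓ = 2)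
    {x : Fin 2 → V4} (hx : LinearIndependent ℝ x) (hmem : ∀ i, x i ∈ ℓ) :
    ℓ = Submodule.span ℝ (range x) := by
  symm
  apply Submodule.eq_of_le_of_finrank_eq
  · rw [Submodule.span_le]
    rintro _ ⟨i, rfl⟩
    exact hmem i
  · rw [finrank_span_eq_card hx, hℓ, Fintype.card_fin]

/-- A quadric which is positive on a plane has an orthonormal basis there. -/
theorem exists_orthonormal_of_isPositiveOn {q : Quadric} {ℓ : Submodule ℝ V4}
    (hℓ : Module.finrank ℝ ℓ = 2) (hq : q.IsPositiveOn ℓ) :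
    ∃ z : Fin 2 → V4, (∀ i, z i ∈ ℓ) ∧ ∀ i j, q.eval (z i) (z j) = if i = j then 1 else 0 := by
  have key : ∀ v ∈ ℓ, v ≠ 0 → ∃ c : ℝ, c ≠ 0 ∧ q.eval (c • v) (c • v) = 1 := fun v hv h0 => by
    have := hq v hv h0
    refine ⟨(Real.sqrt (q.eval v v))⁻¹, inv_ne_zero (Real.sqrt_ne_zero'.2 this), ?_⟩
    rw [Quadric.eval_smul_left, Quadric.eval_smul_right, ← mul_assoc, ← mul_inv,
      Real.mul_self_sqrt this.le, inv_mul_cancel₀ this.ne']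
  have b := Module.finBasisOfFinrankEq ℝ ℓ hℓ
  have hb : LinearIndependent ℝ fun i => (b i : V4) :=
    b.linearIndependent.map' ℓ.subtype ℓ.ker_subtype
  rw [show (fun i => (b i : V4)) = ![(b 0 : V4), b 1] by ext i; fin_cases i <;> rfl,
    LinearIndependent.pair_iff] at hb
  have h0 : (b 0 : V4) ≠ 0 := fun h => by
    have := (hb 1 0 (by simp [h])).1
    exact one_ne_zero this
  obtain ⟨c, hc, hc1⟩ := key _ (b 0).2 h0
  set z := c • (b 0 : V4) with hz
  have hzℓ : z ∈ ℓ := ℓ.smul_mem _ (b 0).2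
  set y := (b 1 : V4) - q.eval (b 1) z • z with hy
  have hyℓ : y ∈ ℓ := ℓ.sub_mem (b 1).2 (ℓ.smul_mem _ hzℓ)
  have hy0 : y ≠ 0 := fun h => by
    have := (hb (-(q.eval (b 1) z * c)) 1 (by rw [← h, hy, hz]; module)).2
    exact one_ne_zero this
  have hyz : q.eval y z = 0 := by
    have hn : y = (b 1 : V4) + (-q.eval (b 1) z) • z := by rw [hy]; module
    rw [hn, Quadric.eval_add_left, Quadric.eval_smul_left, hc1]
    ring
  obtain ⟨d, hd, hd1⟩ := key y hyℓ hy0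
  refine ⟨![z, d • y], ?_, ?_⟩
  · intro i
    fin_cases i
    · exact hzℓ
    · exact ℓ.smul_mem _ hyℓ
  · intro i j
    fin_cases i <;> fin_cases j
    · simpa using hc1
    · simp [Quadric.eval_comm q z, Quadric.eval_smul_left, hyz]
    · simp [Quadric.eval_smul_left, hyz]
    · simpa using hd1

/-- If `q_{ℓ₁,ℓ₃}` is positive on `ℓ₂`, then the triple `(ℓ₁, ℓ₂, ℓ₃)` is maximal. -/
theorem IsLagrangianQuadric.isMaximalTriple {ℓ₁ ℓ₂ ℓ₃ : Submodule ℝ V4} {q : Quadric}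
    (hq : IsLagrangianQuadric ℓ₁ ℓ₃ q) (hℓ : IsLagrangian ℓ₂) (hpos : q.IsPositiveOn ℓ₂) :
    IsMaximalTriple ℓ₁ ℓ₂ ℓ₃ := by
  obtain ⟨h1, h3, hc, hv⟩ := hq
  -- The components of a q-orthonormal basis of ℓ₂ form the required symplectic basis: ω(xᵢ, yⱼ) is
  -- symmetric because ℓ₂ is Lagrangian, and its symmetrization is the polarization of q.
  obtain ⟨z, hz, hzq⟩ := exists_orthonormal_of_isPositiveOn hℓ.1 hpos
  have hdec : ∀ i, ∃ x ∈ ℓ₁, ∃ y ∈ ℓ₃, x + y = z i := fun i =>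
    Submodule.mem_sup.1 (hc.sup_eq_top ▸ Submodule.mem_top : z i ∈ ℓ₁ ⊔ ℓ₃)
  choose x hx y hy hxy using hdec
  have hxx : ∀ i j, omega (x i) (x j) = 0 := fun i j => h1.2 _ (hx i) _ (hx j)
  have hyy : ∀ i j, omega (y i) (y j) = 0 := fun i j => h3.2 _ (hy i) _ (hy j)
  have hdiag : ∀ i j, omega (x i) (y j) = if i = j then 1 else 0 := by
    intro i j
    have e1 : omega (z i) (z j) = 0 := hℓ.2 _ (hz i) _ (hz j)
    have e2 := hv (x i + x j) (ℓ₁.add_mem (hx i) (hx j)) (y i + y j) (ℓ₃.add_mem (hy i) (hy j))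
    have e3 : ∀ k, omega (x k) (y k) = 1 := fun k => by
      rw [← hv _ (hx k) _ (hy k), hxy, hzq, if_pos rfl]
    rw [show x i + x j + (y i + y j) = z i + z j by rw [← hxy, ← hxy]; abel] at e2
    rw [← hxy, ← hxy] at e1
    simp only [omega_add_left, omega_add_right, Quadric.eval_add_left, Quadric.eval_add_right,
      hxx, hyy, hzq, e3, if_true] at e1 e2
    rw [omega_swap (y i)] at e1
    rw [if_congr (eq_comm (a := j) (b := i)) rfl rfl] at e2
    linarith
  refine ⟨x, y, ⟨hxx, hyy, hdiag⟩, ?_, ?_, ?_⟩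
  · exact span_eq_of_linearIndependent h1.1 (linearIndependent_of_pairing hdiag) hx
  · have hz' : (fun i => x i + y i) = z := funext hxy
    rw [hz']
    refine span_eq_of_linearIndependent hℓ.1 (linearIndependent_of_pairing (y := y) ?_) hz
    intro i j
    rw [← hxy, omega_add_left, hyy, hdiag, add_zero]
  · refine span_eq_of_linearIndependent h3.1 (linearIndependent_of_pairing (y := fun i => -x i) ?_) hy
    intro i j
    rw [omega_neg_right, omega_swap, neg_neg, hdiag]
    exact if_congr eq_comm rfl rfl

/-- The quadric of the pair (p - V, p + V) is -p ∧ V, which restricts to w ∧ V on the Lagrangian of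
p + w. Maximality is thus the positivity of w ∧ V there, and the orientation decides its sign. -/
theorem isMaximalTriple_iff {p w V : R23} (hw : IsUnitTangentAt p w) (hV : IsUnitTangentAt p V)
    (hwV : form23 w V = 0) :
    IsMaximalTriple (lagrangianOf (p - V)) (lagrangianOf (p + w)) (lagrangianOf (p + V)) ↔
      0 < orient w V := by
  have hpair : IsSpacelikePair w V := ⟨hw.unit, hV.unit, hwV⟩
  constructor
  · rintro ⟨x, y, ⟨_, _, hxy⟩, h1, h2, h3⟩
    rcases lt_or_gt_of_ne hpair.orient_ne_zero with hlt | hgt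
    · exfalso
      have hx : x 0 ∈ lagrangianOf (p - V) := h1 ▸ Submodule.subset_span ⟨0, rfl⟩
      have hz : x 0 + y 0 ∈ lagrangianOf (p + w) := h2 ▸ Submodule.subset_span ⟨0, rfl⟩
      have hy : y 0 ∈ lagrangianOf (p + V) := h3 ▸ Submodule.subset_span ⟨0, rfl⟩
      -- In a maximal triple, w ∧ V takes the value ω(x₀, y₀) = 1 at x₀ + y₀, whereas it is negative
      -- definite for the opposite orientation.
      have e := hV.isLagrangianQuadric.2.2.2 _ hy _ hx
      rw [add_comm, hw.eval_of_mem hV.orthogonal hwV hz, omega_swap, hxy, if_pos rfl] at e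
      have hpos := wedgeQuadric_isPositive hpair.neg_right.pos
        (by rw [orient_neg_right]; linarith) (x 0 + y 0) (fun h0 => by
          rw [h0] at e; simp [Quadric.eval] at e)
      rw [map_neg, Quadric.eval_neg] at hpos
      linarith
    · exact hgt
  · intro ho
    have hq := hV.neg.isLagrangianQuadric
    rw [sub_neg_eq_add, ← sub_eq_add_neg] at hq
    refine hq.isMaximalTriple hw.isLagrangian fun z hz hz0 => ?_
    rw [map_neg, Quadric.eval_neg, hw.eval_of_mem hV.orthogonal hwV hz, neg_neg]
    exact wedgeQuadric_isPositive hpair.pos ho z hz0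

/-! ### The trace pairing -/

/-- The tensor in `S²V` corresponding to a quadric by the identification of `V` with `V*`. -/
def dualTensor (q : Quadric) : Matrix (Fin 4) (Fin 4) ℝ :=
  !![q.1 2 2, q.1 2 3, -q.1 2 0, -q.1 2 1;
    q.1 3 2, q.1 3 3, -q.1 3 0, -q.1 3 1;
    -q.1 0 2, -q.1 0 3, q.1 0 0, q.1 0 1;
    -q.1 1 2, -q.1 1 3, q.1 1 0, q.1 1 1]

/-- The tensor is congruent to q through the matrix of ω. -/
theorem dualTensor_posDef {q : Quadric} (hq : q.IsPositive) : (dualTensor q).PosDef := by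
  refine Matrix.PosDef.of_dotProduct_mulVec_pos ?_ ?_
  · ext i j
    fin_cases i <;> fin_cases j <;> simp [dualTensor, q.2 _ _]
  · intro x hx
    have := hq ![x 2, x 3, -x 0, -x 1] fun h => hx (by
      have h0 := congrFun h 0
      have h1 := congrFun h 1
      have h2 := congrFun h 2
      have h3 := congrFun h 3
      simp at h0 h1 h2 h3
      ext i
      fin_cases i <;> simp [h0, h1, h2, h3])
    simp [Quadric.eval, Fin.sum_univ_four] at this
    simp [dualTensor, Matrix.mulVec, dotProduct, Fin.sum_univ_four]
    linarith

/-- The invariant scalar product of quadrics. -/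
def tracePairing (q q' : Quadric) : ℝ := ∑ i, ∑ j, dualTensor q i j * q'.1 i j

/-- With the normalization of `wedgeQuadric`, the trace pairing is exactly the scalar product
induced on Λ²ℝ^{2,3}. Orthogonality of quadrics can then be read from orthogonality of vectors. -/
theorem tracePairing_wedgeQuadric (a b c d : R23) :
    tracePairing (wedgeQuadric a b) (wedgeQuadric c d) =
      form23 a c * form23 b d - form23 a d * form23 b c := by
  have h : ∀ (a b : R23) (i j : Fin 4), (wedgeQuadric a b).1 i j =
    -(1 / 4) * omega (cliff a (cliff b (Pi.single i 1)) - cliff b (cliff a (Pi.single i 1)))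
      (Pi.single j 1) := wedgeQuadric_coe
  simp only [tracePairing, Fin.sum_univ_four, dualTensor, h, form23_apply]
  simp [omega, cliff_apply]
  ring

theorem tracePairing_add_left (q q' r : Quadric) :
    tracePairing (q + q') r = tracePairing q r + tracePairing q' r := by
  simp [tracePairing, dualTensor, Fin.sum_univ_four]; ring

theorem tracePairing_smul_left (c : ℝ) (q r : Quadric) :
    tracePairing (c • q) r = c * tracePairing q r := by
  simp [tracePairing, dualTensor, Fin.sum_univ_four]; ring

theorem tracePairing_add_right (q r r' : Quadric) :
    tracePairing q (r + r') = tracePairing q r + tracePairing q r' := by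
  simp [tracePairing, dualTensor, Fin.sum_univ_four]; ring

theorem tracePairing_smul_right (c : ℝ) (q r : Quadric) :
    tracePairing q (c • r) = c * tracePairing q r := by
  simp [tracePairing, dualTensor, Fin.sum_univ_four]; ring

/-- The action of quadrics, seen as elements of the Lie algebra of the group of isometries of
`ℝ^{2,3}`, on vectors of `ℝ^{2,3}`, up to sign. -/
def contract : R23 →ₗ[ℝ] Quadric →ₗ[ℝ] R23 :=
  LinearMap.mk₂ ℝ (fun p q i => -((form23 (Pi.single i 1) (Pi.single i 1)) *
      tracePairing (wedgeQuadric p (Pi.single i 1)) q))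
    (fun p p' q => by
      ext i
      simp only [map_add, LinearMap.add_apply, tracePairing_add_left, Pi.add_apply]; ring)
    (fun c p q => by
      ext i
      simp only [map_smul, LinearMap.smul_apply, tracePairing_smul_left, Pi.smul_apply,
        smul_eq_mul]; ring)
    (fun p q q' => by
      ext i
      simp only [tracePairing_add_right, Pi.add_apply]; ring)
    (fun c p q => by
      ext i
      simp only [tracePairing_smul_right, Pi.smul_apply, smul_eq_mul]; ring)

/-- The contraction with p inverts V ↦ p ∧ V on p^⊥. Being bilinear, it recovers the tangent vector
smoothly from an element of a pencil. -/
theorem contract_wedgeQuadric {p V : R23} (hp : form23 p p = -1) (hV : form23 p V = 0) :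
    contract p (wedgeQuadric p V) = V := by
  ext i
  change -((form23 (Pi.single i 1) (Pi.single i 1)) *
      tracePairing (wedgeQuadric p (Pi.single i 1)) (wedgeQuadric p V)) = V i
  rw [tracePairing_wedgeQuadric, hp, hV, form23_apply, form23_apply]
  fin_cases i <;> simp

theorem isMixedPencil_of_orthogonal {P : Submodule ℝ Quadric} {q : Quadric} (hq : q.IsPositive)
    (h : ∀ r ∈ P, tracePairing q r = 0) : IsMixedPencil P :=
  ⟨dualTensor q, dualTensor_posDef hq, h⟩

/-- The quadric p ∧ w vanishes on the Lagrangian of p + w, where pw acts as -1. -/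
theorem IsUnitTangentAt.not_isPositive_smul {p w : R23} (h : IsUnitTangentAt p w) (c : ℝ) :
    ¬(c • wedgeQuadric p w).IsPositive := by
  intro hpos
  have : Nontrivial (lagrangianOf (p + w)) :=
    Module.nontrivial_of_finrank_pos (R := ℝ) (by rw [h.isLagrangian.1]; norm_num)
  obtain ⟨z, hz⟩ := exists_ne (0 : lagrangianOf (p + w))
  have hlt := hpos z (by simpa using hz)
  rw [Quadric.eval_smul, eval_wedgeQuadric_self, (h.mem_iff _).1 z.2, omega_neg_left,
    omega_self] at hlt
  simp at hlt

/-! ### Homotopies of loops of Lagrangians -/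

/-- With the preimages of a basis at x kept fixed, their images under the varying Clifford maps
remain in the planes and remain independent nearby. -/
theorem isContinuousPlaneFamily_lagrangianOf {X : Type*} [TopologicalSpace X] {v : X → R23}
    (hv : Continuous v) (h0 : ∀ x, v x ≠ 0) (hiso : ∀ x, form23 (v x) (v x) = 0) :
    IsContinuousPlaneFamily fun x => lagrangianOf (v x) := by
  intro x
  have hfr := (isLagrangian_lagrangianOf (h0 x) (hiso x)).1
  have b := Module.finBasisOfFinrankEq ℝ (lagrangianOf (v x)) hfr
  have hmem : ∀ i, ∃ y, cliff (v x) y = b i := fun i => by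
    have h : ∀ z ∈ lagrangianOf (v x), ∃ y, cliff (v x) y = z := fun z hz => by
      rwa [lagrangianOf_eq_range] at hz
    exact h _ (b i).2
  choose y hy using hmem
  have hcont : Continuous fun z => fun i => cliff (v z) (y i) := by
    refine continuous_pi fun i => ?_
    exact (LinearMap.continuous_of_finiteDimensional (cliff.flip (y i))).comp hv
  have hli : LinearIndependent ℝ fun i => cliff (v x) (y i) := by
    simp only [hy]
    exact b.linearIndependent.map' (lagrangianOf (v x)).subtype (Submodule.ker_subtype _)
  have hopen := hcont.continuousAt.eventually hli.eventually
  refine ⟨_, hopen, fun i z => cliff (v z) (y i),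
    fun i => ((continuous_apply i).comp hcont).continuousOn, fun z hz => ⟨hz, ?_⟩⟩
  symm
  refine span_eq_of_linearIndependent (isLagrangian_lagrangianOf (h0 z) (hiso z)).1 hz fun i => ?_
  rw [lagrangianOf_eq_range]
  exact ⟨_, rfl⟩

/-- Free homotopy of `2π`-periodic loops of nonzero vectors. -/
def LoopHomotopic {E : Type*} [TopologicalSpace E] [Zero E] (f g : ℝ → E) : Prop :=
  ∃ H : ℝ × ℝ → E, Continuous H ∧ (∀ p, H p ≠ 0) ∧ (∀ s θ, H (s, θ + 2 * Real.pi) = H (s, θ)) ∧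
    (∀ θ, H (0, θ) = f θ) ∧ ∀ θ, H (1, θ) = g θ

theorem LoopHomotopic.trans {E : Type*} [TopologicalSpace E] [Zero E] {f g h : ℝ → E}
    (h₁ : LoopHomotopic f g) (h₂ : LoopHomotopic g h) : LoopHomotopic f h := by
  obtain ⟨H, hc, hn, hp, h0, h1⟩ := h₁
  obtain ⟨K, kc, kn, kp, k0, k1⟩ := h₂
  refine ⟨fun p => if p.1 ≤ 1 / 2 then H (2 * p.1, p.2) else K (2 * p.1 - 1, p.2), ?_, ?_, ?_, ?_, ?_⟩
  · refine Continuous.if_le (by fun_prop) (by fun_prop) continuous_fst continuous_const ?_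
    rintro ⟨s, θ⟩ (rfl : s = 1 / 2)
    norm_num [h1, k0]
  · intro p
    dsimp only
    split_ifs
    · exact hn _
    · exact kn _
  · intro s θ
    simp only [hp, kp]
  · intro θ
    norm_num [h0]
  · intro θ
    norm_num [k1]

theorem LoopHomotopic.segment {E : Type*} [TopologicalSpace E] [AddCommGroup E] [Module ℝ E]
    [ContinuousAdd E] [ContinuousSMul ℝ E] {f g : ℝ → E} (hf : Continuous f) (hg : Continuous g)
    (hfp : ∀ θ, f (θ + 2 * Real.pi) = f θ) (hgp : ∀ θ, g (θ + 2 * Real.pi) = g θ)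
    (h : ∀ s : ℝ, 0 ≤ s → s ≤ 1 → ∀ θ, (1 - s) • f θ + s • g θ ≠ 0) : LoopHomotopic f g := by
  -- Homotopies are parametrized by all of ℝ, so the parameter is clamped to [0, 1].
  refine ⟨fun p => (1 - max 0 (min 1 p.1)) • f p.2 + max 0 (min 1 p.1) • g p.2, by fun_prop, ?_, ?_,
    ?_, ?_⟩
  · intro p
    exact h _ (le_max_left _ _) (max_le zero_le_one (min_le_left _ _)) _
  · intro s θ
    simp only [hfp, hgp]
  · intro θ
    simp
  · intro θ
    simp

/-- The isotropic vector with given directions in `ℝ^{2,0}` and in `ℝ^{0,3}`. -/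
def isotropicVector (a : ℝ × ℝ) (n : ℝ × ℝ × ℝ) : R23 :=
  ![a.1 * Real.sqrt (n.1 ^ 2 + n.2.1 ^ 2 + n.2.2 ^ 2), a.2 * Real.sqrt (n.1 ^ 2 + n.2.1 ^ 2 + n.2.2 ^ 2),
    n.1 * Real.sqrt (a.1 ^ 2 + a.2 ^ 2), n.2.1 * Real.sqrt (a.1 ^ 2 + a.2 ^ 2),
    n.2.2 * Real.sqrt (a.1 ^ 2 + a.2 ^ 2)]

theorem form23_isotropicVector (a : ℝ × ℝ) (n : ℝ × ℝ × ℝ) :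
    form23 (isotropicVector a n) (isotropicVector a n) = 0 := by
  have h1 := Real.mul_self_sqrt (by positivity : 0 ≤ n.1 ^ 2 + n.2.1 ^ 2 + n.2.2 ^ 2)
  have h2 := Real.mul_self_sqrt (by positivity : 0 ≤ a.1 ^ 2 + a.2 ^ 2)
  rw [form23_apply]
  simp [isotropicVector]
  linear_combination (a.1 ^ 2 + a.2 ^ 2) * h1 - (n.1 ^ 2 + n.2.1 ^ 2 + n.2.2 ^ 2) * h2

theorem sq_add_sq_pos {a : ℝ × ℝ} (ha : a ≠ 0) : 0 < a.1 ^ 2 + a.2 ^ 2 := by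
  by_contra h
  apply ha
  have h1 := sq_nonneg a.1
  have h2 := sq_nonneg a.2
  exact Prod.ext (pow_eq_zero_iff two_ne_zero |>.1 (by linarith))
    (pow_eq_zero_iff two_ne_zero |>.1 (by linarith))

theorem sq_add_sq_add_sq_pos {n : ℝ × ℝ × ℝ} (hn : n ≠ 0) :
    0 < n.1 ^ 2 + n.2.1 ^ 2 + n.2.2 ^ 2 := by
  by_contra h
  apply hn
  have h1 := sq_nonneg n.1
  have h2 := sq_nonneg n.2.1
  have h3 := sq_nonneg n.2.2
  exact Prod.ext (pow_eq_zero_iff two_ne_zero |>.1 (by linarith))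
    (Prod.ext (pow_eq_zero_iff two_ne_zero |>.1 (by linarith))
      (pow_eq_zero_iff two_ne_zero |>.1 (by linarith)))

theorem isotropicVector_ne_zero {a : ℝ × ℝ} {n : ℝ × ℝ × ℝ} (ha : a ≠ 0) (hn : n ≠ 0) :
    isotropicVector a n ≠ 0 := by
  intro h
  have hn' := (Real.sqrt_pos.2 (sq_add_sq_add_sq_pos hn)).ne'
  have h0 := congrFun h 0
  have h1 := congrFun h 1
  simp [isotropicVector, hn'] at h0 h1
  exact ha (Prod.ext h0 h1)

theorem continuous_isotropicVector : Continuous fun p : (ℝ × ℝ) × (ℝ × ℝ × ℝ) =>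
    isotropicVector p.1 p.2 := by
  refine continuous_pi fun i => ?_
  fin_cases i <;> simp [isotropicVector] <;> fun_prop

/-- The parts of an isotropic vector in ℝ^{2,0} and ℝ^{0,3} have the same Euclidean length, so
`isotropicVector` only rescales v by it. -/
theorem lagrangianOf_isotropicVector {v : R23} (h0 : v ≠ 0) (h : form23 v v = 0) :
    lagrangianOf (isotropicVector (v 0, v 1) (v 2, v 3, v 4)) = lagrangianOf v := by
  rw [form23_apply] at h
  have hs : v 2 ^ 2 + v 3 ^ 2 + v 4 ^ 2 = v 0 ^ 2 + v 1 ^ 2 := by linarith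
  have hne : Real.sqrt (v 0 ^ 2 + v 1 ^ 2) ≠ 0 := by
    rw [Real.sqrt_ne_zero']
    refine sq_add_sq_pos (a := (v 0, v 1)) fun hz => h0 ?_
    have z0 : v 0 = 0 := congrArg Prod.fst hz
    have z1 : v 1 = 0 := congrArg Prod.snd hz
    rw [z0, z1] at hs
    have h2 := sq_nonneg (v 2)
    have h3 := sq_nonneg (v 3)
    have h4 := sq_nonneg (v 4)
    ext i
    fin_cases i
    · exact z0
    · exact z1
    · exact (pow_eq_zero_iff two_ne_zero).1 (by linarith : v 2 ^ 2 = 0)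
    · exact (pow_eq_zero_iff two_ne_zero).1 (by linarith : v 3 ^ 2 = 0)
    · exact (pow_eq_zero_iff two_ne_zero).1 (by linarith : v 4 ^ 2 = 0)
  rw [← lagrangianOf_smul hne v]
  congr 1
  ext i
  fin_cases i <;> simp [isotropicVector, hs, mul_comm]

/-- Isotropic directions are pairs of nonzero vectors of ℝ² and ℝ³ up to scaling. A loop that lifts
to such pairs can be deformed in the two factors independently. -/
theorem areFreelyHomotopic_of_loopHomotopic {a b : ℝ → ℝ × ℝ} {n m : ℝ → ℝ × ℝ × ℝ}
    (h₁ : LoopHomotopic a b) (h₂ : LoopHomotopic n m) :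
    AreFreelyHomotopic (fun θ => lagrangianOf (isotropicVector (a θ) (n θ)))
      fun θ => lagrangianOf (isotropicVector (b θ) (m θ)) := by
  obtain ⟨H, hc, hn, hp, h0, h1⟩ := h₁
  obtain ⟨K, kc, kn, kp, k0, k1⟩ := h₂
  have hcont : Continuous fun p : unitInterval × ℝ =>
      isotropicVector (H (p.1, p.2)) (K (p.1, p.2)) :=
    continuous_isotropicVector.comp (f := fun p : unitInterval × ℝ => (H (p.1, p.2), K (p.1, p.2)))
      (by fun_prop)
  refine ⟨fun p => lagrangianOf (isotropicVector (H (p.1, p.2)) (K (p.1, p.2))), ?_, ?_, ?_, ?_⟩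
  · exact isContinuousPlaneFamily_lagrangianOf hcont
      (fun _ => isotropicVector_ne_zero (hn _) (kn _)) fun _ => form23_isotropicVector _ _
  · refine fun s => ⟨fun θ => isLagrangian_lagrangianOf (isotropicVector_ne_zero (hn _) (kn _))
      (form23_isotropicVector _ _), ?_, fun θ => by simp only [hp, kp]⟩
    exact isContinuousPlaneFamily_lagrangianOf (hcont.comp (by fun_prop : Continuous fun θ => (s, θ)))
      (fun _ => isotropicVector_ne_zero (hn _) (kn _)) fun _ => form23_isotropicVector _ _
  · intro θ
    simp only [Set.Icc.coe_zero, h0, k0]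
  · intro θ
    simp only [Set.Icc.coe_one, h1, k1]

/-- Twice the generator lifts to a pair of closed loops: the circle traversed once in ℝ², and a loop
in ℝ³ minus the origin, where every loop is contractible. -/
theorem tauLoop_two_mul (θ : ℝ) : tauLoop (2 * θ) = lagrangianOf
    (isotropicVector (Real.cos θ, Real.sin θ) (Real.cos θ, -Real.sin θ, 0)) := by
  set v : R23 := ![Real.cos θ, Real.sin θ, Real.cos θ, -Real.sin θ, 0] with hv
  have hcs := Real.cos_sq_add_sin_sq θ
  have hiso : form23 v v = 0 := by
    rw [form23_apply]; simp [hv]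
  have hne : v ≠ 0 := fun h => by
    have h0 : Real.cos θ = 0 := congrFun h 0
    have h1 : Real.sin θ = 0 := congrFun h 1
    rw [h0, h1] at hcs
    norm_num at hcs
  have := lagrangianOf_isotropicVector hne hiso
  rw [show isotropicVector (v 0, v 1) (v 2, v 3, v 4) =
    isotropicVector (Real.cos θ, Real.sin θ) (Real.cos θ, -Real.sin θ, 0) by simp [hv]] at this
  rw [this, tauLoop, mul_div_cancel_left₀ θ two_ne_zero]
  rw [show ({![Real.cos θ, 0, Real.sin θ, 0], ![0, 1, 0, 0]} : Set V4) =
    range ![![Real.cos θ, 0, Real.sin θ, 0], ![0, 1, 0, 0]] by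
      rw [Matrix.range_cons, Matrix.range_cons, Matrix.range_empty, union_empty]; rfl]
  symm
  refine span_eq_of_linearIndependent (isLagrangian_lagrangianOf hne hiso).1 ?_ ?_
  · rw [LinearIndependent.pair_iff]
    intro s t hst
    have h0 := congrFun hst 0
    have h1 := congrFun hst 1
    have h2 := congrFun hst 2
    simp at h0 h1 h2
    refine ⟨?_, h1⟩
    rcases h0 with h | h
    · exact h
    · rcases h2 with h' | h'
      · exact h'
      · rw [h, h'] at hcs
        norm_num at hcs
  · intro i
    rw [mem_lagrangianOf_iff hne hiso]
    ext j
    fin_cases i <;> fin_cases j <;> simp [cliff_apply, hv]; ring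

/-! ### Spacelike tangent planes -/

/-- `T` is a spacelike tangent plane of `ℍ^{2,2}` at the point `p`. -/
structure IsTangentPlane (p : R23) (T : Submodule ℝ R23) : Prop where
  point : form23 p p = -1
  finrank : Module.finrank ℝ T = 2
  orthogonal : ∀ w ∈ T, form23 p w = 0
  pos : ∀ w ∈ T, w ≠ 0 → 0 < form23 w w

/-- The pencil of a tangent plane. -/
def planePencil (p : R23) (T : Submodule ℝ R23) : Submodule ℝ Quadric := T.map (wedgeQuadric p)

theorem IsSpacelikePair.rotate {a b : R23} (h : IsSpacelikePair a b) {x y : ℝ}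
    (hxy : x ^ 2 + y ^ 2 = 1) : IsSpacelikePair (x • a + y • b) (-y • a + x • b) := by
  refine ⟨by rw [h.form23_combination, hxy], by rw [h.form23_combination, ← hxy]; ring, ?_⟩
  simp only [map_add, map_smul, LinearMap.add_apply, LinearMap.smul_apply, smul_eq_mul, h.left,
    h.right, h.orthogonal, form23_comm b a]
  ring

theorem orient_rotate (a b : R23) (x y : ℝ) :
    orient (x • a + y • b) (-y • a + x • b) = (x ^ 2 + y ^ 2) * orient a b := by
  simp only [orient, Pi.add_apply, Pi.smul_apply, smul_eq_mul]; ring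

theorem exists_smul_form23_eq_one {w : R23} (hw : 0 < form23 w w) :
    ∃ c : ℝ, 0 < c ∧ form23 (c • w) (c • w) = 1 := by
  refine ⟨(Real.sqrt (form23 w w))⁻¹, inv_pos.2 (Real.sqrt_pos.2 hw), ?_⟩
  rw [map_smul, map_smul, LinearMap.smul_apply, smul_eq_mul, smul_eq_mul, ← mul_assoc, ← mul_inv,
    Real.mul_self_sqrt hw.le, inv_mul_cancel₀ hw.ne']

namespace IsTangentPlane

variable {p : R23} {T : Submodule ℝ R23} (h : IsTangentPlane p T)
include h

theorem isUnitTangentAt {w : R23} (hw : w ∈ T) (h1 : form23 w w = 1) : IsUnitTangentAt p w :=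
  ⟨h.point, h1, h.orthogonal w hw⟩

/-- The remainder is orthogonal to the pair, hence negative unless it vanishes; but it lies in T,
hence is positive unless it vanishes. -/
theorem mem_eq_of_pair {w V z : R23} (hw : w ∈ T) (hV : V ∈ T) (hwV : IsSpacelikePair w V)
    (hz : z ∈ T) : z = form23 z w • w + form23 z V • V := by
  rw [← sub_eq_zero]
  by_contra hne
  have h1 := h.pos _ (T.sub_mem hz (T.add_mem (T.smul_mem _ hw) (T.smul_mem _ hV))) hne
  have h2 := hwV.form23_neg hne
    (by simp [hwV.left, hwV.orthogonal, form23_comm V w])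
    (by simp [hwV.right, hwV.orthogonal])
  linarith

/-- Triangular oriented orthonormal bases. -/
theorem exists_pair : ∃ a b : R23, a ∈ T ∧ b ∈ T ∧ IsSpacelikePair a b ∧ 0 < a 0 ∧ a 1 = 0 ∧
    0 < b 1 := by
  have b := Module.finBasisOfFinrankEq ℝ T h.finrank
  have hb : LinearIndependent ℝ fun i => (b i : R23) :=
    b.linearIndependent.map' T.subtype T.ker_subtype
  rw [show (fun i => (b i : R23)) = ![(b 0 : R23), b 1] by ext i; fin_cases i <;> rfl,
    LinearIndependent.pair_iff] at hb
  have hsp : ∀ s t : ℝ, s ≠ 0 ∨ t ≠ 0 → 0 < form23 (s • (b 0 : R23) + t • (b 1 : R23))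
      (s • (b 0 : R23) + t • (b 1 : R23)) := fun s t hst =>
    h.pos _ (T.add_mem (T.smul_mem _ (b 0).2) (T.smul_mem _ (b 1).2)) fun h0 => by
      have := hb s t h0
      tauto
  have ho := orient_ne_zero_of_spacelike hsp
  have hcomb : ∀ s t : ℝ, s • (b 0 : R23) + t • (b 1 : R23) ∈ T := fun s t =>
    T.add_mem (T.smul_mem _ (b 0).2) (T.smul_mem _ (b 1).2)
  -- Cramer's rule gives a vector of T with projection (1, 0); the y below has second coordinate 1.
  -- Gram–Schmidt then preserves the triangular shape.
  obtain ⟨x, hxT, hx0, hx1⟩ : ∃ x ∈ T, 0 < x 0 ∧ x 1 = 0 := by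
    refine ⟨_, hcomb ((b 1 : R23) 1 / orient (b 0) (b 1)) (-(b 0 : R23) 1 / orient (b 0) (b 1)), ?_, ?_⟩
    · have : (((b 1 : R23) 1 / orient (b 0) (b 1)) • (b 0 : R23) +
          (-(b 0 : R23) 1 / orient (b 0) (b 1)) • (b 1 : R23)) 0 = 1 := by
        simp only [Pi.add_apply, Pi.smul_apply, smul_eq_mul]
        field_simp
        simp only [orient]; ring
      rw [this]; exact one_pos
    · simp only [Pi.add_apply, Pi.smul_apply, smul_eq_mul]
      ring
  obtain ⟨y, hyT, hy1⟩ : ∃ y ∈ T, 0 < y 1 := by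
    refine ⟨_, hcomb (-(b 1 : R23) 0 / orient (b 0) (b 1)) ((b 0 : R23) 0 / orient (b 0) (b 1)), ?_⟩
    have : ((-(b 1 : R23) 0 / orient (b 0) (b 1)) • (b 0 : R23) +
        ((b 0 : R23) 0 / orient (b 0) (b 1)) • (b 1 : R23)) 1 = 1 := by
      simp only [Pi.add_apply, Pi.smul_apply, smul_eq_mul]
      field_simp
      simp only [orient]; ring
    rw [this]; exact one_pos
  obtain ⟨c, hc, hc1⟩ := exists_smul_form23_eq_one (h.pos x hxT fun h0 => by simp [h0] at hx0)
  set a := c • x with ha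
  have haT : a ∈ T := T.smul_mem _ hxT
  have ha1 : a 1 = 0 := by simp [ha, hx1]
  set z := y - form23 y a • a with hz
  have hzT : z ∈ T := T.sub_mem hyT (T.smul_mem _ haT)
  have hz1 : z 1 = y 1 := by simp [hz, ha1]
  have hza : form23 a z = 0 := by
    simp only [hz, map_sub, map_smul, hc1, smul_eq_mul, form23_comm y a]
    ring
  obtain ⟨d, hd, hd1⟩ := exists_smul_form23_eq_one (h.pos z hzT fun h0 => by
    rw [h0] at hz1; simp at hz1; linarith)
  refine ⟨a, d • z, haT, T.smul_mem _ hzT, ⟨hc1, hd1, by simp [hza]⟩, ?_, ha1, ?_⟩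
  · simp only [ha, Pi.smul_apply, smul_eq_mul]; positivity
  · simp only [Pi.smul_apply, smul_eq_mul, hz1]; positivity

theorem exists_oriented_pair : ∃ a b : R23, a ∈ T ∧ b ∈ T ∧ IsSpacelikePair a b ∧ 0 < orient a b := by
  obtain ⟨a, b, ha, hb, hab, ha0, ha1, hb1⟩ := h.exists_pair
  refine ⟨a, b, ha, hb, hab, ?_⟩
  rw [orient, ha1]
  simp only [zero_mul, sub_zero]
  positivity

/-- The rotation of unit tangent vectors by a right angle. -/
theorem existsUnique_rotation {w : R23} (hw : w ∈ T) (h1 : form23 w w = 1) :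
    ∃! V, V ∈ T ∧ IsSpacelikePair w V ∧ 0 < orient w V := by
  obtain ⟨a, b, ha, hb, hab, ho⟩ := h.exists_oriented_pair
  have hwab := h.mem_eq_of_pair ha hb hab hw
  have hxy : form23 w a ^ 2 + form23 w b ^ 2 = 1 := by
    rw [← h1]; conv_rhs => rw [hwab, hab.form23_combination]
  have hp := hab.rotate hxy
  have hor := orient_rotate a b (form23 w a) (form23 w b)
  rw [← hwab, hxy, one_mul] at hor
  rw [← hwab] at hp
  set V := -form23 w b • a + form23 w a • b with hV
  have hVT : V ∈ T := T.add_mem (T.smul_mem _ ha) (T.smul_mem _ hb)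
  refine ⟨V, ⟨hVT, hp, by rw [hor]; exact ho⟩, ?_⟩
  rintro V' ⟨hV'T, hp', ho'⟩
  have e := h.mem_eq_of_pair hw hVT hp hV'T
  rw [form23_comm V' w, hp'.orthogonal, zero_smul, zero_add] at e
  set t := form23 V' V with ht
  have h2 := hp'.right
  rw [e] at h2 ho'
  simp only [map_smul, LinearMap.smul_apply, hp.right, smul_eq_mul] at h2
  have h3 : orient w (t • V) = t * orient w V := by
    simp only [orient, Pi.smul_apply, smul_eq_mul]; ring
  rw [h3] at ho'
  have htpos : 0 < t := (pos_iff_pos_of_mul_pos ho').2 (by rw [hor]; exact ho)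
  have : t = 1 := by nlinarith
  rw [e, this, one_smul]

/-- The inverse rotation. -/
theorem existsUnique_rotation_inv {V : R23} (hV : V ∈ T) (h1 : form23 V V = 1) :
    ∃! w, w ∈ T ∧ IsSpacelikePair w V ∧ 0 < orient w V := by
  obtain ⟨w, ⟨hw, hp, ho⟩, huniq⟩ := h.existsUnique_rotation hV h1
  refine ⟨-w, ⟨T.neg_mem hw, hp.symm.neg_left, ?_⟩, ?_⟩
  · rw [orient_neg_left, orient_swap, neg_neg]; exact ho
  · rintro w' ⟨hw', hp', ho'⟩
    rw [← huniq (-w') ⟨T.neg_mem hw', hp'.symm.neg_right, ?_⟩, neg_neg]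
    rw [orient_neg_right, orient_swap, neg_neg]; exact ho'

theorem wedgeQuadric_injOn {V V' : R23} (hV : V ∈ T) (hV' : V' ∈ T)
    (he : wedgeQuadric p V = wedgeQuadric p V') : V = V' := by
  rw [← contract_wedgeQuadric h.point (h.orthogonal V hV), he,
    contract_wedgeQuadric h.point (h.orthogonal V' hV')]

theorem contract_mem {q : Quadric} (hq : q ∈ planePencil p T) : contract p q ∈ T := by
  obtain ⟨V, hV, rfl⟩ := hq
  rwa [contract_wedgeQuadric h.point (h.orthogonal V hV)]

theorem wedgeQuadric_contract {q : Quadric} (hq : q ∈ planePencil p T) :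
    wedgeQuadric p (contract p q) = q := by
  obtain ⟨V, hV, rfl⟩ := hq
  rw [contract_wedgeQuadric h.point (h.orthogonal V hV)]

/-- The pencil of a tangent plane is spanned by the quadrics of the pairs of endpoints of
geodesics. -/
theorem span_lagrangianQuadrics : Submodule.span ℝ {q | ∃ w, (w ∈ T ∧ form23 w w = 1) ∧
    IsLagrangianQuadric (lagrangianOf (p + w)) (lagrangianOf (p - w)) q} = planePencil p T := by
  apply le_antisymm
  · rw [Submodule.span_le]
    rintro q ⟨w, ⟨hw, h1⟩, hq⟩
    rw [(h.isUnitTangentAt hw h1).isLagrangianQuadric_iff] at hq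
    exact ⟨w, hw, hq.symm⟩
  · rintro _ ⟨V, hV, rfl⟩
    by_cases h0 : V = 0
    · rw [h0, map_zero]; exact Submodule.zero_mem _
    obtain ⟨c, hc, hc1⟩ := exists_smul_form23_eq_one (h.pos V hV h0)
    have : wedgeQuadric p V = c⁻¹ • wedgeQuadric p (c • V) := by
      rw [map_smul, smul_smul, inv_mul_cancel₀ hc.ne', one_smul]
    rw [this]
    exact Submodule.smul_mem _ _ (Submodule.subset_span ⟨c • V, ⟨T.smul_mem _ hV, hc1⟩,
      (h.isUnitTangentAt (T.smul_mem _ hV) hc1).isLagrangianQuadric⟩)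

theorem planePencil_eq_span {a b : R23} (ha : a ∈ T) (hb : b ∈ T) (hab : IsSpacelikePair a b) :
    planePencil p T = Submodule.span ℝ {wedgeQuadric p a, wedgeQuadric p b} := by
  apply le_antisymm
  · rintro _ ⟨V, hV, rfl⟩
    rw [h.mem_eq_of_pair ha hb hab hV, map_add, map_smul, map_smul]
    exact Submodule.add_mem _ (Submodule.smul_mem _ _ (Submodule.subset_span (by simp)))
      (Submodule.smul_mem _ _ (Submodule.subset_span (by simp)))
  · rw [Submodule.span_le]
    rintro _ (rfl | rfl)
    · exact ⟨a, ha, rfl⟩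
    · exact ⟨b, hb, rfl⟩

theorem finrank_planePencil : Module.finrank ℝ (planePencil p T) = 2 := by
  rw [← h.finrank]
  symm
  refine LinearEquiv.finrank_eq (LinearEquiv.ofBijective ((wedgeQuadric p).submoduleMap T) ⟨?_,
    (wedgeQuadric p).submoduleMap_surjective T⟩)
  rintro ⟨V, hV⟩ ⟨V', hV'⟩ he
  exact Subtype.ext (h.wedgeQuadric_injOn hV hV' (congrArg Subtype.val he))

/-- The positive quadric a ∧ b of an oriented orthonormal basis of T is trace-orthogonal to p ∧ T
because p is orthogonal to T. -/
theorem isMixedPencil : IsMixedPencil (planePencil p T) := by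
  obtain ⟨a, b, ha, hb, hab, ho⟩ := h.exists_oriented_pair
  refine isMixedPencil_of_orthogonal (wedgeQuadric_isPositive hab.pos ho) ?_
  rintro _ ⟨V, hV, rfl⟩
  rw [tracePairing_wedgeQuadric, form23_comm a p, form23_comm b p, h.orthogonal a ha,
    h.orthogonal b hb]
  ring

theorem not_isPositive {q : Quadric} (hq : q ∈ planePencil p T) : ¬q.IsPositive := by
  obtain ⟨V, hV, rfl⟩ := hq
  by_cases h0 : V = 0
  · subst h0
    intro hpos
    have := hpos ![1, 0, 0, 0] (fun h => one_ne_zero (congrFun h 0))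
    simp [Quadric.eval] at this
  obtain ⟨c, hc, hc1⟩ := exists_smul_form23_eq_one (h.pos V hV h0)
  have := (h.isUnitTangentAt (T.smul_mem c hV) hc1).not_isPositive_smul c⁻¹
  rwa [map_smul, smul_smul, inv_mul_cancel₀ hc.ne', one_smul] at this

/-- On this Lagrangian p ∧ V equals -(w ∧ V) = V ∧ w. -/
theorem isPositiveOn {w V : R23} (hw : w ∈ T) (hV : V ∈ T) (hwV : IsSpacelikePair w V)
    (ho : 0 < orient V w) : (wedgeQuadric p V).IsPositiveOn (lagrangianOf (p + w)) := by
  intro z hz h0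
  rw [(h.isUnitTangentAt hw hwV.left).eval_of_mem (h.orthogonal V hV) hwV.orthogonal hz,
    ← Quadric.eval_neg, ← wedgeQuadric_swap]
  exact wedgeQuadric_isPositive hwV.symm.pos ho z h0

/-- With V normalized and w its quarter turn, p ∧ V is positive on the Lagrangian of p + w and
negative on that of p - w. -/
theorem isOmegaRegular {q : Quadric} (hq : q ∈ planePencil p T) (h0 : q ≠ 0) : IsOmegaRegular q := by
  obtain ⟨V, hV, rfl⟩ := hq
  have hV0 : V ≠ 0 := fun h => h0 (by rw [h, map_zero])
  obtain ⟨c, hc, hc1⟩ := exists_smul_form23_eq_one (h.pos V hV hV0)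
  obtain ⟨w, ⟨hw, hp, ho⟩, -⟩ := h.existsUnique_rotation (T.smul_mem c hV) hc1
  have hpos : ∀ z : V4, 0 < (wedgeQuadric p (c • V)).eval z z → 0 < (wedgeQuadric p V).eval z z := by
    intro z hz
    rw [map_smul, Quadric.eval_smul] at hz
    exact (pos_iff_pos_of_mul_pos hz).1 hc
  refine ⟨⟨lagrangianOf (p + w), (h.isUnitTangentAt hw hp.right).isLagrangian, ?_⟩,
    ⟨lagrangianOf (p + -w), (h.isUnitTangentAt hw hp.right).neg.isLagrangian, ?_⟩⟩
  · intro z hz hz0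
    exact hpos z (h.isPositiveOn hw (T.smul_mem c hV) hp.symm ho z hz hz0)
  · intro z hz hz0
    have := h.isPositiveOn (T.neg_mem hw) (T.neg_mem (T.smul_mem c hV)) hp.symm.neg_left.neg_right
      (by rw [orient_neg_left, orient_neg_right, neg_neg]; exact ho) z hz hz0
    rw [map_neg, map_smul, Quadric.eval_neg, Quadric.eval_smul, ← mul_neg, ← Quadric.eval_neg] at this
    exact (pos_iff_pos_of_mul_pos this).1 hc

end IsTangentPlane

/-! ### The homotopy class of the loop of endpoints of geodesics through a point -/

theorem form23_neg_of_timelike {z : R23} (h0 : z 0 = 0) (h1 : z 1 = 0) (hz : z ≠ 0) :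
    form23 z z < 0 := by
  by_contra hn
  rw [form23_apply, h0, h1] at hn
  have h2 := mul_self_nonneg (z 2)
  have h3 := mul_self_nonneg (z 3)
  have h4 := mul_self_nonneg (z 4)
  apply hz
  ext i
  fin_cases i
  · exact h0
  · exact h1
  · exact mul_self_eq_zero.1 (by linarith : z 2 * z 2 = 0)
  · exact mul_self_eq_zero.1 (by linarith : z 3 * z 3 = 0)
  · exact mul_self_eq_zero.1 (by linarith : z 4 * z 4 = 0)

theorem form23_pos_of_spacelike {z : R23} (h2 : z 2 = 0) (h3 : z 3 = 0) (h4 : z 4 = 0)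
    (hz : z ≠ 0) : 0 < form23 z z := by
  by_contra hn
  rw [form23_apply, h2, h3, h4] at hn
  have h0 := mul_self_nonneg (z 0)
  have h1 := mul_self_nonneg (z 1)
  apply hz
  ext i
  fin_cases i
  · exact mul_self_eq_zero.1 (by linarith : z 0 * z 0 = 0)
  · exact mul_self_eq_zero.1 (by linarith : z 1 * z 1 = 0)
  · exact h2
  · exact h3
  · exact h4

/-- The loop of unit vectors of a plane. -/
def unitLoop (a b : R23) (θ : ℝ) : R23 := Real.cos θ • a + Real.sin θ • b

theorem continuous_unitLoop (a b : R23) : Continuous (unitLoop a b) := by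
  unfold unitLoop
  fun_prop

theorem unitLoop_periodic (a b : R23) (θ : ℝ) : unitLoop a b (θ + 2 * Real.pi) = unitLoop a b θ := by
  simp [unitLoop]

theorem cos_sin_not_zero {θ : ℝ} (hc : Real.cos θ = 0) (hs : Real.sin θ = 0) : False := by
  have := Real.cos_sq_add_sin_sq θ
  rw [hc, hs] at this
  norm_num at this

section

variable {p a b : R23} (ha : IsUnitTangentAt p a) (hb : IsUnitTangentAt p b)
  (hab : IsSpacelikePair a b)
include ha hb hab

theorem isUnitTangentAt_unitLoop (θ : ℝ) : IsUnitTangentAt p (unitLoop a b θ) :=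
  ⟨ha.point, by rw [unitLoop, hab.form23_combination, Real.cos_sq_add_sin_sq], by
    simp [unitLoop, ha.orthogonal, hb.orthogonal]⟩

/-- The spacelike component of the loop of endpoints of geodesics through a point. -/
theorem loopHomotopic_spacelike (ha0 : 0 < a 0) (ha1 : a 1 = 0) (hb1 : 0 < b 1) :
    LoopHomotopic (fun θ => ((p + unitLoop a b θ) 0, (p + unitLoop a b θ) 1))
      fun θ => (Real.cos θ, Real.sin θ) := by
  have hcont := continuous_unitLoop a b
  refine LoopHomotopic.trans (g := fun θ => (unitLoop a b θ 0, unitLoop a b θ 1)) ?_ ?_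
  -- The point p is faded out. The vector (1 - s)p + w has norm 1 - (1 - s)² ≥ 0, so it is not
  -- purely timelike and its projection to ℝ^{2,0} is nonzero.
  · refine LoopHomotopic.segment (by fun_prop) (by fun_prop) (fun θ => by rw [unitLoop_periodic])
      (fun θ => by rw [unitLoop_periodic]) fun s hs0 hs1 θ h0 => ?_
    have hw := isUnitTangentAt_unitLoop ha hb hab θ
    set w := unitLoop a b θ
    have e0 : ((1 - s) • p + w) 0 = 0 := by
      have := congrArg Prod.fst h0
      simp only [Prod.fst_add, Prod.smul_fst, Pi.add_apply, Prod.fst_zero, smul_eq_mul] at this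
      simp only [Pi.add_apply, Pi.smul_apply, smul_eq_mul]
      linarith
    have e1 : ((1 - s) • p + w) 1 = 0 := by
      have := congrArg Prod.snd h0
      simp only [Prod.snd_add, Prod.smul_snd, Pi.add_apply, Prod.snd_zero, smul_eq_mul] at this
      simp only [Pi.add_apply, Pi.smul_apply, smul_eq_mul]
      linarith
    have hpw := hw.orthogonal
    have hwp : form23 w p = 0 := by rw [form23_comm, hpw]
    have := form23_neg_of_timelike e0 e1 fun hz => by
      have : form23 w ((1 - s) • p + w) = 0 := by rw [hz, map_zero]
      simp [hwp, hw.unit] at this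
    simp only [map_add, map_smul, LinearMap.add_apply, LinearMap.smul_apply, smul_eq_mul, hpw, hwp,
      hw.point, hw.unit] at this
    nlinarith
  -- The projected frame is triangular with positive diagonal, and so is each of its convex
  -- combinations with the standard frame.
  · refine LoopHomotopic.segment (by fun_prop) (by fun_prop) (fun θ => by rw [unitLoop_periodic])
      (fun θ => by simp) fun s hs0 hs1 θ h0 => ?_
    have e0 := congrArg Prod.fst h0
    have e1 := congrArg Prod.snd h0
    simp only [Prod.fst_add, Prod.snd_add, Prod.smul_fst, Prod.smul_snd, Prod.fst_zero,
      Prod.snd_zero, unitLoop, Pi.add_apply, Pi.smul_apply, smul_eq_mul, ha1] at e0 e1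
    have hpos : ∀ r : ℝ, 0 < r → 0 < (1 - s) * r + s := fun r hr => by
      rcases eq_or_lt_of_le hs1 with rfl | h
      · norm_num
      · have := mul_pos (sub_pos.2 h) hr
        linarith
    have hs : Real.sin θ = 0 := by
      have : Real.sin θ * ((1 - s) * b 1 + s) = 0 := by linear_combination e1
      exact (mul_eq_zero.1 this).resolve_right (hpos _ hb1).ne'
    have hc : Real.cos θ = 0 := by
      have : Real.cos θ * ((1 - s) * a 0 + s) = 0 := by
        linear_combination e0 - (1 - s) * b 0 * hs
      exact (mul_eq_zero.1 this).resolve_right (hpos _ ha0).ne'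
    exact cos_sin_not_zero hc hs

/-- The timelike component of the loop of endpoints of geodesics through a point. -/
theorem loopHomotopic_timelike :
    LoopHomotopic (fun θ => ((p + unitLoop a b θ) 2, (p + unitLoop a b θ) 3, (p + unitLoop a b θ) 4))
      fun θ => (Real.cos θ, -Real.sin θ, (0 : ℝ)) := by
  have hcont := continuous_unitLoop a b
  -- For 0 ≤ t ≤ 1 the norm of p + tw is t² - 1 ≤ 0, so this vector is not purely spacelike and the
  -- loop contracts to the timelike part of p.
  have hp : ∀ t : ℝ, 0 ≤ t → t ≤ 1 → ∀ θ, (p + t • unitLoop a b θ) 2 = 0 →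
      (p + t • unitLoop a b θ) 3 = 0 → (p + t • unitLoop a b θ) 4 = 0 → False := by
    intro t ht0 ht1 θ e2 e3 e4
    have hw := isUnitTangentAt_unitLoop ha hb hab θ
    set w := unitLoop a b θ
    have hpw := hw.orthogonal
    have hwp : form23 w p = 0 := by rw [form23_comm, hpw]
    have := form23_pos_of_spacelike e2 e3 e4 fun hz => by
      have : form23 p (p + t • w) = 0 := by rw [hz, map_zero]
      simp [hpw, hw.point] at this
    simp only [map_add, map_smul, LinearMap.add_apply, LinearMap.smul_apply, smul_eq_mul, hpw, hwp,
      hw.point, hw.unit] at this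
    nlinarith
  -- The constant loop is moved to a pole (0, 0, ε), with ε of the sign of the last coordinate of p
  -- so that the segment avoids the origin; from the pole the equatorial loop is reached by
  -- segments.
  obtain ⟨ε, hε, hεp⟩ : ∃ ε : ℝ, ε ≠ 0 ∧ ∀ s : ℝ, 0 ≤ s → s ≤ 1 → (1 - s) * p 4 + s * ε = 0 →
      s = 0 ∧ p 4 = 0 := by
    by_cases h4 : p 4 < 0
    · refine ⟨-1, by norm_num, fun s h0 h1 h => ?_⟩
      exfalso
      rcases eq_or_lt_of_le h1 with rfl | h1
      · norm_num at h
      · nlinarith [mul_neg_of_pos_of_neg (sub_pos.2 h1) h4]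
    · refine ⟨1, by norm_num, fun s h0 h1 h => ?_⟩
      have := mul_nonneg (sub_nonneg.2 h1) (not_lt.1 h4)
      have hs : s = 0 := by linarith
      refine ⟨hs, ?_⟩
      rw [hs] at h
      linarith
  refine LoopHomotopic.trans (g := fun _ => (p 2, p 3, p 4)) ?_
    (LoopHomotopic.trans (g := fun _ => ((0 : ℝ), (0 : ℝ), ε)) ?_ ?_)
  · refine LoopHomotopic.segment (by fun_prop) (by fun_prop) (fun θ => by rw [unitLoop_periodic])
      (fun θ => rfl) fun s hs0 hs1 θ h0 => ?_
    simp only [Prod.smul_mk, Prod.mk_add_mk, Prod.mk_eq_zero, smul_eq_mul, Pi.add_apply] at h0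
    refine hp (1 - s) (by linarith) (by linarith) θ ?_ ?_ ?_ <;>
      simp only [Pi.add_apply, Pi.smul_apply, smul_eq_mul] <;> linarith [h0.1, h0.2.1, h0.2.2]
  · refine LoopHomotopic.segment (by fun_prop) (by fun_prop) (fun θ => rfl)
      (fun θ => rfl) fun s hs0 hs1 θ h0 => ?_
    simp only [Prod.smul_mk, Prod.mk_add_mk, Prod.mk_eq_zero, smul_eq_mul] at h0
    obtain ⟨h2, h3, h4⟩ := h0
    obtain ⟨rfl, h4⟩ := hεp s hs0 hs1 h4
    refine hp 0 le_rfl zero_le_one θ ?_ ?_ ?_ <;>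
      simp only [Pi.add_apply, Pi.smul_apply, smul_eq_mul] <;> linarith
  · refine LoopHomotopic.segment (by fun_prop) (by fun_prop) (fun θ => rfl)
      (fun θ => by simp) fun s hs0 hs1 θ h0 => ?_
    simp only [Prod.smul_mk, Prod.mk_add_mk, Prod.mk_eq_zero, smul_eq_mul] at h0
    obtain ⟨h2, h3, h4⟩ := h0
    have hs : s = 1 := by
      have : (1 - s) * ε = 0 := by linarith
      linarith [(mul_eq_zero.1 this).resolve_right hε]
    subst hs
    exact cos_sin_not_zero (θ := θ) (by linarith) (by linarith)

end

/-- The boundary map sends the direction p ∧ (-Jw) to the Lagrangian of p + w, for w running once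
around the unit circle of T. -/
theorem IsTangentPlane.isMaximalPencil {p : R23} {T : Submodule ℝ R23} (h : IsTangentPlane p T) :
    IsMaximalPencil (planePencil p T) := by
  refine ⟨h.finrank_planePencil, fun q hq h0 => h.isOmegaRegular hq h0, ?_⟩
  obtain ⟨a, b, haT, hbT, hab, ha0, ha1, hb1⟩ := h.exists_pair
  have ho : 0 < orient a b := by
    rw [orient, ha1, zero_mul, sub_zero]; positivity
  have ha := h.isUnitTangentAt haT hab.left
  have hb := h.isUnitTangentAt hbT hab.right
  have hiso : ∀ θ, form23 (p + unitLoop a b θ) (p + unitLoop a b θ) = 0 := fun θ =>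
    (isUnitTangentAt_unitLoop ha hb hab θ).isotropic
  have hne : ∀ θ, p + unitLoop a b θ ≠ 0 := fun θ =>
    (isUnitTangentAt_unitLoop ha hb hab θ).ne_zero
  -- The basis (-Ja, -Jb), since b = Ja and a = -Jb: at angle θ it gives minus the quarter turn of
  -- the unit vector at angle θ.
  refine ⟨wedgeQuadric p (-b), wedgeQuadric p a,
    h.planePencil_eq_span (T.neg_mem hbT) haT hab.symm.neg_left,
    fun θ => lagrangianOf (p + unitLoop a b θ), ⟨fun θ => isLagrangian_lagrangianOf (hne θ) (hiso θ),
      isContinuousPlaneFamily_lagrangianOf (continuous_const.add (continuous_unitLoop a b)) hne hiso,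
      fun θ => by simp only [unitLoop_periodic]⟩, ?_, ?_⟩
  · intro θ
    rw [← map_smul, ← map_smul, ← map_add]
    have hrot := hab.rotate (Real.cos_sq_add_sin_sq θ)
    have horot := orient_rotate a b (Real.cos θ) (Real.sin θ)
    rw [Real.cos_sq_add_sin_sq, one_mul] at horot
    have e : Real.cos θ • -b + Real.sin θ • a = -(-Real.sin θ • a + Real.cos θ • b) := by module
    rw [e]
    refine h.isPositiveOn (T.add_mem (T.smul_mem _ haT) (T.smul_mem _ hbT))
      (T.neg_mem (T.add_mem (T.smul_mem _ haT) (T.smul_mem _ hbT))) hrot.neg_right ?_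
    rw [orient_neg_left, orient_swap, neg_neg, unitLoop, horot]
    exact ho
  · have key := areFreelyHomotopic_of_loopHomotopic (loopHomotopic_spacelike ha hb hab ha0 ha1 hb1)
      (loopHomotopic_timelike ha hb hab)
    simp only [lagrangianOf_isotropicVector (hne _) (hiso _)] at key
    simpa only [tauLoop_two_mul] using key

/-! ### Coefficients in spacelike frames -/

theorem ContDiffAt.form23 {E : Type*} [NormedAddCommGroup E] [NormedSpace ℝ E] {n : WithTop ℕ∞}
    {f g : E → R23} {x : E} (hf : ContDiffAt ℝ n f x) (hg : ContDiffAt ℝ n g x) :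
    ContDiffAt ℝ n (fun y => _root_.form23 (f y) (g y)) x := by
  have hf' := contDiffAt_pi.1 hf
  have hg' := contDiffAt_pi.1 hg
  simp only [form23_apply]
  exact (((((hf' 0).mul (hg' 0)).add ((hf' 1).mul (hg' 1))).sub ((hf' 2).mul (hg' 2))).sub
    ((hf' 3).mul (hg' 3))).sub ((hf' 4).mul (hg' 4))

/-- The Gram determinant. -/
def gramDet (a b : R23) : ℝ := form23 a a * form23 b b - form23 a b ^ 2

/-- The first coefficient of the projection of `z` to the plane spanned by `a` and `b`. The second
one is obtained by exchanging `a` and `b`. -/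
def frameCoeff (a b z : R23) : ℝ :=
  (form23 z a * form23 b b - form23 z b * form23 a b) / gramDet a b

theorem gramDet_comm (a b : R23) : gramDet a b = gramDet b a := by
  simp only [gramDet, form23_comm b a]; ring

theorem frameCoeff_combination {a b : R23} (h : gramDet a b ≠ 0) (s t : ℝ) :
    frameCoeff a b (s • a + t • b) = s := by
  rw [frameCoeff, div_eq_iff h]
  simp only [map_add, map_smul, LinearMap.add_apply, LinearMap.smul_apply, smul_eq_mul,
    form23_comm b a, gramDet]
  ring

theorem eq_frameCoeff {a b z : R23} (h : gramDet a b ≠ 0) (hz : z ∈ Submodule.span ℝ {a, b}) :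
    z = frameCoeff a b z • a + frameCoeff b a z • b := by
  obtain ⟨s, t, rfl⟩ := Submodule.mem_span_pair.1 hz
  rw [frameCoeff_combination h, add_comm (s • a), frameCoeff_combination (gramDet_comm a b ▸ h),
    add_comm]

theorem ContDiffAt.frameCoeff {E : Type*} [NormedAddCommGroup E] [NormedSpace ℝ E] {n : WithTop ℕ∞}
    {a b z : E → R23} {x : E} (ha : ContDiffAt ℝ n a x) (hb : ContDiffAt ℝ n b x)
    (hz : ContDiffAt ℝ n z x) (h : gramDet (a x) (b x) ≠ 0) :
    ContDiffAt ℝ n (fun y => _root_.frameCoeff (a y) (b y) (z y)) x :=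
  (((hz.form23 ha).mul (hb.form23 hb)).sub ((hz.form23 hb).mul (ha.form23 hb))).div
    (((ha.form23 ha).mul (hb.form23 hb)).sub ((ha.form23 hb).pow 2)) h

theorem ContDiff.wedgeQuadric_prod {n : WithTop ℕ∞} :
    ContDiff ℝ n fun p : R23 × R23 => wedgeQuadric p.1 p.2 :=
  (wedgeQuadric.toContinuousBilinearMap).isBoundedBilinearMap.contDiff

theorem ContDiff.contract_prod {n : WithTop ℕ∞} :
    ContDiff ℝ n fun p : R23 × Quadric => contract p.1 p.2 :=
  (contract.toContinuousBilinearMap).isBoundedBilinearMap.contDiff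

theorem HasFDerivAt.wedgeQuadric {E : Type*} [NormedAddCommGroup E] [NormedSpace ℝ E]
    {a b : E → R23} {a' b' : E →L[ℝ] R23} {x : E} (ha : HasFDerivAt a a' x)
    (hb : HasFDerivAt b b' x) : ∃ L : E →L[ℝ] Quadric,
      HasFDerivAt (fun y => _root_.wedgeQuadric (a y) (b y)) L x ∧
      ∀ v, L v = _root_.wedgeQuadric (a' v) (b x) + _root_.wedgeQuadric (a x) (b' v) := by
  have h := (_root_.wedgeQuadric.toContinuousBilinearMap).isBoundedBilinearMap.hasFDerivAt (a x, b x)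
  refine ⟨_, h.comp x (f := fun y => (a y, b y)) (ha.prodMk hb), fun v => ?_⟩
  simp [add_comm]

/-! ### Surfaces in local coordinates -/

/-- The model of surfaces. -/
abbrev Plane2 : Type := EuclideanSpace ℝ (Fin 2)

/-- The standard basis of `ℝ²`. -/
def planeBasis : Module.Basis (Fin 2) ℝ Plane2 := (EuclideanSpace.basisFun (Fin 2) ℝ).toBasis

section Surface

variable {S : Type*} [TopologicalSpace S] [ChartedSpace Plane2 S]

/-- A map on a surface, in the preferred chart at `x`. -/
def inChart (u : S → R23) (x : S) : Plane2 → R23 := u ∘ (extChartAt (𝓡 2) x).symm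

/-- The coordinate vector fields of a map on a surface. -/
def chartFrame (u : S → R23) (x : S) (i : Fin 2) (c : Plane2) : R23 :=
  fderiv ℝ (inChart u x) c (planeBasis i)

/-- The tangent plane of an immersed surface. -/
def tangentPlane (u : S → R23) (x : S) : Submodule ℝ R23 := LinearMap.range (diffAt u x)

variable {u : S → R23}

theorem range_fderiv_eq_span (x : S) (c : Plane2) :
    LinearMap.range (fderiv ℝ (inChart u x) c : Plane2 →ₗ[ℝ] R23) =
      Submodule.span ℝ {chartFrame u x 0 c, chartFrame u x 1 c} := by
  rw [LinearMap.range_eq_map, ← planeBasis.span_eq, LinearMap.map_span, ← range_comp]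
  congr 1
  ext z
  simp [chartFrame, Fin.exists_fin_two, eq_comm]

theorem fderiv_inChart_apply (x : S) (c ν : Plane2) : fderiv ℝ (inChart u x) c ν =
    ν 0 • chartFrame u x 0 c + ν 1 • chartFrame u x 1 c := by
  have h : ν = ν 0 • planeBasis 0 + ν 1 • planeBasis 1 := by
    ext i
    fin_cases i <;> simp [planeBasis]
  conv_lhs => rw [h]
  rw [map_add, map_smul, map_smul]
  rfl

namespace IsSpacelikeImmersion

variable (hu : IsSpacelikeImmersion u)
include hu

theorem diffAt_eq (x : S) (v : TangentSpace (𝓡 2) x) :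
    diffAt u x v = fderiv ℝ (inChart u x) (extChartAt (𝓡 2) x x) (v : Plane2) := by
  have h : MDifferentiableAt (𝓡 2) 𝓘(ℝ, R23) u x := (hu.smooth x).mdifferentiableAt (by simp)
  rw [diffAt, h.mfderiv]
  simp only [writtenInExtChartAt, extChartAt_model_space_eq_id, modelWithCornersSelf_coe, range_id,
    fderivWithin_univ]
  rfl

theorem diffAt_injective (x : S) : Function.Injective (diffAt u x) := by
  rw [injective_iff_map_eq_zero]
  intro v hv
  by_contra h0
  have := hu.spacelike x v h0
  rw [hv] at this
  simp at this

end IsSpacelikeImmersion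

variable [IsManifold (𝓡 2) ∞ S]

theorem exists_mfderiv_extChartAt_eq (x : S) {y : S} (hy : y ∈ (extChartAt (𝓡 2) x).source)
    (ν : Plane2) : ∃ v : TangentSpace (𝓡 2) y,
      (mfderiv (𝓡 2) 𝓘(ℝ, Plane2) (extChartAt (𝓡 2) x) y v : Plane2) = ν := by
  obtain ⟨e, he⟩ := isInvertible_mfderiv_extChartAt (I := 𝓡 2) hy
  refine ⟨e.symm ν, ?_⟩
  rw [← he]
  exact e.apply_symm_apply ν

namespace IsSpacelikeImmersion

variable (hu : IsSpacelikeImmersion u)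
include hu

theorem contDiffOn_inChart (x : S) :
    ContDiffOn ℝ ∞ (inChart u x) (extChartAt (𝓡 2) x).target := by
  rw [← contMDiffOn_iff_contDiffOn]
  exact hu.smooth.comp_contMDiffOn (contMDiffOn_extChartAt_symm x)

theorem contDiffAt_inChart (x : S) {c : Plane2} (hc : c ∈ (extChartAt (𝓡 2) x).target) :
    ContDiffAt ℝ ∞ (inChart u x) c :=
  (hu.contDiffOn_inChart x).contDiffAt ((isOpen_extChartAt_target x).mem_nhds hc)

theorem contDiffAt_fderiv_inChart (x : S) {c : Plane2} (hc : c ∈ (extChartAt (𝓡 2) x).target) :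
    ContDiffAt ℝ ∞ (fderiv ℝ (inChart u x)) c :=
  (hu.contDiffAt_inChart x hc).fderiv_right (m := ∞) (by simp)

theorem contDiffAt_chartFrame (x : S) (i : Fin 2) {c : Plane2}
    (hc : c ∈ (extChartAt (𝓡 2) x).target) : ContDiffAt ℝ ∞ (chartFrame u x i) c :=
  (hu.contDiffAt_fderiv_inChart x hc).clm_apply contDiffAt_const

theorem diffAt_eq_comp (x : S) {y : S} (hy : y ∈ (extChartAt (𝓡 2) x).source)
    (v : TangentSpace (𝓡 2) y) : diffAt u y v = fderiv ℝ (inChart u x) (extChartAt (𝓡 2) x y)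
      (mfderiv (𝓡 2) 𝓘(ℝ, Plane2) (extChartAt (𝓡 2) x) y v : Plane2) := by
  have hF := ((hu.contDiffAt_inChart x ((extChartAt (𝓡 2) x).map_source hy)).differentiableAt
    (by simp)).hasFDerivAt.hasMFDerivAt
  have hφ : MDifferentiableAt (𝓡 2) 𝓘(ℝ, Plane2) (extChartAt (𝓡 2) x) y :=
    mdifferentiableAt_extChartAt (by simpa using hy)
  have hcomp := hF.comp y hφ.hasMFDerivAt
  have heq : u =ᶠ[𝓝 y] inChart u x ∘ extChartAt (𝓡 2) x := by
    filter_upwards [extChartAt_source_mem_nhds' hy] with z hz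
    simp only [inChart, Function.comp_apply, (extChartAt (𝓡 2) x).left_inv hz]
  have := (hcomp.congr_of_eventuallyEq heq).mfderiv
  rw [diffAt, this]
  rfl

theorem tangentPlane_eq (x : S) {y : S} (hy : y ∈ (extChartAt (𝓡 2) x).source) :
    tangentPlane u y = LinearMap.range
      (fderiv ℝ (inChart u x) (extChartAt (𝓡 2) x y) : Plane2 →ₗ[ℝ] R23) := by
  ext z
  constructor
  · rintro ⟨v, rfl⟩
    exact ⟨_, (hu.diffAt_eq_comp x hy v).symm⟩
  · rintro ⟨ν, rfl⟩
    obtain ⟨v, hv⟩ := exists_mfderiv_extChartAt_eq x hy ν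
    refine ⟨v, ?_⟩
    rw [hu.diffAt_eq_comp x hy, hv]
    rfl

/-- This is the derivative of the equation ⟨u, u⟩ = -1. -/
theorem form23_fderiv_inChart (x : S) {c : Plane2} (hc : c ∈ (extChartAt (𝓡 2) x).target)
    (ν : Plane2) : form23 (inChart u x c) (fderiv ℝ (inChart u x) c ν) = 0 := by
  have hF := ((hu.contDiffAt_inChart x hc).differentiableAt (by simp)).hasFDerivAt
  have hline : HasDerivAt (fun t : ℝ => c + t • ν) ν 0 := by
    simpa using ((hasDerivAt_id (0 : ℝ)).smul_const ν).const_add c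
  have hcomp : HasDerivAt (fun t : ℝ => inChart u x (c + t • ν)) (fderiv ℝ (inChart u x) c ν) 0 :=
    hF.comp_hasDerivAt_of_eq (0 : ℝ) hline (by simp)
  have hi := fun i => (hasDerivAt_pi.1 hcomp) i
  have hform := (((((hi 0).mul (hi 0)).add ((hi 1).mul (hi 1))).sub ((hi 2).mul (hi 2))).sub
    ((hi 3).mul (hi 3))).sub ((hi 4).mul (hi 4))
  have h2 := (hasDerivAt_const (0 : ℝ) (-1 : ℝ)).unique
    (hform.congr_of_eventuallyEq (Filter.Eventually.of_forall fun t => by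
      rw [← hu.mem ((extChartAt (𝓡 2) x).symm (c + t • ν)), form23_apply]; rfl))
  simp only [zero_smul, add_zero] at h2
  rw [form23_apply]
  linarith

theorem form23_diffAt (x : S) (v : TangentSpace (𝓡 2) x) : form23 (u x) (diffAt u x v) = 0 := by
  have := hu.form23_fderiv_inChart x (mem_extChartAt_target x) v
  rw [← hu.diffAt_eq x v] at this
  simpa [inChart] using this

theorem isTangentPlane (x : S) : IsTangentPlane (u x) (tangentPlane u x) where
  point := hu.mem x
  finrank := by
    have : Module.finrank ℝ (TangentSpace (𝓡 2) x) = 2 := finrank_euclideanSpace_fin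
    rw [tangentPlane, LinearMap.finrank_range_of_inj (hu.diffAt_injective x), this]
  orthogonal := by
    rintro _ ⟨v, rfl⟩
    exact hu.form23_diffAt x v
  pos := by
    rintro _ ⟨v, rfl⟩ h0
    exact hu.spacelike x v fun h => h0 (by rw [h, map_zero])

theorem gaussMap_eq (x : S) : gaussMap u x = planePencil (u x) (tangentPlane u x) :=
  (hu.isTangentPlane x).span_lagrangianQuadrics

theorem fderiv_inChart_spacelike (x : S) {c : Plane2} (hc : c ∈ (extChartAt (𝓡 2) x).target)
    {ν : Plane2} (hν : ν ≠ 0) :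
    0 < form23 (fderiv ℝ (inChart u x) c ν) (fderiv ℝ (inChart u x) c ν) := by
  have hy := (extChartAt (𝓡 2) x).map_target hc
  obtain ⟨v, hv⟩ := exists_mfderiv_extChartAt_eq x hy ν
  have := hu.diffAt_eq_comp x hy v
  rw [hv, (extChartAt (𝓡 2) x).right_inv hc] at this
  rw [← this]
  refine hu.spacelike _ _ fun h0 => hν ?_
  rw [← hv, h0]
  exact map_zero _

theorem chartFrame_spacelike (x : S) {c : Plane2} (hc : c ∈ (extChartAt (𝓡 2) x).target) (s t : ℝ)
    (hst : s ≠ 0 ∨ t ≠ 0) : 0 < form23 (s • chartFrame u x 0 c + t • chartFrame u x 1 c)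
      (s • chartFrame u x 0 c + t • chartFrame u x 1 c) := by
  have := hu.fderiv_inChart_spacelike x hc (ν := !₂[s, t]) fun h => by
    have h0 := congrFun (congrArg WithLp.ofLp h) 0
    have h1 := congrFun (congrArg WithLp.ofLp h) 1
    simp at h0 h1
    tauto
  rw [fderiv_inChart_apply] at this
  simpa using this

theorem gramDet_chartFrame_pos (x : S) {c : Plane2} (hc : c ∈ (extChartAt (𝓡 2) x).target) :
    0 < gramDet (chartFrame u x 0 c) (chartFrame u x 1 c) :=
  gram_pos (hu.chartFrame_spacelike x hc)

end IsSpacelikeImmersion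

end Surface

/-! ### The second fundamental form -/

/-- The component of `z` orthogonal to an orthonormal frame `(p, w, V)`, where `p` is timelike. -/
def normalPart (p w V : R23) : R23 →ₗ[ℝ] R23 :=
  LinearMap.id + (form23 p).smulRight p - (form23 w).smulRight w - (form23 V).smulRight V

theorem normalPart_apply (p w V z : R23) : normalPart p w V z =
    z + form23 p z • p - form23 w z • w - form23 V z • V := rfl

theorem form23_normalPart_point {p w V : R23} (hw : IsUnitTangentAt p w) (hV : IsUnitTangentAt p V)
    (z : R23) : form23 (normalPart p w V z) p = 0 := by
  rw [form23_comm, normalPart_apply]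
  simp [hw.point, hw.orthogonal, hV.orthogonal]

theorem form23_normalPart_left {p w V : R23} (hw : IsUnitTangentAt p w) (hwV : form23 w V = 0)
    (z : R23) : form23 (normalPart p w V z) w = 0 := by
  rw [form23_comm, normalPart_apply]
  simp [hw.unit, hw.orthogonal, hwV, form23_comm w p]

theorem form23_normalPart_right {p w V : R23} (hV : IsUnitTangentAt p V) (hwV : form23 w V = 0)
    (z : R23) : form23 (normalPart p w V z) V = 0 := by
  rw [form23_comm, normalPart_apply]
  simp [hV.unit, hV.orthogonal, hwV, form23_comm V p, form23_comm V w]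

section Surface

variable {S : Type*} [TopologicalSpace S] [ChartedSpace Plane2 S] {u : S → R23}

theorem ContMDiffOn.wedgeQuadric {n : WithTop ℕ∞} {a b : S → R23} {s : Set S}
    (ha : ContMDiffOn (𝓡 2) 𝓘(ℝ, R23) n a s) (hb : ContMDiffOn (𝓡 2) 𝓘(ℝ, R23) n b s) :
    ContMDiffOn (𝓡 2) 𝓘(ℝ, Quadric) n (fun y => _root_.wedgeQuadric (a y) (b y)) s := by
  have h : ContMDiff 𝓘(ℝ, R23 × R23) 𝓘(ℝ, Quadric) n
      fun p : R23 × R23 => _root_.wedgeQuadric p.1 p.2 := ContDiff.wedgeQuadric_prod.contMDiff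
  have hab : ContMDiffOn (𝓡 2) 𝓘(ℝ, R23 × R23) n (fun y => (a y, b y)) s := ha.prodMk_space hb
  generalize hf : (fun y => (a y, b y)) = f at hab
  have hf' : (fun y => _root_.wedgeQuadric (a y) (b y)) =
      fun y => _root_.wedgeQuadric (f y).1 (f y).2 := by rw [← hf]
  rw [hf']
  exact h.comp_contMDiffOn hab

theorem secondDerivAt_add_left (x : S) (v v' w : TangentSpace (𝓡 2) x) :
    secondDerivAt u x (v + v') w = secondDerivAt u x v w + secondDerivAt u x v' w := by
  unfold secondDerivAt
  exact congrFun (congrArg DFunLike.coe (map_add _ (v : Plane2) (v' : Plane2))) w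

theorem secondDerivAt_smul_left (x : S) (c : ℝ) (v w : TangentSpace (𝓡 2) x) :
    secondDerivAt u x (c • v) w = c • secondDerivAt u x v w := by
  unfold secondDerivAt
  exact congrFun (congrArg DFunLike.coe (map_smul _ c (v : Plane2))) w

theorem secondDerivAt_add_right (x : S) (v w w' : TangentSpace (𝓡 2) x) :
    secondDerivAt u x v (w + w') = secondDerivAt u x v w + secondDerivAt u x v w' :=
  map_add _ (w : Plane2) (w' : Plane2)

theorem secondDerivAt_smul_right (x : S) (c : ℝ) (v w : TangentSpace (𝓡 2) x) :
    secondDerivAt u x v (c • w) = c • secondDerivAt u x v w :=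
  map_smul _ c (w : Plane2)

/-- Since u ∧ u = 0 and tangential vectors contribute elements of the pencil, only the normal part
of a second derivative is visible modulo the pencil. -/
theorem wedgeQuadric_sub_normalPart_mem (x : S) {w V : R23} (hw : w ∈ tangentPlane u x)
    (hV : V ∈ tangentPlane u x) (z : R23) :
    wedgeQuadric (u x) z - wedgeQuadric (u x) (normalPart (u x) w V z) ∈
      planePencil (u x) (tangentPlane u x) := by
  rw [normalPart_apply, map_sub, map_sub, map_add, map_smul, wedgeQuadric_self, smul_zero, add_zero]
  have e : ∀ a b c : Quadric, a - (a - b - c) = b + c := fun a b c => by abel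
  rw [e, ← map_add]
  exact ⟨_, Submodule.add_mem _ (Submodule.smul_mem _ _ hw) (Submodule.smul_mem _ _ hV), rfl⟩

variable [IsManifold (𝓡 2) ∞ S]

namespace IsSpacelikeImmersion

variable (hu : IsSpacelikeImmersion u)
include hu

theorem secondDerivAt_comm (x : S) (v w : TangentSpace (𝓡 2) x) :
    secondDerivAt u x v w = secondDerivAt u x w v :=
  ((hu.contDiffAt_inChart x (mem_extChartAt_target x)).isSymmSndFDerivAt
    (by rw [minSmoothness_of_isRCLikeNormedField]; exact ENat.LEInfty.out)) v w

/-- Under the bound on the second fundamental form along the diagonal, `‖II(v, w)‖ < 1` for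
orthonormal vectors `v` and `w`. -/
theorem neg_one_lt_form23_normalPart
    (hII : ∀ (x : S) (v : TangentSpace (𝓡 2) x), v ≠ 0 →
      ∀ n, IsSecondFundamentalForm u x v v n →
        Real.sqrt (-form23 n n) < form23 (diffAt u x v) (diffAt u x v))
    (x : S) {v w : TangentSpace (𝓡 2) x} (hvw : IsSpacelikePair (diffAt u x v) (diffAt u x w)) :
    -1 < form23 (normalPart (u x) (diffAt u x v) (diffAt u x w) (secondDerivAt u x v w))
      (normalPart (u x) (diffAt u x v) (diffAt u x w) (secondDerivAt u x v w)) := by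
  have hT := hu.isTangentPlane x
  have hv := hT.isUnitTangentAt (LinearMap.mem_range_self _ v) hvw.left
  have hw := hT.isUnitTangentAt (LinearMap.mem_range_self _ w) hvw.right
  set N := normalPart (u x) (diffAt u x v) (diffAt u x w) with hN
  -- Applied to v ± w, of squared length 2, the hypothesis gives ‖II‖ < 2.
  have hbound : ∀ ξ : TangentSpace (𝓡 2) x, form23 (diffAt u x ξ) (diffAt u x ξ) = 2 →
      -form23 (N (secondDerivAt u x ξ ξ)) (N (secondDerivAt u x ξ ξ)) < 4 := by
    intro ξ hξ
    have h := hII x ξ (fun h0 => by rw [h0, map_zero] at hξ; simp at hξ)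
      (N (secondDerivAt u x ξ ξ)) ⟨form23_normalPart_point hv hw _, fun z => ?_, ?_⟩
    · rw [hξ, Real.sqrt_lt' two_pos] at h
      linarith
    · rw [hT.mem_eq_of_pair (LinearMap.mem_range_self _ v) (LinearMap.mem_range_self _ w) hvw
        (LinearMap.mem_range_self _ z), map_add, map_smul, map_smul,
        form23_normalPart_left hv hvw.orthogonal, form23_normalPart_right hw hvw.orthogonal]
      simp
    · rw [hN, normalPart_apply]
      have e : ∀ a b c d : R23, a - (a + b - c - d) = -b + (c + d) := fun a b c d => by abel
      rw [e]
      refine Submodule.add_mem_sup (Submodule.neg_mem _ (Submodule.smul_mem _ _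
        (Submodule.mem_span_singleton_self _))) (Submodule.add_mem _ ?_ ?_)
      · exact Submodule.smul_mem _ _ (LinearMap.mem_range_self _ v)
      · exact Submodule.smul_mem _ _ (LinearMap.mem_range_self _ w)
  have h1 := hbound (v + w) (by
    rw [map_add]
    have := hvw.form23_combination 1 1
    simp only [one_smul] at this
    rw [this]; norm_num)
  have h2 := hbound (v + (-1 : ℝ) • w) (by
    rw [map_add, map_smul]
    have := hvw.form23_combination 1 (-1)
    rw [one_smul] at this
    rw [this]; norm_num)
  -- Parallelogram identity: II(v ± w, v ± w) = A ± 2n, so 2‖A‖² + 8‖n‖² < 8 and therefore ‖n‖ < 1.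
  set A := N (secondDerivAt u x v v) + N (secondDerivAt u x w w) with hA
  set n := N (secondDerivAt u x v w) with hn
  have e1 : N (secondDerivAt u x (v + w) (v + w)) = A + (2 : ℝ) • n := by
    rw [secondDerivAt_add_left, secondDerivAt_add_right, secondDerivAt_add_right,
      hu.secondDerivAt_comm x w v, map_add, map_add, map_add, hA, hn]
    module
  have e2 : N (secondDerivAt u x (v + (-1 : ℝ) • w) (v + (-1 : ℝ) • w)) = A - (2 : ℝ) • n := by
    rw [secondDerivAt_add_left, secondDerivAt_add_right, secondDerivAt_add_right,
      secondDerivAt_smul_left, secondDerivAt_smul_left, secondDerivAt_smul_right,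
      secondDerivAt_smul_right, hu.secondDerivAt_comm x w v, map_add, map_add, map_add, map_smul,
      map_smul, map_smul, hA, hn]
    module
  rw [e1] at h1
  rw [e2] at h2
  have h3 : form23 A A ≤ 0 := by
    refine hvw.form23_nonpos ?_ ?_
    · rw [hA, ← map_add]; exact form23_normalPart_left hv hvw.orthogonal _
    · rw [hA, ← map_add]; exact form23_normalPart_right hw hvw.orthogonal _
  simp only [map_add, map_sub, map_smul, LinearMap.add_apply, LinearMap.sub_apply,
    LinearMap.smul_apply, smul_eq_mul] at h1 h2
  linarith

/-- The derivative of a section of the Gauss map in the orthogonal direction is positive modulo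
the pencil. -/
theorem exists_isPositive
    (hII : ∀ (x : S) (v : TangentSpace (𝓡 2) x), v ≠ 0 →
      ∀ n, IsSecondFundamentalForm u x v v n →
        Real.sqrt (-form23 n n) < form23 (diffAt u x v) (diffAt u x v))
    (x : S) {v w : TangentSpace (𝓡 2) x} (hvw : IsSpacelikePair (diffAt u x v) (diffAt u x w))
    (ho : 0 < orient (diffAt u x v) (diffAt u x w)) :
    (wedgeQuadric (diffAt u x v) (diffAt u x w) + wedgeQuadric (u x)
      (normalPart (u x) (diffAt u x v) (diffAt u x w) (secondDerivAt u x v w))).IsPositive := by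
  have hT := hu.isTangentPlane x
  have hv := hT.isUnitTangentAt (LinearMap.mem_range_self _ v) hvw.left
  have hw := hT.isUnitTangentAt (LinearMap.mem_range_self _ w) hvw.right
  exact wedgeQuadric_add_isPositive hvw ho hv.point hv.orthogonal hw.orthogonal
    (form23_normalPart_point hv hw _) (form23_normalPart_left hv hvw.orthogonal _)
    (form23_normalPart_right hw hvw.orthogonal _) (hu.neg_one_lt_form23_normalPart hII x hvw)

/-! ### The Gauss map is a fitting immersion -/

/-- A smooth local frame is u ∧ ∂ᵢu for the coordinate fields of a chart; it is independent because
u ∧ · is injective on the tangent plane. -/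
theorem isSmoothPencilMap :
    IsSmoothPencilMap fun x => planePencil (u x) (tangentPlane u x) := by
  intro x
  refine ⟨(extChartAt (𝓡 2) x).source, extChartAt_source_mem_nhds x,
    fun i y => wedgeQuadric (u y) (chartFrame u x i (extChartAt (𝓡 2) x y)), fun i => ?_,
    fun y hy => ?_⟩
  · have h1 : ContMDiffOn (𝓡 2) 𝓘(ℝ, R23) ∞
        (fun y => chartFrame u x i (extChartAt (𝓡 2) x y)) (extChartAt (𝓡 2) x).source := by
      have hE : ContDiffOn ℝ ∞ (chartFrame u x i) (extChartAt (𝓡 2) x).target := fun c hc =>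
        (hu.contDiffAt_chartFrame x i hc).contDiffWithinAt
      exact hE.contMDiffOn.comp (by
        rw [extChartAt_source]
        exact contMDiffOn_extChartAt) (extChartAt (𝓡 2) x).mapsTo
    exact hu.smooth.contMDiffOn.wedgeQuadric h1
  · set c := extChartAt (𝓡 2) x y with hc
    have hct : c ∈ (extChartAt (𝓡 2) x).target := (extChartAt (𝓡 2) x).map_source hy
    have hT := hu.isTangentPlane y
    have hTeq := hu.tangentPlane_eq x hy
    let L : Plane2 →ₗ[ℝ] Quadric :=
      (wedgeQuadric (u y)).comp (fderiv ℝ (inChart u x) c : Plane2 →ₗ[ℝ] R23)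
    have hmem : ∀ ν, fderiv ℝ (inChart u x) c ν ∈ tangentPlane u y := fun ν => by
      rw [hTeq]; exact ⟨ν, rfl⟩
    have hker : LinearMap.ker L = ⊥ := by
      rw [LinearMap.ker_eq_bot']
      intro ν hν
      by_contra h0
      have h1 := hu.fderiv_inChart_spacelike x hct h0
      have h2 : fderiv ℝ (inChart u x) c ν = 0 :=
        hT.wedgeQuadric_injOn (hmem ν) (Submodule.zero_mem _) (by rw [map_zero]; exact hν)
      rw [h2] at h1
      simp at h1
    refine ⟨planeBasis.linearIndependent.map' L hker, ?_⟩
    have : planePencil (u y) (tangentPlane u y) = LinearMap.range L := by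
      rw [planePencil, hTeq, LinearMap.range_comp]
    refine Eq.trans ?_ this.symm
    rw [LinearMap.range_eq_map, ← planeBasis.span_eq, LinearMap.map_span, ← range_comp]
    rfl

end IsSpacelikeImmersion

end Surface

/-! ### Differentiability of the scalar product, the contraction and the frame coefficients -/

theorem DifferentiableAt.form23 {E : Type*} [NormedAddCommGroup E] [NormedSpace ℝ E]
    {f g : E → R23} {x : E} (hf : DifferentiableAt ℝ f x) (hg : DifferentiableAt ℝ g x) :
    DifferentiableAt ℝ (fun y => _root_.form23 (f y) (g y)) x :=
  ((ContDiffAt.form23 (contDiffAt_fst (n := 1)) (contDiffAt_snd (p := (f x, g x)))).differentiableAt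
    (by simp)).comp x (f := fun y => (f y, g y)) (hf.prodMk hg)

theorem DifferentiableAt.contract {E : Type*} [NormedAddCommGroup E] [NormedSpace ℝ E]
    {a : E → R23} {q : E → Quadric} {x : E} (ha : DifferentiableAt ℝ a x)
    (hq : DifferentiableAt ℝ q x) : DifferentiableAt ℝ (fun y => _root_.contract (a y) (q y)) x :=
  ((ContDiff.contract_prod (n := 1)).contDiffAt.differentiableAt (by simp)).comp x
    (f := fun y => (a y, q y)) (ha.prodMk hq)

theorem DifferentiableAt.frameCoeff {E : Type*} [NormedAddCommGroup E] [NormedSpace ℝ E]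
    {a b z : E → R23} {x : E} (ha : DifferentiableAt ℝ a x) (hb : DifferentiableAt ℝ b x)
    (hz : DifferentiableAt ℝ z x) (h : gramDet (a x) (b x) ≠ 0) :
    DifferentiableAt ℝ (fun y => _root_.frameCoeff (a y) (b y) (z y)) x := by
  have h1 := ((hz.form23 ha).fun_mul (hb.form23 hb)).fun_sub ((hz.form23 hb).fun_mul (ha.form23 hb))
  have h2 : DifferentiableAt ℝ (fun y => gramDet (a y) (b y)) x :=
    ((ha.form23 ha).fun_mul (hb.form23 hb)).fun_sub ((ha.form23 hb).fun_pow 2)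
  have h3 := h1.fun_mul (h2.fun_inv h)
  simpa only [_root_.frameCoeff, div_eq_mul_inv] using h3

/-! ### The differential of the Gauss map -/

section Surface

variable {S : Type*} [TopologicalSpace S] [ChartedSpace Plane2 S] {u : S → R23}

/-- The coordinates, in the chart at `x`, of a vector tangent to the surface. -/
def chartCoord (u : S → R23) (x : S) (c : Plane2) (z : R23) : Plane2 :=
  frameCoeff (chartFrame u x 0 c) (chartFrame u x 1 c) z • planeBasis 0 +
    frameCoeff (chartFrame u x 1 c) (chartFrame u x 0 c) z • planeBasis 1

/-- The tangent plane at a point of the chart at `x`. -/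
def chartPlane (u : S → R23) (x : S) (c : Plane2) : Submodule ℝ R23 :=
  LinearMap.range (fderiv ℝ (inChart u x) c : Plane2 →ₗ[ℝ] R23)

theorem fderiv_mem_chartPlane (x : S) (c ν : Plane2) :
    fderiv ℝ (inChart u x) c ν ∈ chartPlane u x c := ⟨ν, rfl⟩

variable [IsManifold (𝓡 2) ∞ S]

namespace IsSpacelikeImmersion

variable (hu : IsSpacelikeImmersion u)
include hu

theorem tangentPlane_symm (x : S) {c : Plane2} (hc : c ∈ (extChartAt (𝓡 2) x).target) :
    tangentPlane u ((extChartAt (𝓡 2) x).symm c) = chartPlane u x c := by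
  rw [hu.tangentPlane_eq x ((extChartAt (𝓡 2) x).map_target hc),
    (extChartAt (𝓡 2) x).right_inv hc, chartPlane]

theorem isTangentPlane_inChart (x : S) {c : Plane2} (hc : c ∈ (extChartAt (𝓡 2) x).target) :
    IsTangentPlane (inChart u x c) (chartPlane u x c) := by
  rw [← hu.tangentPlane_symm x hc]
  exact hu.isTangentPlane _

theorem fderiv_chartCoord (x : S) {c : Plane2} (hc : c ∈ (extChartAt (𝓡 2) x).target) {z : R23}
    (hz : z ∈ chartPlane u x c) :
    fderiv ℝ (inChart u x) c (chartCoord u x c z) = z := by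
  rw [chartPlane, range_fderiv_eq_span] at hz
  rw [chartCoord, map_add, map_smul, map_smul]
  exact (eq_frameCoeff (hu.gramDet_chartFrame_pos x hc).ne' hz).symm

theorem differentiableAt_chartCoord (x : S) {E : Type*} [NormedAddCommGroup E] [NormedSpace ℝ E]
    {c : E → Plane2} {z : E → R23} {e : E} (hc : c e ∈ (extChartAt (𝓡 2) x).target)
    (hcd : DifferentiableAt ℝ c e) (hz : DifferentiableAt ℝ z e) :
    DifferentiableAt ℝ (fun y => chartCoord u x (c y) (z y)) e := by
  have hE : ∀ i, DifferentiableAt ℝ (fun y => chartFrame u x i (c y)) e := fun i =>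
    ((hu.contDiffAt_chartFrame x i hc).differentiableAt (by simp)).comp e hcd
  have hg := (hu.gramDet_chartFrame_pos x hc).ne'
  exact (((hE 0).frameCoeff (hE 1) hz hg).smul_const _).add
    (((hE 1).frameCoeff (hE 0) hz (by rwa [gramDet_comm])).smul_const _)

theorem fderiv_inChart_injective (x : S) {c : Plane2} (hc : c ∈ (extChartAt (𝓡 2) x).target) :
    Function.Injective (fderiv ℝ (inChart u x) c) := by
  rw [injective_iff_map_eq_zero]
  intro ν hν
  by_contra h0
  have := hu.fderiv_inChart_spacelike x hc h0
  rw [hν] at this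
  simp at this

/-- The derivative of a section of the pencils of the tangent planes, in a chart. -/
theorem hasFDerivAt_section (x : S) {c₀ : Plane2} (hc₀ : c₀ ∈ (extChartAt (𝓡 2) x).target)
    {s : Plane2 → Quadric} {s' : Plane2 →L[ℝ] Quadric} (hs : HasFDerivAt s s' c₀)
    (hmem : ∀ᶠ c in 𝓝 c₀, s c ∈ planePencil (inChart u x c) (chartPlane u x c)) (ν W : Plane2)
    (hW : fderiv ℝ (inChart u x) c₀ W = contract (inChart u x c₀) (s c₀)) :
    s' ν - (wedgeQuadric (fderiv ℝ (inChart u x) c₀ ν) (fderiv ℝ (inChart u x) c₀ W) +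
      wedgeQuadric (inChart u x c₀) (fderiv ℝ (fderiv ℝ (inChart u x)) c₀ ν W)) ∈
        planePencil (inChart u x c₀) (chartPlane u x c₀) := by
  have hF : DifferentiableAt ℝ (inChart u x) c₀ :=
    (hu.contDiffAt_inChart x hc₀).differentiableAt (by simp)
  have hF' : DifferentiableAt ℝ (fderiv ℝ (inChart u x)) c₀ :=
    (hu.contDiffAt_fderiv_inChart x hc₀).differentiableAt (by simp)
  have hY := hF.contract hs.differentiableAt
  have hYmem : ∀ {c}, c ∈ (extChartAt (𝓡 2) x).target →
      s c ∈ planePencil (inChart u x c) (chartPlane u x c) →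
      fderiv ℝ (inChart u x) c (chartCoord u x c (contract (inChart u x c) (s c))) =
        contract (inChart u x c) (s c) := fun hc h =>
    hu.fderiv_chartCoord x hc ((hu.isTangentPlane_inChart x hc).contract_mem h)
  -- Coordinates of the tangent field Y with s = u ∧ Y. The product rule can then be applied to s =
  -- F ∧ dF(a), where F is u in the chart.
  set a : Plane2 → Plane2 := fun c => chartCoord u x c (contract (inChart u x c) (s c)) with ha
  have had : DifferentiableAt ℝ a c₀ := hu.differentiableAt_chartCoord x hc₀ differentiableAt_id hY
  have hsec : s =ᶠ[𝓝 c₀] fun c => wedgeQuadric (inChart u x c) (fderiv ℝ (inChart u x) c (a c)) := by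
    filter_upwards [hmem, (isOpen_extChartAt_target x).mem_nhds hc₀] with c hc hct
    rw [hYmem hct hc, (hu.isTangentPlane_inChart x hct).wedgeQuadric_contract hc]
  have haW : a c₀ = W :=
    hu.fderiv_inChart_injective x hc₀ ((hYmem hc₀ hmem.self_of_nhds).trans hW.symm)
  obtain ⟨L, hL, hLv⟩ := HasFDerivAt.wedgeQuadric hF.hasFDerivAt
    (hF'.hasFDerivAt.clm_apply had.hasFDerivAt)
  -- After cancellation only F ∧ dF(da(ν)) remains, an element of the pencil.
  rw [hs.unique (hL.congr_of_eventuallyEq hsec), hLv, haW, add_sub_add_left_eq_sub, ← map_sub]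
  refine ⟨_, ?_, rfl⟩
  convert fderiv_mem_chartPlane (u := u) x c₀ (fderiv ℝ a c₀ ν) using 1
  simp

theorem mfderiv_section (x : S) {s : S → Quadric}
    (hs : MDifferentiableAt (𝓡 2) 𝓘(ℝ, Quadric) s x)
    (hmem : ∀ᶠ y in 𝓝 x, s y ∈ planePencil (u y) (tangentPlane u y)) (v W : TangentSpace (𝓡 2) x)
    (hW : diffAt u x W = contract (u x) (s x)) :
    (show Quadric from mfderiv (𝓡 2) 𝓘(ℝ, Quadric) s x v) -
      (wedgeQuadric (diffAt u x v) (diffAt u x W) +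
      wedgeQuadric (u x) (secondDerivAt u x v W)) ∈ planePencil (u x) (tangentPlane u x) := by
  have hc₀ : extChartAt (𝓡 2) x x ∈ (extChartAt (𝓡 2) x).target := mem_extChartAt_target x
  have hsymm : (extChartAt (𝓡 2) x).symm (extChartAt (𝓡 2) x x) = x := extChartAt_to_inv x
  have hder : HasFDerivAt (s ∘ (extChartAt (𝓡 2) x).symm)
      (mfderiv (𝓡 2) 𝓘(ℝ, Quadric) s x : Plane2 →L[ℝ] Quadric) (extChartAt (𝓡 2) x x) := by
    have h1 := hs.hasMFDerivAt.2
    rw [modelWithCornersSelf_coe, range_id] at h1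
    exact (hasFDerivWithinAt_univ (𝕜 := ℝ) (E := Plane2) (F := Quadric)).1 h1
  have h6 : inChart u x (extChartAt (𝓡 2) x x) = u x := by simp only [inChart, Function.comp_apply, hsymm]
  have key := hu.hasFDerivAt_section x hc₀ hder (by
    have ht : Filter.Tendsto (extChartAt (𝓡 2) x).symm (𝓝 (extChartAt (𝓡 2) x x)) (𝓝 x) := by
      have := (continuousAt_extChartAt_symm (I := 𝓡 2) x).tendsto
      rwa [hsymm] at this
    filter_upwards [ht.eventually hmem, (isOpen_extChartAt_target x).mem_nhds hc₀] with c hc hct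
    rwa [← hu.tangentPlane_symm x hct]) v W (by
      rw [h6, Function.comp_apply, hsymm, ← hW]
      exact (hu.diffAt_eq x W).symm)
  rw [← hu.tangentPlane_symm x hc₀, hsymm, h6] at key
  have h7 := hu.diffAt_eq x v
  have h8 := hu.diffAt_eq x W
  rw [h7, h8]
  exact key

/-- The tangent vector corresponding to an element of the pencil. -/
def pencilVector (x : S) : planePencil (u x) (tangentPlane u x) →ₗ[ℝ] TangentSpace (𝓡 2) x :=
  (LinearEquiv.ofInjective _ (hu.diffAt_injective x) :
    TangentSpace (𝓡 2) x ≃ₗ[ℝ] tangentPlane u x).symm.toLinearMap.comp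
      ((contract (u x)).restrict fun _ hq => (hu.isTangentPlane x).contract_mem hq)

theorem diffAt_pencilVector (x : S) (q : planePencil (u x) (tangentPlane u x)) :
    diffAt u x (hu.pencilVector x q) = contract (u x) q :=
  congrArg Subtype.val (LinearEquiv.apply_symm_apply (LinearEquiv.ofInjective _
    (hu.diffAt_injective x) : TangentSpace (𝓡 2) x ≃ₗ[ℝ] tangentPlane u x) _)

/-- The differential of the Gauss map. -/
def gaussDifferential (x : S) : TangentSpace (𝓡 2) x →ₗ[ℝ]
    (planePencil (u x) (tangentPlane u x) →ₗ[ℝ] Quadric ⧸ planePencil (u x) (tangentPlane u x)) :=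
  LinearMap.mk₂ ℝ (fun v q => (planePencil (u x) (tangentPlane u x)).mkQ
      (wedgeQuadric (diffAt u x v) (diffAt u x (hu.pencilVector x q)) +
        wedgeQuadric (u x) (secondDerivAt u x v (hu.pencilVector x q))))
    (fun v v' q => by
      rw [← map_add, (diffAt u x).map_add, LinearMap.map_add₂, secondDerivAt_add_left,
        (wedgeQuadric (u x)).map_add, add_add_add_comm])
    (fun c v q => by
      rw [← map_smul, (diffAt u x).map_smul, LinearMap.map_smul₂, secondDerivAt_smul_left,
        (wedgeQuadric (u x)).map_smul, smul_add])
    (fun v q q' => by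
      rw [← map_add, (hu.pencilVector x).map_add, (diffAt u x).map_add,
        (wedgeQuadric (diffAt u x v)).map_add,
        secondDerivAt_add_right, (wedgeQuadric (u x)).map_add, add_add_add_comm])
    (fun c v q => by
      rw [← map_smul, (hu.pencilVector x).map_smul, (diffAt u x).map_smul, map_smul,
        secondDerivAt_smul_right, (wedgeQuadric (u x)).map_smul, smul_add])

theorem gaussDifferential_apply (x : S) (v : TangentSpace (𝓡 2) x)
    (q : planePencil (u x) (tangentPlane u x)) : hu.gaussDifferential x v q =
    (planePencil (u x) (tangentPlane u x)).mkQ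
      (wedgeQuadric (diffAt u x v) (diffAt u x (hu.pencilVector x q)) +
        wedgeQuadric (u x) (secondDerivAt u x v (hu.pencilVector x q))) := rfl

theorem isPencilDifferentialAt_gaussDifferential (x : S) :
    IsPencilDifferentialAt (fun x => planePencil (u x) (tangentPlane u x)) x
      (hu.gaussDifferential x) := by
  intro s hs hmem h v
  rw [gaussDifferential_apply]
  refine ((Submodule.Quotient.eq _).2 ?_).symm
  exact hu.mfderiv_section x hs hmem v _ (hu.diffAt_pencilVector x ⟨s x, h⟩)

/-- With v normalized, the image of u ∧ Jv is the class of v ∧ Jv + u ∧ II(v, Jv), which is positive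
by `exists_isPositive`. -/
theorem isFittingDirection_gaussDifferential
    (hII : ∀ (x : S) (v : TangentSpace (𝓡 2) x), v ≠ 0 →
      ∀ n, IsSecondFundamentalForm u x v v n →
        Real.sqrt (-form23 n n) < form23 (diffAt u x v) (diffAt u x v))
    (x : S) {v : TangentSpace (𝓡 2) x} (hv : v ≠ 0) :
    IsFittingDirection (hu.gaussDifferential x v) := by
  have hT := hu.isTangentPlane x
  obtain ⟨c, hc, hc1⟩ := exists_smul_form23_eq_one (hu.spacelike x v hv)
  rw [← map_smul] at hc1
  obtain ⟨_, ⟨⟨W, rfl⟩, hp, ho⟩, -⟩ := hT.existsUnique_rotation (LinearMap.mem_range_self _ _) hc1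
  have hpos := hu.exists_isPositive hII x hp ho
  have hmem : wedgeQuadric (u x) (diffAt u x W) ∈ planePencil (u x) (tangentPlane u x) :=
    ⟨_, LinearMap.mem_range_self _ W, rfl⟩
  -- By bilinearity, the factor c that normalizes v is moved to the element of the pencil.
  refine ⟨_, hpos, c • ⟨_, hmem⟩, ?_⟩
  have hW : hu.pencilVector x ⟨_, hmem⟩ = W := by
    apply hu.diffAt_injective x
    rw [diffAt_pencilVector]
    exact contract_wedgeQuadric hT.point (hT.orthogonal _ (LinearMap.mem_range_self _ W))
  rw [map_smul, ← LinearMap.smul_apply, ← map_smul, gaussDifferential_apply, hW]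
  refine (Submodule.Quotient.eq _).2 ?_
  rw [add_sub_add_left_eq_sub]
  exact wedgeQuadric_sub_normalPart_mem x (LinearMap.mem_range_self _ _)
    (LinearMap.mem_range_self _ _) _

theorem isFittingImmersion_gaussMap
    (hII : ∀ (x : S) (v : TangentSpace (𝓡 2) x), v ≠ 0 →
      ∀ n, IsSecondFundamentalForm u x v v n →
        Real.sqrt (-form23 n n) < form23 (diffAt u x v) (diffAt u x v)) :
    IsFittingImmersion (gaussMap u) := by
  rw [show gaussMap u = fun x => planePencil (u x) (tangentPlane u x) from funext hu.gaussMap_eq]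
  refine ⟨fun x => (hu.isTangentPlane x).isMixedPencil, hu.isSmoothPencilMap, fun x =>
    ⟨hu.gaussDifferential x, hu.isPencilDifferentialAt_gaussDifferential x, ?_, fun v hv =>
      hu.isFittingDirection_gaussDifferential hII x hv⟩⟩
  -- A vector in the kernel would make a positive quadric an element of the pencil, which is
  -- excluded by `not_isPositive`.
  rw [injective_iff_map_eq_zero]
  intro v hv
  by_contra h0
  obtain ⟨q, hq, r, hr⟩ := hu.isFittingDirection_gaussDifferential hII x h0
  rw [hv, LinearMap.zero_apply] at hr
  exact (hu.isTangentPlane x).not_isPositive ((Submodule.Quotient.mk_eq_zero _).1 hr.symm) hq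

end IsSpacelikeImmersion

end Surface

/-! ### Rotation by a right angle in a spacelike plane -/

/-- The rotation by a right angle of the spacelike plane with basis `(a, b)`, oriented by its
projection to `ℝ^{2,0}`. -/
def frameRotation (a b w : R23) : R23 :=
  (orient a b / Real.sqrt (orient a b ^ 2 * gramDet a b)) • (form23 w a • b - form23 w b • a)

/-- `(a, b)` is a basis of the spacelike plane `T`. -/
structure IsSpacelikeFrame (T : Submodule ℝ R23) (a b : R23) : Prop where
  span_eq : T = Submodule.span ℝ {a, b}
  pos : ∀ s t : ℝ, s ≠ 0 ∨ t ≠ 0 → 0 < form23 (s • a + t • b) (s • a + t • b)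

namespace IsSpacelikeFrame

variable {T : Submodule ℝ R23} {a b : R23} (h : IsSpacelikeFrame T a b)
include h

theorem radicand_pos : 0 < orient a b ^ 2 * gramDet a b :=
  mul_pos (sq_pos_of_ne_zero (orient_ne_zero_of_spacelike h.pos)) (gram_pos h.pos)

theorem frameRotation_mem (w : R23) : frameRotation a b w ∈ T := by
  rw [h.span_eq]
  exact Submodule.smul_mem _ _ (Submodule.sub_mem _
    (Submodule.smul_mem _ _ (Submodule.subset_span (by simp)))
    (Submodule.smul_mem _ _ (Submodule.subset_span (by simp))))

theorem isSpacelikePair_frameRotation {w : R23} (hw : w ∈ T) (h1 : form23 w w = 1) :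
    IsSpacelikePair w (frameRotation a b w) ∧ 0 < orient w (frameRotation a b w) := by
  have hr := h.radicand_pos
  have ho := orient_ne_zero_of_spacelike h.pos
  have hg := gram_pos h.pos
  change 0 < gramDet a b at hg
  -- This is the sign of the orientation divided by the square root of the Gram determinant, in a
  -- form that is visibly smooth in the frame.
  set k : ℝ := orient a b / Real.sqrt (orient a b ^ 2 * gramDet a b) with hk
  have hk2 : k ^ 2 * gramDet a b = 1 := by
    rw [hk, div_pow, Real.sq_sqrt hr.le]
    field_simp
  have hko : 0 < k * orient a b := by
    rw [hk, div_mul_eq_mul_div, ← sq]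
    exact div_pos (by positivity) (Real.sqrt_pos.2 hr)
  rw [h.span_eq, Submodule.mem_span_pair] at hw
  obtain ⟨s, t, rfl⟩ := hw
  have hrot : frameRotation a b (s • a + t • b) = k • (form23 (s • a + t • b) a • b -
    form23 (s • a + t • b) b • a) := rfl
  simp only [map_add, map_smul, LinearMap.add_apply, LinearMap.smul_apply, smul_eq_mul,
    form23_comm b a] at h1 hrot
  rw [gramDet] at hk2
  refine ⟨⟨?_, ?_, ?_⟩, ?_⟩
  · simp only [map_add, map_smul, LinearMap.add_apply, LinearMap.smul_apply, smul_eq_mul,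
      form23_comm b a]
    exact h1
  · rw [hrot]
    simp only [map_sub, map_smul, LinearMap.sub_apply, LinearMap.smul_apply, smul_eq_mul,
      form23_comm b a]
    linear_combination hk2 + k ^ 2 * (form23 a a * form23 b b - form23 a b ^ 2) * h1
  · rw [hrot]
    simp only [map_add, map_sub, map_smul, LinearMap.add_apply, LinearMap.smul_apply, smul_eq_mul,
      form23_comm b a]
    ring
  · rw [hrot]
    have : orient (s • a + t • b) (k • ((s * form23 a a + t * form23 a b) • b -
        (s * form23 a b + t * form23 b b) • a)) = k * orient a b := by
      simp only [orient, Pi.add_apply, Pi.sub_apply, Pi.smul_apply, smul_eq_mul]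
      linear_combination k * (a 0 * b 1 - a 1 * b 0) * h1
    rw [this]
    exact hko

end IsSpacelikeFrame

theorem ContDiffAt.orient {E : Type*} [NormedAddCommGroup E] [NormedSpace ℝ E] {n : WithTop ℕ∞}
    {a b : E → R23} {x : E} (ha : ContDiffAt ℝ n a x) (hb : ContDiffAt ℝ n b x) :
    ContDiffAt ℝ n (fun y => _root_.orient (a y) (b y)) x :=
  (((contDiffAt_pi.1 ha 0).mul (contDiffAt_pi.1 hb 1)).sub
    ((contDiffAt_pi.1 ha 1).mul (contDiffAt_pi.1 hb 0)))

theorem ContDiffAt.frameRotation {E : Type*} [NormedAddCommGroup E] [NormedSpace ℝ E]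
    {n : WithTop ℕ∞} {a b w : E → R23} {x : E} (ha : ContDiffAt ℝ n a x) (hb : ContDiffAt ℝ n b x)
    (hw : ContDiffAt ℝ n w x) {T : Submodule ℝ R23} (h : IsSpacelikeFrame T (a x) (b x)) :
    ContDiffAt ℝ n (fun y => _root_.frameRotation (a y) (b y) (w y)) x := by
  have hg : ContDiffAt ℝ n (fun y => gramDet (a y) (b y)) x :=
    ((ha.form23 ha).mul (hb.form23 hb)).sub ((ha.form23 hb).pow 2)
  have hd := ((((ha.orient hb).pow 2).mul hg).sqrt h.radicand_pos.ne').inv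
    (Real.sqrt_pos.2 h.radicand_pos).ne'
  have := ((ha.orient hb).mul hd).smul (((hw.form23 ha).smul hb).sub ((hw.form23 hb).smul ha))
  simp only [_root_.frameRotation, div_eq_mul_inv]
  exact this

theorem IsTangentPlane.eq_frameRotation {p : R23} {T : Submodule ℝ R23} (hT : IsTangentPlane p T)
    {a b : R23} (h : IsSpacelikeFrame T a b) {w V : R23} (hw : w ∈ T) (hV : V ∈ T)
    (hwV : IsSpacelikePair w V) (ho : 0 < orient w V) : V = frameRotation a b w :=
  (hT.existsUnique_rotation hw hwV.left).unique ⟨hV, hwV, ho⟩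
    ⟨h.frameRotation_mem w, h.isSpacelikePair_frameRotation hw hwV.left⟩

/-! ### Unit tangent vectors and directions of the pencil -/

section Surface

variable {S : Type*} [TopologicalSpace S] [ChartedSpace Plane2 S] {u : S → R23}

variable [IsManifold (𝓡 2) ∞ S]

namespace IsSpacelikeImmersion

variable (hu : IsSpacelikeImmersion u)
include hu

/-- Translation of the definition by maximal triples into q_w = u ∧ Jw. -/
theorem isVelocityQuadric_iff {x : S} {w : R23} (hw : IsUnitTangent u x w) {q : Quadric} :
    IsVelocityQuadric u x w q ↔ ∃ V ∈ tangentPlane u x, IsSpacelikePair w V ∧ 0 < orient w V ∧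
      q = wedgeQuadric (u x) V := by
  have hT := hu.isTangentPlane x
  have hwT := hT.isUnitTangentAt hw.1 hw.2
  constructor
  · rintro ⟨V, hV, hVw, hmax, hq⟩
    have hVT := hT.isUnitTangentAt hV.1 hV.2
    rw [form23_comm] at hVw
    exact ⟨V, hV.1, ⟨hw.2, hV.2, hVw⟩, (isMaximalTriple_iff hwT hVT hVw).1 hmax,
      hVT.isLagrangianQuadric_iff.1 hq⟩
  · rintro ⟨V, hV, hwV, ho, rfl⟩
    have hVT := hT.isUnitTangentAt hV hwV.right
    exact ⟨V, ⟨hV, hwV.right⟩, hwV.symm.orthogonal, (isMaximalTriple_iff hwT hVT hwV.orthogonal).2 ho,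
      hVT.isLagrangianQuadric⟩

theorem isVelocityQuadric_iff_eq {x : S} {w : R23} (hw : IsUnitTangent u x w) {a b : R23}
    (h : IsSpacelikeFrame (tangentPlane u x) a b) {q : Quadric} :
    IsVelocityQuadric u x w q ↔ q = wedgeQuadric (u x) (frameRotation a b w) := by
  rw [hu.isVelocityQuadric_iff hw]
  constructor
  · rintro ⟨V, hV, hwV, ho, rfl⟩
    rw [(hu.isTangentPlane x).eq_frameRotation h hw.1 hV hwV ho]
  · rintro rfl
    exact ⟨_, h.frameRotation_mem w, (h.isSpacelikePair_frameRotation hw.1 hw.2).1,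
      (h.isSpacelikePair_frameRotation hw.1 hw.2).2, rfl⟩

theorem existsUnique_isVelocityQuadric {x : S} {w : R23} (hw : IsUnitTangent u x w) :
    ∃! q, IsVelocityQuadric u x w q := by
  obtain ⟨V, ⟨hV, hwV, ho⟩, huniq⟩ := (hu.isTangentPlane x).existsUnique_rotation hw.1 hw.2
  refine ⟨wedgeQuadric (u x) V, (hu.isVelocityQuadric_iff hw).2 ⟨V, hV, hwV, ho, rfl⟩, ?_⟩
  intro q hq
  obtain ⟨V', hV', hwV', ho', rfl⟩ := (hu.isVelocityQuadric_iff hw).1 hq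
  rw [huniq V' ⟨hV', hwV', ho'⟩]

theorem contract_ne_zero {x : S} {q : Quadric} (hq : q ∈ gaussMap u x) (h0 : q ≠ 0) :
    contract (u x) q ≠ 0 := by
  rw [hu.gaussMap_eq] at hq
  intro h
  rw [← (hu.isTangentPlane x).wedgeQuadric_contract hq, h, map_zero] at h0
  exact h0 rfl

/-- The quadric of a velocity is u ∧ V with V a unit vector, so the scale c is forced to be the
normalizing factor k, and w must be the inverse quarter turn of the normalized contraction. -/
theorem exists_velocity_iff {x : S} {q : Quadric} (hq : q ∈ gaussMap u x) {k : ℝ} (hk : 0 < k)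
    (hk1 : form23 (k • contract (u x) q) (k • contract (u x) q) = 1) {w : R23} :
    (IsUnitTangent u x w ∧ ∃ c : ℝ, 0 < c ∧ IsVelocityQuadric u x w (c • q)) ↔
      w ∈ tangentPlane u x ∧ IsSpacelikePair w (k • contract (u x) q) ∧
        0 < orient w (k • contract (u x) q) := by
  have hT := hu.isTangentPlane x
  rw [hu.gaussMap_eq] at hq
  constructor
  · rintro ⟨hw, c, hc, hcq⟩
    obtain ⟨V, hV, hwV, ho, he⟩ := (hu.isVelocityQuadric_iff hw).1 hcq
    have hVc : V = c • contract (u x) q := by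
      rw [← map_smul, he, contract_wedgeQuadric hT.point (hT.orthogonal V hV)]
    have hck : c = k := by
      have h1 := hwV.right
      rw [hVc] at h1
      simp only [map_smul, LinearMap.smul_apply, smul_eq_mul] at h1 hk1
      have hy : form23 (contract (u x) q) (contract (u x) q) ≠ 0 := fun h => by
        rw [h] at hk1; simp at hk1
      have : c * c = k * k := mul_right_cancel₀ hy (by linarith)
      exact (mul_self_inj hc.le hk.le).1 this
    rw [← hck, ← hVc]
    exact ⟨hw.1, hwV, ho⟩
  · rintro ⟨hw, hwV, ho⟩
    have hwu : IsUnitTangent u x w := ⟨hw, hwV.left⟩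
    refine ⟨hwu, k, hk, (hu.isVelocityQuadric_iff hwu).2
      ⟨_, (tangentPlane u x).smul_mem k (hT.contract_mem hq), hwV, ho, ?_⟩⟩
    rw [map_smul, hT.wedgeQuadric_contract hq]

theorem existsUnique_velocity {x : S} {q : Quadric} (hq : q ∈ gaussMap u x) (h0 : q ≠ 0) :
    ∃! w, IsUnitTangent u x w ∧ ∃ c : ℝ, 0 < c ∧ IsVelocityQuadric u x w (c • q) := by
  have hT := hu.isTangentPlane x
  have hY : contract (u x) q ∈ tangentPlane u x :=
    hT.contract_mem (by rwa [← hu.gaussMap_eq])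
  obtain ⟨k, hk, hk1⟩ := exists_smul_form23_eq_one (hT.pos _ hY (hu.contract_ne_zero hq h0))
  simp only [hu.exists_velocity_iff hq hk hk1]
  exact hT.existsUnique_rotation_inv ((tangentPlane u x).smul_mem k hY) hk1

/-- A formula for the velocity corresponding to an element of the pencil. -/
theorem velocity_eq {x : S} {a b : R23} (h : IsSpacelikeFrame (tangentPlane u x) a b) {q : Quadric}
    (hq : q ∈ gaussMap u x) (h0 : q ≠ 0) {w : R23} (hw : IsUnitTangent u x w) {c : ℝ} (hc : 0 < c)
    (hcq : IsVelocityQuadric u x w (c • q)) :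
    w = -frameRotation a b
      ((Real.sqrt (form23 (contract (u x) q) (contract (u x) q)))⁻¹ • contract (u x) q) := by
  have hT := hu.isTangentPlane x
  have hY : contract (u x) q ∈ tangentPlane u x :=
    hT.contract_mem (by rwa [← hu.gaussMap_eq])
  have hpos := hT.pos _ hY (hu.contract_ne_zero hq h0)
  set k := (Real.sqrt (form23 (contract (u x) q) (contract (u x) q)))⁻¹ with hk
  have hk0 : 0 < k := inv_pos.2 (Real.sqrt_pos.2 hpos)
  have hk1 : form23 (k • contract (u x) q) (k • contract (u x) q) = 1 := by
    rw [map_smul, map_smul, LinearMap.smul_apply, smul_eq_mul, smul_eq_mul, ← mul_assoc, hk,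
      ← mul_inv, Real.mul_self_sqrt hpos.le, inv_mul_cancel₀ hpos.ne']
  obtain ⟨hwT, hwV, ho⟩ := (hu.exists_velocity_iff hq hk0 hk1).1 ⟨hw, c, hc, hcq⟩
  rw [← hT.eq_frameRotation h ((tangentPlane u x).smul_mem k hY)
    ((tangentPlane u x).neg_mem hwT) hwV.symm.neg_right
    (by rw [orient_neg_right, orient_swap, neg_neg]; exact ho), neg_neg]

end IsSpacelikeImmersion

end Surface

/-! ### Geodesics in a chart and the growth of their quadrics -/

section Surface

variable {S : Type*} [TopologicalSpace S] [ChartedSpace Plane2 S] {u : S → R23}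

/-- A curve, in the chart at `x`. -/
def chartCurve (x : S) (γ : ℝ → S) (t : ℝ) : Plane2 := extChartAt (𝓡 2) x (γ t)

theorem inChart_chartCurve {x : S} {γ : ℝ → S} {t : ℝ} (ht : γ t ∈ (extChartAt (𝓡 2) x).source) :
    inChart u x (chartCurve x γ t) = u (γ t) := by
  simp only [inChart, chartCurve, Function.comp_apply, (extChartAt (𝓡 2) x).left_inv ht]

theorem chartCurve_mem {x : S} {γ : ℝ → S} {t : ℝ} (ht : γ t ∈ (extChartAt (𝓡 2) x).source) :
    chartCurve x γ t ∈ (extChartAt (𝓡 2) x).target := (extChartAt (𝓡 2) x).map_source ht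

theorem IsUnitGeodesic.eventually_mem_source {γ : ℝ → S} {J : Set ℝ} (hγ : IsUnitGeodesic u γ J)
    (hJ : IsOpen J) {x : S} {t : ℝ} (ht : t ∈ J) (htx : γ t ∈ (extChartAt (𝓡 2) x).source) :
    ∀ᶠ s in 𝓝 t, s ∈ J ∧ γ s ∈ (extChartAt (𝓡 2) x).source :=
  (hJ.eventually_mem ht).and ((hγ.smooth.continuousOn.continuousAt (hJ.mem_nhds ht)).eventually
    ((isOpen_extChartAt_source x).mem_nhds htx))

variable [IsManifold (𝓡 2) ∞ S]

namespace IsUnitGeodesic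

variable {γ : ℝ → S} {J : Set ℝ} (hγ : IsUnitGeodesic u γ J) (hJ : IsOpen J)
include hγ hJ

theorem contDiffAt_chartCurve {x : S} {t : ℝ} (ht : t ∈ J)
    (htx : γ t ∈ (extChartAt (𝓡 2) x).source) : ContDiffAt ℝ 2 (chartCurve x γ) t := by
  have h1 : ContMDiffAt 𝓘(ℝ, ℝ) (𝓡 2) 2 γ t := hγ.smooth.contMDiffAt (hJ.mem_nhds ht)
  have h2 : ContMDiffAt (𝓡 2) 𝓘(ℝ, Plane2) 2 (extChartAt (𝓡 2) x) (γ t) :=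
    (contMDiffAt_extChartAt' (n := ∞) (by simpa using htx)).of_le ENat.LEInfty.out
  exact contMDiffAt_iff_contDiffAt.1 (h2.comp t h1)

theorem hasDerivAt_chartCurve {x : S} {t : ℝ} (ht : t ∈ J)
    (htx : γ t ∈ (extChartAt (𝓡 2) x).source) :
    HasDerivAt (chartCurve x γ) (deriv (chartCurve x γ) t) t :=
  ((hγ.contDiffAt_chartCurve hJ ht htx).differentiableAt (by simp)).hasDerivAt

theorem hasDerivAt_deriv_chartCurve {x : S} {t : ℝ} (ht : t ∈ J)
    (htx : γ t ∈ (extChartAt (𝓡 2) x).source) :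
    HasDerivAt (deriv (chartCurve x γ)) (deriv (deriv (chartCurve x γ)) t) t := by
  have := (hγ.contDiffAt_chartCurve hJ ht htx).fderiv_right (m := 1) (by norm_num)
  have h2 : DifferentiableAt ℝ (fun s => fderiv ℝ (chartCurve x γ) s 1) t :=
    (this.differentiableAt (by simp)).clm_apply (differentiableAt_const _)
  exact h2.hasDerivAt

variable (hu : IsSpacelikeImmersion u)
include hu

theorem hasDerivAt_comp {x : S} {t : ℝ} (ht : t ∈ J) (htx : γ t ∈ (extChartAt (𝓡 2) x).source) :
    HasDerivAt (u ∘ γ)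
      (fderiv ℝ (inChart u x) (chartCurve x γ t) (deriv (chartCurve x γ) t)) t := by
  have hF := ((hu.contDiffAt_inChart x (chartCurve_mem htx)).differentiableAt (by simp)).hasFDerivAt
  refine (hF.comp_hasDerivAt t (hγ.hasDerivAt_chartCurve hJ ht htx)).congr_of_eventuallyEq ?_
  filter_upwards [hγ.eventually_mem_source hJ ht htx] with s hs
  exact (inChart_chartCurve hs.2).symm

theorem deriv_comp {x : S} {t : ℝ} (ht : t ∈ J) (htx : γ t ∈ (extChartAt (𝓡 2) x).source) :
    deriv (u ∘ γ) t = fderiv ℝ (inChart u x) (chartCurve x γ t) (deriv (chartCurve x γ) t) :=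
  (hγ.hasDerivAt_comp hJ hu ht htx).deriv

theorem hasDerivAt_deriv_comp {x : S} {t : ℝ} (ht : t ∈ J)
    (htx : γ t ∈ (extChartAt (𝓡 2) x).source) :
    HasDerivAt (deriv (u ∘ γ))
      (fderiv ℝ (fderiv ℝ (inChart u x)) (chartCurve x γ t) (deriv (chartCurve x γ) t)
          (deriv (chartCurve x γ) t) +
        fderiv ℝ (inChart u x) (chartCurve x γ t) (deriv (deriv (chartCurve x γ)) t)) t := by
  have hF := ((hu.contDiffAt_fderiv_inChart x (chartCurve_mem htx)).differentiableAt
    (by simp)).hasFDerivAt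
  refine ((hF.comp_hasDerivAt t (hγ.hasDerivAt_chartCurve hJ ht htx)).clm_apply
    (hγ.hasDerivAt_deriv_chartCurve hJ ht htx)).congr_of_eventuallyEq ?_
  filter_upwards [hγ.eventually_mem_source hJ ht htx] with s hs
  exact hγ.deriv_comp hJ hu hs.1 hs.2

theorem deriv_comp_mem {t : ℝ} (ht : t ∈ J) : deriv (u ∘ γ) t ∈ tangentPlane u (γ t) := by
  rw [hγ.deriv_comp hJ hu ht (mem_extChartAt_source (γ t)), hu.tangentPlane_eq (γ t)
    (mem_extChartAt_source (γ t))]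
  exact ⟨_, rfl⟩

theorem isUnitTangent {t : ℝ} (ht : t ∈ J) : IsUnitTangent u (γ t) (deriv (u ∘ γ) t) :=
  ⟨hγ.deriv_comp_mem hJ hu ht, hγ.unit t ht⟩

end IsUnitGeodesic

namespace IsSpacelikeImmersion

variable (hu : IsSpacelikeImmersion u)
include hu

theorem isSpacelikeFrame_chartFrame (x : S) {c : Plane2} (hc : c ∈ (extChartAt (𝓡 2) x).target) :
    IsSpacelikeFrame (chartPlane u x c) (chartFrame u x 0 c) (chartFrame u x 1 c) :=
  ⟨range_fderiv_eq_span x c, hu.chartFrame_spacelike x hc⟩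

theorem tangentPlane_eq_chartPlane (x : S) {y : S} (hy : y ∈ (extChartAt (𝓡 2) x).source) :
    tangentPlane u y = chartPlane u x (extChartAt (𝓡 2) x y) :=
  hu.tangentPlane_eq x hy

end IsSpacelikeImmersion

theorem HasDerivAt.form23 {f g : ℝ → R23} {f' g' : R23} {t : ℝ} (hf : HasDerivAt f f' t)
    (hg : HasDerivAt g g' t) : HasDerivAt (fun s => _root_.form23 (f s) (g s))
      (_root_.form23 f' (g t) + _root_.form23 (f t) g') t := by
  have hfi := hasDerivAt_pi.1 hf
  have hgi := hasDerivAt_pi.1 hg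
  have h := (((((hfi 0).mul (hgi 0)).add ((hfi 1).mul (hgi 1))).sub ((hfi 2).mul (hgi 2))).sub
    ((hfi 3).mul (hgi 3))).sub ((hfi 4).mul (hgi 4))
  have h2 : HasDerivAt (fun s => _root_.form23 (f s) (g s)) _ t :=
    h.congr_of_eventuallyEq (Filter.Eventually.of_forall fun s => form23_apply (f s) (g s))
  refine h2.congr_deriv ?_
  rw [form23_apply, form23_apply]
  ring

theorem HasDerivAt.wedgeQuadric {f g : ℝ → R23} {f' g' : R23} {t : ℝ} (hf : HasDerivAt f f' t)
    (hg : HasDerivAt g g' t) : HasDerivAt (fun s => _root_.wedgeQuadric (f s) (g s))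
      (_root_.wedgeQuadric f' (g t) + _root_.wedgeQuadric (f t) g') t := by
  obtain ⟨L, hL, hLv⟩ := HasFDerivAt.wedgeQuadric hf.hasFDerivAt hg.hasFDerivAt
  have := hL.hasDerivAt
  rw [hLv] at this
  simpa using this

namespace IsUnitGeodesic

variable {γ : ℝ → S} {J : Set ℝ} (hγ : IsUnitGeodesic u γ J) (hJ : IsOpen J)
  (hu : IsSpacelikeImmersion u)
include hγ hJ hu

/-- The quadrics associated with the velocities of a geodesic increase. -/
theorem exists_hasDerivAt_isPositive
    (hII : ∀ (x : S) (v : TangentSpace (𝓡 2) x), v ≠ 0 →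
      ∀ n, IsSecondFundamentalForm u x v v n →
        Real.sqrt (-form23 n n) < form23 (diffAt u x v) (diffAt u x v))
    {Q : ℝ → Quadric} (hQ : ∀ t ∈ J, IsVelocityQuadric u (γ t) (deriv (u ∘ γ) t) (Q t))
    {t : ℝ} (ht : t ∈ J) : ∃ Q' : Quadric, HasDerivAt Q Q' t ∧ Q'.IsPositive := by
  set x := γ t with hx
  have htx : γ t ∈ (extChartAt (𝓡 2) x).source := mem_extChartAt_source x
  set c := chartCurve x γ with hc
  have hct : c t ∈ (extChartAt (𝓡 2) x).target := chartCurve_mem htx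
  have hcd : DifferentiableAt ℝ c t := (hγ.hasDerivAt_chartCurve hJ ht htx).differentiableAt
  have hw : HasDerivAt (deriv (u ∘ γ)) _ t := hγ.hasDerivAt_deriv_comp hJ hu ht htx
  set w := deriv (u ∘ γ) with hwdef
  -- The formula for the quarter turn in the moving coordinate frame shows that V = Jw is
  -- differentiable.
  set V : ℝ → R23 := fun s => frameRotation (chartFrame u x 0 (c s)) (chartFrame u x 1 (c s)) (w s)
    with hV
  have hE : ∀ i, DifferentiableAt ℝ (fun s => chartFrame u x i (c s)) t := fun i =>
    ((hu.contDiffAt_chartFrame x i hct).differentiableAt (by simp)).comp t hcd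
  have hframe : ∀ s, s ∈ J ∧ γ s ∈ (extChartAt (𝓡 2) x).source →
      IsSpacelikeFrame (tangentPlane u (γ s)) (chartFrame u x 0 (c s)) (chartFrame u x 1 (c s)) := by
    intro s hs
    rw [hu.tangentPlane_eq_chartPlane x hs.2]
    exact hu.isSpacelikeFrame_chartFrame x (chartCurve_mem hs.2)
  have hVd : DifferentiableAt ℝ V t := by
    have h1 : ContDiffAt ℝ 1 (fun z : R23 × R23 × R23 => frameRotation z.1 z.2.1 z.2.2)
        (chartFrame u x 0 (c t), chartFrame u x 1 (c t), w t) :=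
      contDiffAt_fst.frameRotation (contDiffAt_fst.comp _ contDiffAt_snd)
        (contDiffAt_snd.comp _ contDiffAt_snd) (hframe t ⟨ht, htx⟩)
    exact (h1.differentiableAt (by simp)).comp t
      (f := fun s => (chartFrame u x 0 (c s), chartFrame u x 1 (c s), w s))
      ((hE 0).prodMk ((hE 1).prodMk hw.differentiableAt))
  have hev := hγ.eventually_mem_source hJ ht htx
  have hpair : ∀ s, s ∈ J ∧ γ s ∈ (extChartAt (𝓡 2) x).source →
      IsSpacelikePair (w s) (V s) ∧ 0 < orient (w s) (V s) := fun s hs =>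
    (hframe s hs).isSpacelikePair_frameRotation (hγ.deriv_comp_mem hJ hu hs.1) (hγ.unit s hs.1)
  have hVmem : ∀ s, s ∈ J ∧ γ s ∈ (extChartAt (𝓡 2) x).source → V s ∈ tangentPlane u (γ s) :=
    fun s hs => (hframe s hs).frameRotation_mem _
  -- In the coordinates μ, the derivative V' splits into the second derivative of u, called Z below,
  -- and a tangential term R.
  set μ : ℝ → Plane2 := fun s => chartCoord u x (c s) (V s) with hμ
  have hμd : DifferentiableAt ℝ μ t := hu.differentiableAt_chartCoord x hct hcd hVd
  have hVμ : ∀ s, s ∈ J ∧ γ s ∈ (extChartAt (𝓡 2) x).source →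
      V s = fderiv ℝ (inChart u x) (c s) (μ s) := by
    intro s hs
    refine (hu.fderiv_chartCoord x (chartCurve_mem hs.2) ?_).symm
    rw [chartCurve, ← hu.tangentPlane_eq_chartPlane x hs.2]
    exact hVmem s hs
  have hF' := ((hu.contDiffAt_fderiv_inChart x hct).differentiableAt (by simp)).hasFDerivAt
  have hVd' : HasDerivAt V (fderiv ℝ (fderiv ℝ (inChart u x)) (c t) (deriv c t) (μ t) +
      fderiv ℝ (inChart u x) (c t) (deriv μ t)) t := by
    refine ((hF'.comp_hasDerivAt t hcd.hasDerivAt).clm_apply hμd.hasDerivAt).congr_of_eventuallyEq ?_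
    filter_upwards [hev] with s hs using hVμ s hs
  have huγ := hγ.hasDerivAt_comp hJ hu ht htx
  rw [← hγ.deriv_comp hJ hu ht htx] at huγ
  have hQd := huγ.wedgeQuadric hVd'
  have hQeq : Q =ᶠ[𝓝 t] fun s => wedgeQuadric ((u ∘ γ) s) (V s) := by
    filter_upwards [hev] with s hs
    exact (hu.isVelocityQuadric_iff_eq (hγ.isUnitTangent hJ hu hs.1) (hframe s hs)).1 (hQ s hs.1)
  refine ⟨_, hQd.congr_of_eventuallyEq hQeq, ?_⟩
  have hT := hu.isTangentPlane x
  have hwT : w t ∈ tangentPlane u x := hγ.deriv_comp_mem hJ hu ht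
  have hVT : V t ∈ tangentPlane u x := hVmem t ⟨ht, htx⟩
  obtain ⟨hp, ho⟩ := hpair t ⟨ht, htx⟩
  have e1 : w t = diffAt u x (deriv c t) :=
    (hγ.deriv_comp hJ hu ht htx).trans (hu.diffAt_eq x (deriv c t)).symm
  have e2 : V t = diffAt u x (μ t) := (hVμ t ⟨ht, htx⟩).trans (hu.diffAt_eq x (μ t)).symm
  have e3 : fderiv ℝ (fderiv ℝ (inChart u x)) (c t) (deriv c t) (μ t) =
      secondDerivAt u x (deriv c t) (μ t) := rfl
  rw [e3] at hVd' ⊢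
  set Z := secondDerivAt u x (deriv c t) (μ t) with hZ
  set R := fderiv ℝ (inChart u x) (c t) (deriv μ t) with hR
  have hRT : R ∈ tangentPlane u x := by
    rw [hu.tangentPlane_eq_chartPlane x htx]
    exact fderiv_mem_chartPlane x _ _
  -- Differentiating ⟨V,V⟩ = 1 and ⟨w,V⟩ = 0, and using the geodesic equation ⟨w',V⟩ = 0, shows that
  -- V' has no tangential component.
  have hVV : form23 (V t) (Z + R) = 0 := by
    have h1 := (hVd'.form23 hVd').congr_of_eventuallyEq (f₁ := fun _ => (1 : ℝ)) (by
      filter_upwards [hev] with s hs using (hpair s hs).1.right.symm)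
    have h2 := (hasDerivAt_const t (1 : ℝ)).unique h1
    rw [form23_comm (Z + R)] at h2
    linarith
  have hwV : form23 (w t) (Z + R) = 0 := by
    have h1 := (hw.form23 hVd').congr_of_eventuallyEq (f₁ := fun _ => (0 : ℝ)) (by
      filter_upwards [hev] with s hs using (hpair s hs).1.orthogonal.symm)
    have h2 := (hasDerivAt_const t (0 : ℝ)).unique h1
    have h3 := hγ.geodesic t ht (μ t)
    rw [← hwdef, hw.deriv, ← hx, ← e2] at h3
    linarith
  -- The normal part of Z is therefore V' up to a multiple of u, which disappears in the wedge with
  -- u.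
  have hn : normalPart (u x) (w t) (V t) Z = Z + R + form23 (u x) (Z + R) • u x := by
    have hr := hT.mem_eq_of_pair hwT hVT hp hRT
    have h4 := hT.orthogonal R hRT
    rw [map_add] at hVV hwV
    rw [normalPart_apply, map_add, h4, add_zero, eq_neg_of_add_eq_zero_left hVV,
      eq_neg_of_add_eq_zero_left hwV]
    conv_rhs => rw [hr]
    rw [form23_comm R, form23_comm R]
    module
  have hfin := hu.exists_isPositive hII x (e1 ▸ e2 ▸ hp) (e1 ▸ e2 ▸ ho)
  rw [← e1, ← e2, ← hZ, hn, map_add, map_smul, wedgeQuadric_self, smul_zero, add_zero] at hfin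
  exact hfin

/-- For each nonzero v, the value at v of the quadric has positive derivative along the geodesic, so
it is strictly increasing on the interval J. -/
theorem velocityQuadric_sub_isPositive
    (hII : ∀ (x : S) (v : TangentSpace (𝓡 2) x), v ≠ 0 →
      ∀ n, IsSecondFundamentalForm u x v v n →
        Real.sqrt (-form23 n n) < form23 (diffAt u x v) (diffAt u x v))
    (hJc : J.OrdConnected) {s t : ℝ} (hs : s ∈ J) (ht : t ∈ J) (hst : s < t) {q q' : Quadric}
    (hq : IsVelocityQuadric u (γ s) (deriv (u ∘ γ) s) q)
    (hq' : IsVelocityQuadric u (γ t) (deriv (u ∘ γ) t) q') : (q' - q).IsPositive := by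
  have hex : ∀ r, ∃ q, r ∈ J → IsVelocityQuadric u (γ r) (deriv (u ∘ γ) r) q := fun r => by
    by_cases hr : r ∈ J
    · obtain ⟨q, hq, -⟩ := hu.existsUnique_isVelocityQuadric (hγ.isUnitTangent hJ hu hr)
      exact ⟨q, fun _ => hq⟩
    · exact ⟨0, fun h => absurd h hr⟩
  choose Q hQ using hex
  have hQs : Q s = q := (hu.existsUnique_isVelocityQuadric (hγ.isUnitTangent hJ hu hs)).unique (hQ s hs) hq
  have hQt : Q t = q' := (hu.existsUnique_isVelocityQuadric (hγ.isUnitTangent hJ hu ht)).unique (hQ t ht) hq'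
  intro v hv
  have hev : ∀ r ∈ J, ∃ d, 0 < d ∧ HasDerivAt (fun r => (Q r).eval v v) d r := fun r hr => by
    obtain ⟨Q', hQ', hpos⟩ := hγ.exists_hasDerivAt_isPositive hJ hu hII hQ hr
    let e : Quadric →L[ℝ] ℝ := LinearMap.toContinuousLinearMap
      { toFun := fun q => q.eval v v
        map_add' := fun a b => Quadric.eval_add a b v v
        map_smul' := fun c a => Quadric.eval_smul c a v v }
    exact ⟨_, hpos v hv, e.hasFDerivAt.comp_hasDerivAt r hQ'⟩
  have hmono : StrictMonoOn (fun r => (Q r).eval v v) J := by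
    refine strictMonoOn_of_deriv_pos hJc.convex (fun r hr => ?_) (fun r hr => ?_)
    · obtain ⟨d, -, hd⟩ := hev r hr
      exact hd.continuousAt.continuousWithinAt
    · obtain ⟨d, hd0, hd⟩ := hev r (interior_subset hr)
      rwa [hd.deriv]
  have := hmono hs ht hst
  simp only [hQs, hQt] at this
  rw [Quadric.eval_sub]
  linarith

end IsUnitGeodesic

end Surface

/-! ### The geodesic equation in a chart -/

/-- The local flow of a continuously differentiable vector field. -/
theorem ContDiffAt.exists_localFlow {E : Type*} [NormedAddCommGroup E] [NormedSpace ℝ E]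
    [CompleteSpace E] {G : E → E} {z₀ : E} (hG : ContDiffAt ℝ 1 G z₀) {W : Set E} (hW : W ∈ 𝓝 z₀) :
    ∃ δ > 0, ∃ N s : Set E, ∃ K, ∃ α : E × ℝ → E, IsOpen N ∧ z₀ ∈ N ∧ IsOpen s ∧ s ⊆ W ∧
      LipschitzOnWith K G s ∧ ContinuousOn α (N ×ˢ Ioo (-δ) δ) ∧ ∀ z ∈ N, α (z, 0) = z ∧
        ∀ t ∈ Ioo (-δ) δ, HasDerivAt (fun t => α (z, t)) (G (α (z, t))) t ∧ α (z, t) ∈ s := by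
  obtain ⟨K, s₁, hs₁, hl⟩ := hG.exists_lipschitzOnWith
  obtain ⟨s, hs, hso, hz₀⟩ := mem_nhds_iff.1 (Filter.inter_mem hs₁ hW)
  obtain ⟨ε, hε, a, r, L, K', hr, hpl⟩ := IsPicardLindelof.of_contDiffAt_one hG
  obtain ⟨α, hα, hcont⟩ :=
    (hpl 0).exists_forall_mem_closedBall_eq_hasDerivWithinAt_continuousOn
  simp only [zero_sub, zero_add] at hα hcont
  have h0 : α (z₀, 0) = z₀ := (hα z₀ (Metric.mem_closedBall_self r.2)).1
  have hnhds : Metric.closedBall z₀ r ×ˢ Icc (-ε) ε ∈ 𝓝 (z₀, (0 : ℝ)) :=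
    prod_mem_nhds (Metric.closedBall_mem_nhds z₀ hr) (Icc_mem_nhds (by linarith) hε)
  -- Short trajectories from nearby points stay in the set where the field is Lipschitz, as required
  -- for uniqueness later.
  have hpre : ∀ᶠ p in 𝓝 (z₀, (0 : ℝ)), α p ∈ s :=
    (hcont.continuousAt hnhds).eventually (hso.mem_nhds (h0.symm ▸ hz₀))
  obtain ⟨N₁, hN₁, T, hT, hNT⟩ := mem_nhds_prod_iff.1 hpre
  obtain ⟨δ₁, hδ₁, hδT⟩ := Metric.mem_nhds_iff.1 hT
  rw [Real.ball_eq_Ioo, zero_sub, zero_add] at hδT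
  obtain ⟨N, hN, hNo, hzN⟩ := mem_nhds_iff.1
    (Filter.inter_mem hN₁ (Metric.closedBall_mem_nhds z₀ hr))
  refine ⟨min ε δ₁, lt_min hε hδ₁, N, s, K, α, hNo, hzN, hso, hs.trans inter_subset_right,
    hl.mono (hs.trans inter_subset_left), hcont.mono (prod_mono (hN.trans inter_subset_right) ?_),
    fun z hz => ⟨(hα z (hN hz).2).1, fun t ht => ⟨?_, ?_⟩⟩⟩
  · intro t ht
    exact ⟨by linarith [ht.1, min_le_left ε δ₁], by linarith [ht.2, min_le_left ε δ₁]⟩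
  · have ht' : -ε < t ∧ t < ε :=
      ⟨by linarith [ht.1, min_le_left ε δ₁], by linarith [ht.2, min_le_left ε δ₁]⟩
    exact ((hα z (hN hz).2).2 t ⟨ht'.1.le, ht'.2.le⟩).hasDerivAt (Icc_mem_nhds ht'.1 ht'.2)
  · exact hNT (mk_mem_prod (hN hz).1 (hδT
      ⟨by linarith [ht.1, min_le_right ε δ₁], by linarith [ht.2, min_le_right ε δ₁]⟩))

section Surface

variable {S : Type*} [TopologicalSpace S] [ChartedSpace Plane2 S] {u : S → R23}

theorem frameCoeff_add (a b z z' : R23) :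
    frameCoeff a b (z + z') = frameCoeff a b z + frameCoeff a b z' := by
  simp only [frameCoeff, map_add, LinearMap.add_apply]
  ring

theorem chartCoord_add (x : S) (c : Plane2) (z z' : R23) :
    chartCoord u x c (z + z') = chartCoord u x c z + chartCoord u x c z' := by
  simp only [chartCoord, frameCoeff_add, add_smul]
  abel

/-- For arbitrary vectors, `chartCoord` gives the coordinates of the orthogonal projection to the
tangent plane, so it kills normal vectors. -/
theorem chartCoord_eq_zero {x : S} {c : Plane2} {z : R23}
    (h : ∀ y ∈ chartPlane u x c, form23 z y = 0) : chartCoord u x c z = 0 := by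
  have hE : ∀ i, form23 z (chartFrame u x i c) = 0 := fun i => h _ (fderiv_mem_chartPlane x c _)
  simp [chartCoord, frameCoeff, hE]

/-- The geodesic vector field in the chart at `x`. -/
def geodesicField (u : S → R23) (x : S) (z : Plane2 × Plane2) : Plane2 × Plane2 :=
  (z.2, -chartCoord u x z.1 (fderiv ℝ (fderiv ℝ (inChart u x)) z.1 z.2 z.2))

theorem IsUnitGeodesic.comp_add {γ : ℝ → S} (hγ : IsUnitGeodesic u γ univ) (a : ℝ) :
    IsUnitGeodesic u (fun t => γ (t + a)) univ := by
  have h1 : deriv (u ∘ fun t => γ (t + a)) = fun t => deriv (u ∘ γ) (t + a) :=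
    funext fun t => deriv_comp_add_const (u ∘ γ) a t
  refine ⟨?_, fun t _ => ?_, fun t _ v => ?_⟩
  · have h2 : ContMDiff 𝓘(ℝ, ℝ) 𝓘(ℝ, ℝ) 2 fun t : ℝ => t + a :=
      (contDiff_id.add contDiff_const).contMDiff
    exact ((contMDiffOn_univ.1 hγ.smooth).comp h2).contMDiffOn
  · rw [h1]
    exact hγ.unit _ (mem_univ _)
  · rw [h1, deriv_comp_add_const (deriv (u ∘ γ)) a t]
    exact hγ.geodesic _ (mem_univ _) v

variable [IsManifold (𝓡 2) ∞ S]

namespace IsSpacelikeImmersion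

variable (hu : IsSpacelikeImmersion u)
include hu

theorem contDiffAt_chartCoord (x : S) {E : Type*} [NormedAddCommGroup E] [NormedSpace ℝ E]
    {c : E → Plane2} {z : E → R23} {e : E} {n : ℕ∞} (hc : c e ∈ (extChartAt (𝓡 2) x).target)
    (hcd : ContDiffAt ℝ n c e) (hz : ContDiffAt ℝ n z e) :
    ContDiffAt ℝ n (fun y => chartCoord u x (c y) (z y)) e := by
  have hE : ∀ i, ContDiffAt ℝ n (fun y => chartFrame u x i (c y)) e := fun i =>
    ((hu.contDiffAt_chartFrame x i hc).of_le (by exact_mod_cast le_top)).comp e hcd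
  have hg := (hu.gramDet_chartFrame_pos x hc).ne'
  exact (((hE 0).frameCoeff (hE 1) hz hg).smul contDiffAt_const).add
    (((hE 1).frameCoeff (hE 0) hz (gramDet_comm (chartFrame u x 0 (c e)) _ ▸ hg)).smul
      contDiffAt_const)

theorem contDiffAt_geodesicField (x : S) {z : Plane2 × Plane2}
    (hz : z.1 ∈ (extChartAt (𝓡 2) x).target) : ContDiffAt ℝ 1 (geodesicField u x) z := by
  have h2 : ContDiffAt ℝ 1 (fderiv ℝ (fderiv ℝ (inChart u x))) z.1 :=
    ((hu.contDiffAt_fderiv_inChart x hz).fderiv_right (m := ∞) (by simp)).of_le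
      (by exact_mod_cast le_top)
  exact contDiffAt_snd.prodMk (hu.contDiffAt_chartCoord (n := 1) x hz contDiffAt_fst
    (((h2.comp z contDiffAt_fst).clm_apply contDiffAt_snd).clm_apply contDiffAt_snd)).neg

theorem chartCoord_fderiv (x : S) {c : Plane2} (hc : c ∈ (extChartAt (𝓡 2) x).target) (ν : Plane2) :
    chartCoord u x c (fderiv ℝ (inChart u x) c ν) = ν :=
  hu.fderiv_inChart_injective x hc (hu.fderiv_chartCoord x hc (fderiv_mem_chartPlane x c ν))

end IsSpacelikeImmersion

namespace IsUnitGeodesic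

variable {γ : ℝ → S} {J : Set ℝ} (hγ : IsUnitGeodesic u γ J) (hJ : IsOpen J)
  (hu : IsSpacelikeImmersion u)
include hγ hJ hu

/-- The acceleration of u ∘ γ is d²F(c', c') + dF(c''), with F and c denoting u and γ in the chart.
Its tangential coordinates vanish, which determines c''. -/
theorem hasDerivAt_geodesicField {x : S} {t : ℝ} (ht : t ∈ J)
    (htx : γ t ∈ (extChartAt (𝓡 2) x).source) :
    HasDerivAt (fun s => (chartCurve x γ s, deriv (chartCurve x γ) s))
      (geodesicField u x (chartCurve x γ t, deriv (chartCurve x γ) t)) t := by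
  have hd := hγ.hasDerivAt_deriv_chartCurve hJ ht htx
  have hc := chartCurve_mem htx
  have h0 := chartCoord_eq_zero (u := u) (x := x) (c := chartCurve x γ t)
    (z := deriv (deriv (u ∘ γ)) t) (by
      intro y hy
      rw [chartCurve, ← hu.tangentPlane_eq_chartPlane x htx] at hy
      obtain ⟨v, rfl⟩ := hy
      exact hγ.geodesic t ht v)
  rw [(hγ.hasDerivAt_deriv_comp hJ hu ht htx).deriv, chartCoord_add, hu.chartCoord_fderiv x hc] at h0
  rw [geodesicField, neg_eq_of_add_eq_zero_right h0]
  exact (hγ.hasDerivAt_chartCurve hJ ht htx).prodMk hd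

end IsUnitGeodesic

/-- Local description of the geodesic flow, in the chart at `x`, as the flow of the geodesic
vector field. -/
theorem IsSpacelikeImmersion.exists_localGeodesicFlow [T2Space S] (hu : IsSpacelikeImmersion u)
    (x : S) (ν₀ : Plane2) :
    ∃ δ > 0, ∃ N : Set (Plane2 × Plane2), ∃ α : (Plane2 × Plane2) × ℝ → Plane2 × Plane2,
      IsOpen N ∧ (extChartAt (𝓡 2) x x, ν₀) ∈ N ∧ ContinuousOn α (N ×ˢ Ioo (-δ) δ) ∧
        ∀ z ∈ N, (∀ t ∈ Ioo (-δ) δ, (α (z, t)).1 ∈ (extChartAt (𝓡 2) x).target) ∧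
          ∀ γ : ℝ → S, IsUnitGeodesic u γ univ → γ 0 = (extChartAt (𝓡 2) x).symm z.1 →
            deriv (u ∘ γ) 0 = fderiv ℝ (inChart u x) z.1 z.2 → ∀ t ∈ Ioo (-δ) δ,
              γ t = (extChartAt (𝓡 2) x).symm (α (z, t)).1 ∧
                deriv (u ∘ γ) t = fderiv ℝ (inChart u x) (α (z, t)).1 (α (z, t)).2 := by
  have hx := mem_extChartAt_target (I := 𝓡 2) x
  obtain ⟨δ, hδ, N, s, K, α, hN, hzN, hs, hsW, hl, hcont, hα⟩ :=
    (hu.contDiffAt_geodesicField x (z := (extChartAt (𝓡 2) x x, ν₀)) hx).exists_localFlow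
      (prod_mem_nhds ((isOpen_extChartAt_target x).mem_nhds hx) Filter.univ_mem)
  refine ⟨δ, hδ, N, α, hN, hzN, hcont, fun z hz => ⟨fun t ht => (hsW ((hα z hz).2 t ht).2).1, ?_⟩⟩
  intro γ hγ h0 hd0
  have htarget : ∀ t ∈ Ioo (-δ) δ, (α (z, t)).1 ∈ (extChartAt (𝓡 2) x).target := fun t ht =>
    (hsW ((hα z hz).2 t ht).2).1
  -- The set of times of agreement contains 0 and is open and closed in the interval, so the
  -- geodesic also stays in the chart, which was not assumed.
  set A : Set ℝ := {t | t ∈ Ioo (-δ) δ ∧ γ t = (extChartAt (𝓡 2) x).symm (α (z, t)).1 ∧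
    deriv (u ∘ γ) t = fderiv ℝ (inChart u x) (α (z, t)).1 (α (z, t)).2} with hA
  have h0mem : (0 : ℝ) ∈ Ioo (-δ) δ := ⟨by linarith, hδ⟩
  have hγc : Continuous γ := continuousOn_univ.1 hγ.smooth.continuousOn
  have hopen : IsOpen A := by
    rw [isOpen_iff_mem_nhds]
    rintro t ⟨ht, hγt, hdt⟩
    have htx : γ t ∈ (extChartAt (𝓡 2) x).source := by
      rw [hγt]
      exact (extChartAt (𝓡 2) x).map_target (htarget t ht)
    have hev := hγ.eventually_mem_source isOpen_univ (mem_univ t) htx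
    have hc : chartCurve x γ t = (α (z, t)).1 := by
      rw [chartCurve, hγt, (extChartAt (𝓡 2) x).right_inv (htarget t ht)]
    have hν : deriv (chartCurve x γ) t = (α (z, t)).2 := by
      rw [hγ.deriv_comp isOpen_univ hu (mem_univ t) htx, hc] at hdt
      exact hu.fderiv_inChart_injective x (htarget t ht) hdt
    -- Openness comes from the uniqueness of integral curves of the locally Lipschitz geodesic
    -- field.
    have heq : (fun r => (chartCurve x γ r, deriv (chartCurve x γ) r)) =ᶠ[𝓝 t] fun r => α (z, r) := by
      have hval : (chartCurve x γ t, deriv (chartCurve x γ) t) = α (z, t) := Prod.ext hc hν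
      refine ODE_solution_unique_of_eventually (v := fun _ => geodesicField u x) (s := fun _ => s)
        (K := K) (Filter.Eventually.of_forall fun _ => hl) ?_ ?_ hval
      · have hcd := (hγ.hasDerivAt_geodesicField isOpen_univ hu (mem_univ t) htx).continuousAt
        have hmem : (chartCurve x γ t, deriv (chartCurve x γ) t) ∈ s := by
          rw [hval]
          exact ((hα z hz).2 t ht).2
        filter_upwards [hev, hcd.eventually (hs.mem_nhds hmem)] with r hr hrs
        exact ⟨hγ.hasDerivAt_geodesicField isOpen_univ hu hr.1 hr.2, hrs⟩
      · filter_upwards [isOpen_Ioo.mem_nhds ht] with r hr using (hα z hz).2 r hr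
    filter_upwards [heq, hev, isOpen_Ioo.mem_nhds ht] with r hr hrx hrI
    refine ⟨hrI, ?_, ?_⟩
    · rw [← hr]
      exact ((extChartAt (𝓡 2) x).left_inv hrx.2).symm
    · rw [← hr]
      exact hγ.deriv_comp isOpen_univ hu hrx.1 hrx.2
  -- Closedness comes from continuity and from the Hausdorff property of S.
  have hclosed : closure A ∩ Ioo (-δ) δ ⊆ A := by
    rintro t ⟨htA, ht⟩
    have : (𝓝[A] t).NeBot := mem_closure_iff_nhdsWithin_neBot.1 htA
    have hαt : ContinuousAt (fun r => α (z, r)) t := ((hα z hz).2 t ht).1.continuousAt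
    have hd : ContinuousAt (deriv (u ∘ γ)) t :=
      (hγ.hasDerivAt_deriv_comp isOpen_univ hu (mem_univ t) (mem_extChartAt_source (γ t))).continuousAt
    have h1 : ContinuousAt (fun r => (extChartAt (𝓡 2) x).symm (α (z, r)).1) t :=
      ContinuousAt.comp (g := (extChartAt (𝓡 2) x).symm)
        ((continuousOn_extChartAt_symm x).continuousAt
          ((isOpen_extChartAt_target x).mem_nhds (htarget t ht))) hαt.fst
    have h2 : ContinuousAt (fun r => fderiv ℝ (inChart u x) (α (z, r)).1 (α (z, r)).2) t :=
      (ContinuousAt.comp (g := fderiv ℝ (inChart u x)) (f := fun r => (α (z, r)).1)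
        (hu.contDiffAt_fderiv_inChart x (htarget t ht)).continuousAt
        hαt.fst).clm_apply hαt.snd
    have hγt : Filter.Tendsto γ (𝓝[A] t) (𝓝 (γ t)) :=
      hγc.continuousAt.mono_left nhdsWithin_le_nhds
    have hdt : Filter.Tendsto (deriv (u ∘ γ)) (𝓝[A] t) (𝓝 (deriv (u ∘ γ) t)) :=
      hd.mono_left nhdsWithin_le_nhds
    refine ⟨ht, tendsto_nhds_unique hγt ((h1.mono_left nhdsWithin_le_nhds).congr' ?_),
      tendsto_nhds_unique hdt ((h2.mono_left nhdsWithin_le_nhds).congr' ?_)⟩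
    · filter_upwards [self_mem_nhdsWithin] with r hr using hr.2.1.symm
    · filter_upwards [self_mem_nhdsWithin] with r hr using hr.2.2.symm
  have hsub := isPreconnected_Ioo.subset_of_closure_inter_subset hopen
    ⟨0, h0mem, h0mem, by rw [(hα z hz).1, h0], by rw [(hα z hz).1, hd0]⟩ hclosed
  exact fun t ht => (hsub ht).2

/-- Complete geodesics are determined by their velocity at one time. -/
theorem IsUnitGeodesic.eq_of_deriv_eq [T2Space S] (hu : IsSpacelikeImmersion u) {γ γ' : ℝ → S}
    (hγ : IsUnitGeodesic u γ univ) (hγ' : IsUnitGeodesic u γ' univ) (h0 : γ 0 = γ' 0)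
    (hd0 : deriv (u ∘ γ) 0 = deriv (u ∘ γ') 0) : γ = γ' := by
  have hcont : ∀ {γ : ℝ → S}, IsUnitGeodesic u γ univ → Continuous γ ∧ Continuous (deriv (u ∘ γ)) :=
    fun hγ => ⟨continuousOn_univ.1 hγ.smooth.continuousOn, continuous_iff_continuousAt.2 fun t =>
      (hγ.hasDerivAt_deriv_comp isOpen_univ hu (mem_univ t) (mem_extChartAt_source _)).continuousAt⟩
  -- The set where the geodesics and their velocities agree is closed, and it is open by the local
  -- flow at the common point after a translation of time.
  set A : Set ℝ := {t | γ t = γ' t ∧ deriv (u ∘ γ) t = deriv (u ∘ γ') t} with hA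
  have hclosed : IsClosed A := (isClosed_eq (hcont hγ).1 (hcont hγ').1).inter
    (isClosed_eq (hcont hγ).2 (hcont hγ').2)
  have hopen : IsOpen A := by
    rw [isOpen_iff_mem_nhds]
    rintro t ⟨ht, hdt⟩
    set ν := deriv (chartCurve (γ t) γ) t with hν
    obtain ⟨δ, hδ, N, α, -, hzN, -, hα⟩ := hu.exists_localGeodesicFlow (γ t) ν
    have hsymm : (extChartAt (𝓡 2) (γ t)).symm (extChartAt (𝓡 2) (γ t) (γ t)) = γ t :=
      extChartAt_to_inv (γ t)
    have hshift : ∀ η : ℝ → S, deriv (u ∘ fun r => η (r + t)) = fun r => deriv (u ∘ η) (r + t) :=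
      fun η => funext fun r => deriv_comp_add_const (u ∘ η) t r
    have hdν : deriv (u ∘ γ) t = fderiv ℝ (inChart u (γ t)) (extChartAt (𝓡 2) (γ t) (γ t)) ν :=
      hγ.deriv_comp isOpen_univ hu (mem_univ t) (mem_extChartAt_source (γ t))
    have h1 := (hα _ hzN).2 _ (hγ.comp_add t) (by rw [zero_add, hsymm])
      (by rw [hshift]; simpa only [zero_add] using hdν)
    have h2 := (hα _ hzN).2 _ (hγ'.comp_add t) (by rw [zero_add, hsymm, ht])
      (by rw [hshift]; simpa only [zero_add, ← hdt] using hdν)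
    rw [hshift] at h1 h2
    filter_upwards [Ioo_mem_nhds (show t - δ < t by linarith) (show t < t + δ by linarith)] with r hr
    have hr' : r - t ∈ Ioo (-δ) δ := ⟨by linarith [hr.1], by linarith [hr.2]⟩
    have h3 := h1 _ hr'
    have h4 := h2 _ hr'
    simp only [sub_add_cancel] at h3 h4
    exact ⟨h3.1.trans h4.1.symm, h3.2.trans h4.2.symm⟩
  have huniv : A = univ := IsClopen.eq_univ ⟨hclosed, hopen⟩ ⟨0, h0, hd0⟩
  funext t
  exact (huniv.symm ▸ mem_univ t : t ∈ A).1

end Surface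

/-! ### Flows -/

/-- A one-parameter group of transformations is continuous if it is continuous for small times. -/
theorem continuous_of_eventually_continuousAt {X : Type*} [TopologicalSpace X] {Φ : ℝ × X → X}
    (h0 : ∀ e, Φ (0, e) = e) (hadd : ∀ s t e, Φ (s + t, e) = Φ (s, Φ (t, e)))
    (hloc : ∀ e, ∀ᶠ p in 𝓝 ((0 : ℝ), e), ContinuousAt Φ p) : Continuous Φ := by
  have hsub : ∀ s t e, Φ (s, e) = Φ (s - t, Φ (t, e)) := fun s t e => by
    rw [← hadd, sub_add_cancel]
  have horbit : ∀ e, Continuous fun t => Φ (t, e) := fun e => continuous_iff_continuousAt.2 fun t => by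
    rw [show (fun s => Φ (s, e)) = fun s => Φ (s - t, Φ (t, e)) from funext fun s => hsub s t e]
    have h1 := (hloc (Φ (t, e))).self_of_nhds
    have h2 : ContinuousAt (fun s : ℝ => (s - t, Φ (t, e))) t := by fun_prop
    refine ContinuousAt.comp_of_eq (g := Φ) h1 h2 ?_
    rw [sub_self]
  have hstep : ∀ {s t e}, ContinuousAt Φ (s - t, Φ (t, e)) →
      ContinuousAt (fun e' => Φ (t, e')) e → ContinuousAt (fun e' => Φ (s, e')) e := by
    intro s t e h1 h2
    rw [show (fun e' => Φ (s, e')) = fun e' => Φ (s - t, Φ (t, e')) from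
      funext fun e' => hsub s t e']
    exact ContinuousAt.comp (g := Φ) (f := fun e' => (s - t, Φ (t, e'))) h1
      (continuousAt_const.prodMk h2)
  have htime : ∀ t e, ContinuousAt (fun e' => Φ (t, e')) e := by
    intro t e
    -- For fixed e, continuity of Φ_t at e propagates both ways between nearby times, since Φ_s is a
    -- small-time map composed with Φ_t. It holds at t = 0, hence always.
    have hconst : IsLocallyConstant fun t => ContinuousAt (fun e' => Φ (t, e')) e := by
      rw [IsLocallyConstant.iff_eventually_eq]
      intro t
      have h1 : ∀ᶠ s in 𝓝 t, ContinuousAt Φ (s - t, Φ (t, e)) := by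
        have : ContinuousAt (fun s : ℝ => (s - t, Φ (t, e))) t := by fun_prop
        refine this.eventually ?_
        simp only [sub_self]
        exact hloc _
      have h2 : ∀ᶠ s in 𝓝 t, ContinuousAt Φ (t - s, Φ (s, e)) := by
        have : ContinuousAt (fun s : ℝ => (t - s, Φ (s, e))) t :=
          (continuousAt_const.sub continuousAt_id).prodMk (horbit e).continuousAt
        refine this.eventually ?_
        simp only [sub_self]
        exact hloc _
      filter_upwards [h1, h2] with s hs1 hs2
      exact propext ⟨hstep hs2, hstep hs1⟩
    rw [hconst.apply_eq_of_isPreconnected isPreconnected_univ (mem_univ t) (mem_univ 0)]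
    simp only [h0]
    exact continuousAt_id
  refine continuous_iff_continuousAt.2 fun ⟨t, e⟩ => ?_
  rw [show Φ = fun p : ℝ × X => Φ (p.1 - t, Φ (t, p.2)) from funext fun p => hsub p.1 t p.2]
  have h1 := (hloc (Φ (t, e))).self_of_nhds
  have h2 : ContinuousAt (fun p : ℝ × X => (p.1 - t, Φ (t, p.2))) (t, e) :=
    ((continuousAt_fst.sub continuousAt_const)).prodMk
      (ContinuousAt.comp (g := fun e' => Φ (t, e')) (f := Prod.snd) (x := (t, e)) (htime t e)
        continuousAt_snd)
  refine ContinuousAt.comp_of_eq (g := Φ) h1 h2 ?_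
  rw [sub_self]

/-! ### The sphere bundle -/

section SphereBundle

variable {M : Type*} [TopologicalSpace M] (f : M → Submodule ℝ Quadric)

/-- The saturation of an open set is the union of its preimages under positive scalings, which are
continuous. Openness is what allows products with ℝ and local continuity to descend to the quotient.
-/
theorem isOpenQuotientMap_sphereBundle :
    IsOpenQuotientMap (Quotient.mk (sphereSetoid f)) := by
  refine ⟨Quotient.mk_surjective, continuous_quotient_mk', fun U hU => ?_⟩
  let σ : {c : ℝ // 0 < c} → NonzeroBundle f → NonzeroBundle f := fun c p =>
    ⟨(p.1.1, c.1 • p.1.2), (f p.1.1).smul_mem _ p.2.1, smul_ne_zero c.2.ne' p.2.2⟩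
  have hσ : ∀ c, Continuous (σ c) := fun c =>
    Continuous.subtype_mk ((continuous_fst.comp continuous_subtype_val).prodMk
      ((continuous_snd.comp continuous_subtype_val).const_smul c.1)) _
  have hpre : Quotient.mk (sphereSetoid f) ⁻¹' (Quotient.mk (sphereSetoid f) '' U) =
      ⋃ c, σ c ⁻¹' U := by
    ext p
    simp only [mem_preimage, mem_image, mem_iUnion]
    constructor
    · rintro ⟨p', hp', he⟩
      have hr : p.1.1 = p'.1.1 ∧ ∃ c : ℝ, 0 < c ∧ p'.1.2 = c • p.1.2 := Quotient.exact he.symm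
      obtain ⟨h1, c, hc, h2⟩ := hr
      refine ⟨⟨c, hc⟩, ?_⟩
      have : σ ⟨c, hc⟩ p = p' := Subtype.ext (Prod.ext h1 h2.symm)
      rwa [this]
    · rintro ⟨c, hc⟩
      have hr : p.1.1 = (σ c p).1.1 ∧ ∃ d : ℝ, 0 < d ∧ (σ c p).1.2 = d • p.1.2 :=
        ⟨rfl, c.1, c.2, rfl⟩
      exact ⟨_, hc, (Quotient.sound hr : Quotient.mk (sphereSetoid f) p = _).symm⟩
  rw [← isQuotientMap_quotient_mk'.isOpen_preimage]
  exact hpre ▸ isOpen_iUnion fun c => hU.preimage (hσ c)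

end SphereBundle

/-! ### The geodesic flow on the sphere bundle of the Gauss map -/

theorem ContinuousAt.form23 {X : Type*} [TopologicalSpace X] {a b : X → R23} {x : X}
    (ha : ContinuousAt a x) (hb : ContinuousAt b x) :
    ContinuousAt (fun y => _root_.form23 (a y) (b y)) x :=
  ContinuousAt.comp (g := fun z : R23 × R23 => _root_.form23 z.1 z.2) (f := fun y => (a y, b y))
    (contDiffAt_fst.form23 (n := 0) contDiffAt_snd).continuousAt (ha.prodMk hb)

theorem ContinuousAt.wedgeQuadric {X : Type*} [TopologicalSpace X] {a b : X → R23} {x : X}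
    (ha : ContinuousAt a x) (hb : ContinuousAt b x) :
    ContinuousAt (fun y => _root_.wedgeQuadric (a y) (b y)) x :=
  ContinuousAt.comp (g := fun z : R23 × R23 => _root_.wedgeQuadric z.1 z.2)
    (f := fun y => (a y, b y)) (ContDiff.wedgeQuadric_prod (n := 0)).continuous.continuousAt
    (ha.prodMk hb)

theorem ContinuousAt.contract {X : Type*} [TopologicalSpace X] {a : X → R23} {q : X → Quadric} {x : X}
    (ha : ContinuousAt a x) (hq : ContinuousAt q x) :
    ContinuousAt (fun y => _root_.contract (a y) (q y)) x :=
  ContinuousAt.comp (g := fun z : R23 × Quadric => _root_.contract z.1 z.2)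
    (f := fun y => (a y, q y)) (ContDiff.contract_prod (n := 0)).continuous.continuousAt
    (ha.prodMk hq)

theorem ContinuousAt.frameRotation {X : Type*} [TopologicalSpace X] {a b w : X → R23} {x : X}
    (ha : ContinuousAt a x) (hb : ContinuousAt b x) (hw : ContinuousAt w x) {T : Submodule ℝ R23}
    (h : IsSpacelikeFrame T (a x) (b x)) :
    ContinuousAt (fun y => _root_.frameRotation (a y) (b y) (w y)) x :=
  ContinuousAt.comp (g := fun z : R23 × R23 × R23 => _root_.frameRotation z.1 z.2.1 z.2.2)
    (f := fun y => (a y, b y, w y))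
    (ContDiffAt.frameRotation (n := 0) (x := (a x, b x, w x)) contDiffAt_fst
      (contDiffAt_fst.comp _ contDiffAt_snd) (contDiffAt_snd.comp _ contDiffAt_snd) h).continuousAt
    (ha.prodMk (hb.prodMk hw))

section Surface

variable {S : Type*} [TopologicalSpace S] [ChartedSpace Plane2 S] {u : S → R23}

/-- `γ` is the complete geodesic corresponding to an element of the bundle of pencils. -/
structure IsOrbit (u : S → R23) (p : NonzeroBundle (gaussMap u)) (γ : ℝ → S) : Prop where
  geodesic : IsUnitGeodesic u γ univ
  point : γ 0 = p.1.1
  velocity : ∃ c : ℝ, 0 < c ∧ IsVelocityQuadric u p.1.1 (deriv (u ∘ γ) 0) (c • p.1.2)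

/-- A lift of the geodesic flow to the bundle of pencils. -/
def IsLiftedFlow (u : S → R23)
    (Ψ : ℝ × NonzeroBundle (gaussMap u) → NonzeroBundle (gaussMap u)) : Prop :=
  ∀ p, ∃ γ, IsOrbit u p γ ∧ ∀ t, (Ψ (t, p)).1.1 = γ t ∧
    IsVelocityQuadric u (γ t) (deriv (u ∘ γ) t) (Ψ (t, p)).1.2

theorem IsOrbit.of_equiv {p p' : NonzeroBundle (gaussMap u)} {γ : ℝ → S} (h : IsOrbit u p γ)
    (hp : p ≈ p') : IsOrbit u p' γ := by
  obtain ⟨⟨x, q⟩, hq⟩ := p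
  obtain ⟨⟨x', q'⟩, hq'⟩ := p'
  have hr : x = x' ∧ ∃ d : ℝ, 0 < d ∧ q' = d • q := hp
  obtain ⟨rfl, d, hd, rfl⟩ := hr
  obtain ⟨c, hc, hcq⟩ := h.velocity
  refine ⟨h.geodesic, h.point, c / d, div_pos hc hd, ?_⟩
  rwa [smul_smul, div_mul_cancel₀ c hd.ne']

variable [IsManifold (𝓡 2) ∞ S]

theorem IsVelocityQuadric.mem_gaussMap (hu : IsSpacelikeImmersion u) {x : S} {w : R23}
    (hw : IsUnitTangent u x w) {q : Quadric} (hq : IsVelocityQuadric u x w q) :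
    q ∈ gaussMap u x ∧ q ≠ 0 := by
  obtain ⟨V, hV, hwV, -, rfl⟩ := (hu.isVelocityQuadric_iff hw).1 hq
  have hT := hu.isTangentPlane x
  refine ⟨by rw [hu.gaussMap_eq]; exact ⟨V, hV, rfl⟩, fun h0 => ?_⟩
  have h1 := contract_wedgeQuadric hT.point (hT.orthogonal V hV)
  have h2 := hwV.right
  rw [← h1, h0] at h2
  simp at h2

theorem IsOrbit.isUnitTangent (hu : IsSpacelikeImmersion u) {p : NonzeroBundle (gaussMap u)}
    {γ : ℝ → S} (h : IsOrbit u p γ) : IsUnitTangent u p.1.1 (deriv (u ∘ γ) 0) :=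
  h.point ▸ h.geodesic.isUnitTangent isOpen_univ hu (mem_univ 0)

/-- The direction of a quadric determines the unit velocity, which determines the complete geodesic.
-/
theorem IsOrbit.eq [T2Space S] (hu : IsSpacelikeImmersion u) {p : NonzeroBundle (gaussMap u)}
    {γ γ' : ℝ → S} (h : IsOrbit u p γ) (h' : IsOrbit u p γ') : γ = γ' :=
  h.geodesic.eq_of_deriv_eq hu h'.geodesic (h.point.trans h'.point.symm)
    ((hu.existsUnique_velocity p.2.1 p.2.2).unique ⟨h.isUnitTangent hu, h.velocity⟩
      ⟨h'.isUnitTangent hu, h'.velocity⟩)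

theorem exists_isOrbit (hu : IsSpacelikeImmersion u) (hc : IsGeodesicallyComplete u)
    (p : NonzeroBundle (gaussMap u)) : ∃ γ, IsOrbit u p γ := by
  obtain ⟨w, ⟨hw, hv⟩, -⟩ := hu.existsUnique_velocity p.2.1 p.2.2
  obtain ⟨γ, hγ, h0, hd⟩ := hc p.1.1 w hw
  exact ⟨γ, hγ, h0, hd.symm ▸ hv⟩

theorem exists_isLiftedFlow (hu : IsSpacelikeImmersion u) (hc : IsGeodesicallyComplete u) :
    ∃ Ψ, IsLiftedFlow u Ψ := by
  choose γ hγ using exists_isOrbit hu hc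
  have hex : ∀ n : ℝ × NonzeroBundle (gaussMap u), ∃ q,
      IsVelocityQuadric u (γ n.2 n.1) (deriv (u ∘ γ n.2) n.1) q := fun n =>
    (hu.existsUnique_isVelocityQuadric ((hγ n.2).geodesic.isUnitTangent isOpen_univ hu
      (mem_univ n.1))).exists
  choose q hq using hex
  exact ⟨fun n => ⟨(γ n.2 n.1, q n), (hq n).mem_gaussMap hu
      ((hγ n.2).geodesic.isUnitTangent isOpen_univ hu (mem_univ n.1))⟩,
    fun p => ⟨γ p, hγ p, fun t => ⟨rfl, hq (t, p)⟩⟩⟩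

namespace IsLiftedFlow

variable {Ψ : ℝ × NonzeroBundle (gaussMap u) → NonzeroBundle (gaussMap u)}
  (hΨ : IsLiftedFlow u Ψ) (hu : IsSpacelikeImmersion u)
include hΨ hu

/-- Any geodesic starting in the direction of p computes the lifted flow; this reduces the flow
properties to statements about geodesics. -/
theorem eq_iff [T2Space S] {p p' : NonzeroBundle (gaussMap u)} {γ : ℝ → S} (h : IsOrbit u p γ)
    {t : ℝ} (h1 : p'.1.1 = γ t) (h2 : IsVelocityQuadric u (γ t) (deriv (u ∘ γ) t) p'.1.2) :
    Ψ (t, p) = p' := by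
  obtain ⟨γ', h', hΨ'⟩ := hΨ p
  obtain rfl := h.eq hu h'
  exact Subtype.ext (Prod.ext ((hΨ' t).1.trans h1.symm)
    ((hu.existsUnique_isVelocityQuadric (h.geodesic.isUnitTangent isOpen_univ hu
      (mem_univ t))).unique (hΨ' t).2 h2))

theorem eq_of_equiv [T2Space S] {p p' : NonzeroBundle (gaussMap u)} (hp : p ≈ p') (t : ℝ) :
    Ψ (t, p) = Ψ (t, p') := by
  obtain ⟨γ, h, hγ⟩ := hΨ p'
  exact hΨ.eq_iff hu (h.of_equiv (Setoid.symm hp)) (hγ t).1 (hγ t).2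

/-- The lift takes values in normalized quadrics, so at time 0 it is the identity only up to a
positive factor. -/
theorem zero_equiv (p : NonzeroBundle (gaussMap u)) : Ψ (0, p) ≈ p := by
  obtain ⟨γ, h, hγ⟩ := hΨ p
  obtain ⟨c, hc, hcq⟩ := h.velocity
  refine Setoid.symm ⟨h.point.symm.trans (hγ 0).1.symm, c, hc, ?_⟩
  exact (hu.existsUnique_isVelocityQuadric (h.isUnitTangent hu)).unique (h.point ▸ (hγ 0).2) hcq

theorem add [T2Space S] (s t : ℝ) (p : NonzeroBundle (gaussMap u)) :
    Ψ (s + t, p) = Ψ (s, Ψ (t, p)) := by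
  obtain ⟨γ, h, hγ⟩ := hΨ p
  have hd : ∀ r, deriv (u ∘ fun r => γ (r + t)) r = deriv (u ∘ γ) (r + t) := fun r =>
    deriv_comp_add_const (u ∘ γ) t r
  refine (hΨ.eq_iff hu (γ := fun r => γ (r + t)) ⟨h.geodesic.comp_add t, ?_, 1, one_pos, ?_⟩
    (hγ (s + t)).1 ?_).symm
  · rw [zero_add, (hγ t).1]
  · rw [hd, zero_add, one_smul, (hγ t).1]
    exact (hγ t).2
  · rw [hd]
    exact (hγ (s + t)).2

/-- Monotonicity along the geodesic compares the normalized quadrics. Dividing by the factor c that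
normalizes p gives the comparison for p itself. -/
theorem exists_sub_isPositive
    (hII : ∀ (x : S) (v : TangentSpace (𝓡 2) x), v ≠ 0 →
      ∀ n, IsSecondFundamentalForm u x v v n →
        Real.sqrt (-form23 n n) < form23 (diffAt u x v) (diffAt u x v))
    {t : ℝ} (ht : 0 < t) (p : NonzeroBundle (gaussMap u)) :
    ∃ p' : NonzeroBundle (gaussMap u), Ψ (t, p) ≈ p' ∧ (p'.1.2 - p.1.2).IsPositive := by
  obtain ⟨γ, h, hγ⟩ := hΨ p
  obtain ⟨c, hc, hcq⟩ := h.velocity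
  have hpos := h.geodesic.velocityQuadric_sub_isPositive isOpen_univ hu hII ordConnected_univ
    (mem_univ 0) (mem_univ t) ht (h.point.symm ▸ hcq) (hγ t).2
  refine ⟨⟨((Ψ (t, p)).1.1, c⁻¹ • (Ψ (t, p)).1.2), Submodule.smul_mem _ _ (Ψ (t, p)).2.1,
    smul_ne_zero (inv_pos.2 hc).ne' (Ψ (t, p)).2.2⟩, ⟨rfl, c⁻¹, inv_pos.2 hc, rfl⟩, fun v hv => ?_⟩
  have h1 := hpos v hv
  rw [Quadric.eval_sub, Quadric.eval_smul] at h1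
  rw [Quadric.eval_sub, Quadric.eval_smul]
  have h2 := mul_pos (inv_pos.2 hc) h1
  rwa [mul_sub, ← mul_assoc c⁻¹ c, inv_mul_cancel₀ hc.ne', one_mul] at h2

end IsLiftedFlow

/-- The velocity, read in the chart at `x`, of the geodesic corresponding to an element of the bundle
of pencils. -/
def chartVelocity (u : S → R23) (x : S) (p : NonzeroBundle (gaussMap u)) : R23 :=
  -frameRotation (chartFrame u x 0 (extChartAt (𝓡 2) x p.1.1))
    (chartFrame u x 1 (extChartAt (𝓡 2) x p.1.1))
    ((Real.sqrt (form23 (contract (u p.1.1) p.1.2) (contract (u p.1.1) p.1.2)))⁻¹ •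
      contract (u p.1.1) p.1.2)

namespace IsSpacelikeImmersion

variable (hu : IsSpacelikeImmersion u)
include hu

theorem continuousAt_chartFrame {X : Type*} [TopologicalSpace X] {c : X → Plane2} {e : X} (x : S)
    (hc : ContinuousAt c e) (hce : c e ∈ (extChartAt (𝓡 2) x).target) (i : Fin 2) :
    ContinuousAt (fun y => chartFrame u x i (c y)) e :=
  ContinuousAt.comp (g := chartFrame u x i) (hu.contDiffAt_chartFrame x i hce).continuousAt hc

theorem isSpacelikeFrame_tangentPlane (x : S) {y : S} (hy : y ∈ (extChartAt (𝓡 2) x).source) :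
    IsSpacelikeFrame (tangentPlane u y) (chartFrame u x 0 (extChartAt (𝓡 2) x y))
      (chartFrame u x 1 (extChartAt (𝓡 2) x y)) := by
  rw [hu.tangentPlane_eq_chartPlane x hy]
  exact hu.isSpacelikeFrame_chartFrame x ((extChartAt (𝓡 2) x).map_source hy)

theorem continuousAt_chartVelocity (x : S) {p : NonzeroBundle (gaussMap u)}
    (hp : p.1.1 ∈ (extChartAt (𝓡 2) x).source) :
    ContinuousAt (fun p : NonzeroBundle (gaussMap u) => extChartAt (𝓡 2) x p.1.1) p ∧
      ContinuousAt (chartVelocity u x) p := by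
  have h1 : ContinuousAt (fun p : NonzeroBundle (gaussMap u) => p.1.1) p :=
    (continuous_fst.comp continuous_subtype_val).continuousAt
  have h2 : ContinuousAt (fun p : NonzeroBundle (gaussMap u) => p.1.2) p :=
    (continuous_snd.comp continuous_subtype_val).continuousAt
  have hc : ContinuousAt (fun p : NonzeroBundle (gaussMap u) => extChartAt (𝓡 2) x p.1.1) p :=
    ContinuousAt.comp (g := extChartAt (𝓡 2) x) (continuousAt_extChartAt' hp) h1
  have hY : ContinuousAt (fun p : NonzeroBundle (gaussMap u) => contract (u p.1.1) p.1.2) p :=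
    (ContinuousAt.comp (g := u) hu.smooth.continuous.continuousAt h1).contract h2
  have hT := hu.isTangentPlane p.1.1
  have hpos : 0 < form23 (contract (u p.1.1) p.1.2) (contract (u p.1.1) p.1.2) :=
    hT.pos _ (hT.contract_mem (hu.gaussMap_eq p.1.1 ▸ p.2.1)) (hu.contract_ne_zero p.2.1 p.2.2)
  have hE := fun i => hu.continuousAt_chartFrame x hc ((extChartAt (𝓡 2) x).map_source hp) i
  exact ⟨hc, ((hE 0).frameRotation (hE 1) (((hY.form23 hY).sqrt.inv₀
    (Real.sqrt_pos.2 hpos).ne').smul hY) (hu.isSpacelikeFrame_tangentPlane x hp)).neg⟩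

theorem deriv_eq_chartVelocity (x : S) {p : NonzeroBundle (gaussMap u)}
    (hp : p.1.1 ∈ (extChartAt (𝓡 2) x).source) {γ : ℝ → S} (h : IsOrbit u p γ) :
    deriv (u ∘ γ) 0 = chartVelocity u x p := by
  obtain ⟨c, hc, hcq⟩ := h.velocity
  exact hu.velocity_eq (hu.isSpacelikeFrame_tangentPlane x hp) p.2.1 p.2.2 (h.isUnitTangent hu) hc hcq

end IsSpacelikeImmersion

/-- Near time 0 the lift is a composition of continuous maps: the initial velocity in chart
coordinates, the local flow of the geodesic field, and the quadric u ∧ Jw of the resulting velocity.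
-/
theorem IsLiftedFlow.eventually_continuousAt [T2Space S]
    {Ψ : ℝ × NonzeroBundle (gaussMap u) → NonzeroBundle (gaussMap u)} (hΨ : IsLiftedFlow u Ψ)
    (hu : IsSpacelikeImmersion u) (p₀ : NonzeroBundle (gaussMap u)) :
    ∀ᶠ n in 𝓝 ((0 : ℝ), p₀), ContinuousAt Ψ n := by
  set x := p₀.1.1 with hx
  let z : NonzeroBundle (gaussMap u) → Plane2 × Plane2 := fun p => (extChartAt (𝓡 2) x p.1.1,
    chartCoord u x (extChartAt (𝓡 2) x p.1.1) (chartVelocity u x p))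
  obtain ⟨δ, hδ, N, α, hN, hzN, hαc, hα⟩ := hu.exists_localGeodesicFlow x (z p₀).2
  set O : Set (NonzeroBundle (gaussMap u)) := {p | p.1.1 ∈ (extChartAt (𝓡 2) x).source} with hO
  have hOo : IsOpen O := (isOpen_extChartAt_source x).preimage
    (continuous_fst.comp continuous_subtype_val)
  have hzc : ∀ p ∈ O, ContinuousAt z p := fun p hp => by
    obtain ⟨h1, h2⟩ := hu.continuousAt_chartVelocity x hp
    refine h1.prodMk ?_
    exact ContinuousAt.comp (g := fun y : Plane2 × R23 => chartCoord u x y.1 y.2)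
      (f := fun p : NonzeroBundle (gaussMap u) =>
        (extChartAt (𝓡 2) x p.1.1, chartVelocity u x p))
      (hu.contDiffAt_chartCoord (n := 0) x
        (e := ((extChartAt (𝓡 2) x p.1.1, chartVelocity u x p) : Plane2 × R23))
        ((extChartAt (𝓡 2) x).map_source hp) contDiffAt_fst contDiffAt_snd).continuousAt
      (h1.prodMk h2)
  set U : Set (ℝ × NonzeroBundle (gaussMap u)) := Ioo (-δ) δ ×ˢ (O ∩ z ⁻¹' N) with hU
  have hUo : IsOpen U := isOpen_Ioo.prod
    ((continuousOn_of_forall_continuousAt hzc).isOpen_inter_preimage hOo hN)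
  have hp₀ : ((0 : ℝ), p₀) ∈ U := ⟨⟨by linarith, hδ⟩, mem_extChartAt_source x, hzN⟩
  -- The explicit local formula for the lift; as it takes values in S × 𝒬, continuity is later
  -- transferred to the subtype.
  let g : ℝ × NonzeroBundle (gaussMap u) → S × Quadric := fun n =>
    ((extChartAt (𝓡 2) x).symm (α (z n.2, n.1)).1,
      wedgeQuadric (inChart u x (α (z n.2, n.1)).1)
        (frameRotation (chartFrame u x 0 (α (z n.2, n.1)).1) (chartFrame u x 1 (α (z n.2, n.1)).1)
          (fderiv ℝ (inChart u x) (α (z n.2, n.1)).1 (α (z n.2, n.1)).2)))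
  have hg : ∀ n ∈ U, (Ψ n).1 = g n := by
    rintro ⟨t, p⟩ ⟨ht, hpO, hpN⟩
    obtain ⟨γ, h, hγ⟩ := hΨ p
    have hvel := hu.deriv_eq_chartVelocity x hpO h
    have hmem : chartVelocity u x p ∈ chartPlane u x (extChartAt (𝓡 2) x p.1.1) := by
      rw [← hvel, ← hu.tangentPlane_eq_chartPlane x hpO]
      exact (h.isUnitTangent hu).1
    have htar := (hα _ hpN).1 t ht
    obtain ⟨h1, h2⟩ := (hα _ hpN).2 γ h.geodesic
      (h.point.trans ((extChartAt (𝓡 2) x).left_inv hpO).symm)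
      (hvel.trans (hu.fderiv_chartCoord x ((extChartAt (𝓡 2) x).map_source hpO) hmem).symm) t ht
    have hsrc : γ t ∈ (extChartAt (𝓡 2) x).source := by
      rw [h1]
      exact (extChartAt (𝓡 2) x).map_target htar
    have hφ : extChartAt (𝓡 2) x (γ t) = (α (z p, t)).1 := by
      rw [h1, (extChartAt (𝓡 2) x).right_inv htar]
    refine Prod.ext ((hγ t).1.trans h1) ?_
    refine ((hu.isVelocityQuadric_iff_eq (h.geodesic.isUnitTangent isOpen_univ hu (mem_univ t))
      (hu.isSpacelikeFrame_tangentPlane x hsrc)).1 (hγ t).2).trans ?_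
    rw [hφ, h2, h1]
    rfl
  have hgc : ∀ n ∈ U, ContinuousAt g n := by
    rintro ⟨t, p⟩ ⟨ht, hpO, hpN⟩
    have htar := (hα _ hpN).1 t ht
    have hd : ContinuousAt (fun n : ℝ × NonzeroBundle (gaussMap u) => α (z n.2, n.1)) (t, p) := by
      refine ContinuousAt.comp (g := α)
        (f := fun n : ℝ × NonzeroBundle (gaussMap u) => (z n.2, n.1))
        (hαc.continuousAt ((hN.prod isOpen_Ioo).mem_nhds ⟨hpN, ht⟩)) ?_
      exact (ContinuousAt.comp (g := z) (f := Prod.snd) (x := (t, p)) (hzc p hpO)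
        continuousAt_snd).prodMk continuousAt_fst
    have hE := fun i => hu.continuousAt_chartFrame x hd.fst htar i
    refine (ContinuousAt.comp (g := (extChartAt (𝓡 2) x).symm)
      (f := fun n : ℝ × NonzeroBundle (gaussMap u) => (α (z n.2, n.1)).1)
      ((continuousOn_extChartAt_symm x).continuousAt
        ((isOpen_extChartAt_target x).mem_nhds htar)) hd.fst).prodMk ?_
    refine (ContinuousAt.comp (g := inChart u x)
      (f := fun n : ℝ × NonzeroBundle (gaussMap u) => (α (z n.2, n.1)).1)
      (hu.contDiffAt_inChart x htar).continuousAt hd.fst).wedgeQuadric ?_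
    refine (hE 0).frameRotation (hE 1) ?_ (hu.isSpacelikeFrame_chartFrame x htar)
    exact (ContinuousAt.comp (g := fderiv ℝ (inChart u x))
      (f := fun n : ℝ × NonzeroBundle (gaussMap u) => (α (z n.2, n.1)).1)
      (hu.contDiffAt_fderiv_inChart x htar).continuousAt hd.fst).clm_apply hd.snd
  filter_upwards [hUo.mem_nhds hp₀] with n hn
  refine IsInducing.subtypeVal.continuousAt_iff.2 ?_
  refine (hgc n hn).congr ?_
  filter_upwards [hUo.mem_nhds hn] with n' hn' using (hg n' hn').symm

/-- The lift depends only on directions, so it descends to the sphere bundle; there its value at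
time 0 becomes the identity. -/
theorem exists_fittingFlow [T2Space S] (hu : IsSpacelikeImmersion u)
    (hII : ∀ (x : S) (v : TangentSpace (𝓡 2) x), v ≠ 0 →
      ∀ n, IsSecondFundamentalForm u x v v n →
        Real.sqrt (-form23 n n) < form23 (diffAt u x v) (diffAt u x v))
    (hc : IsGeodesicallyComplete u) :
    ∃ Φ : ℝ → SphereBundle (gaussMap u) → SphereBundle (gaussMap u),
      IsGeodesicFlow u Φ ∧ IsFittingFlow (gaussMap u) Φ := by
  obtain ⟨Ψ, hΨ⟩ := exists_isLiftedFlow hu hc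
  let Φ : ℝ → SphereBundle (gaussMap u) → SphereBundle (gaussMap u) := fun t =>
    Quotient.lift (fun p => Quotient.mk _ (Ψ (t, p))) fun p p' hp => by
      rw [hΨ.eq_of_equiv hu hp t]
  have h0 : ∀ e, Φ 0 e = e := fun e => by
    induction e using Quotient.inductionOn with
    | h p => exact Quotient.sound (hΨ.zero_equiv hu p)
  have hadd : ∀ s t e, Φ (s + t) e = Φ s (Φ t e) := fun s t e => by
    induction e using Quotient.inductionOn with
    | h p => exact congrArg (Quotient.mk _) (hΨ.add hu s t p)
  refine ⟨Φ, fun e => ⟨h0 e, ?_⟩, ?_, h0, hadd, fun t ht p => ?_⟩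
  · induction e using Quotient.inductionOn with
    | h p =>
      obtain ⟨γ, h, hγ⟩ := hΨ p
      exact ⟨γ, h.geodesic, fun t => ⟨Ψ (t, p), rfl, (hγ t).1, (hγ t).2⟩⟩
  · refine continuous_of_eventually_continuousAt (Φ := fun p => Φ p.1 p.2) h0 hadd fun e => ?_
    induction e using Quotient.inductionOn with
    | h p =>
      -- The product of the identity of ℝ with the projection is an open quotient map, so
      -- neighbourhoods in ℝ × 𝕊f*𝓔 are images of neighbourhoods upstairs.
      have hπ := IsOpenQuotientMap.id.prodMap (X := ℝ) (isOpenQuotientMap_sphereBundle (gaussMap u))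
      have hloc := hΨ.eventually_continuousAt hu p
      rw [show ((0 : ℝ), Quotient.mk (sphereSetoid (gaussMap u)) p) =
        Prod.map id (Quotient.mk _) ((0 : ℝ), p) from rfl, ← hπ.map_nhds_eq]
      refine Filter.eventually_map.2 ?_
      filter_upwards [hloc] with n hn
      refine hπ.continuousAt_comp_iff.1 ?_
      exact ContinuousAt.comp (g := Quotient.mk _) (f := Ψ)
        (isOpenQuotientMap_sphereBundle _).continuous.continuousAt hn
  · obtain ⟨p', hp', hpos⟩ := hΨ.exists_sub_isPositive hu hII ht p
    exact ⟨p', Quotient.sound hp', hpos⟩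

end Surface

end

theorem theoremB1 {S : Type*} [TopologicalSpace S] [T2Space S]
    [ChartedSpace (EuclideanSpace ℝ (Fin 2)) S] [IsManifold (𝓡 2) ∞ S]
    (u : S → R23) (hu : IsSpacelikeImmersion u)
    (hII : ∀ (x : S) (v : TangentSpace (𝓡 2) x), v ≠ 0 →
      ∀ n, IsSecondFundamentalForm u x v v n →
        Real.sqrt (-form23 n n) < form23 (diffAt u x v) (diffAt u x v)) :
    (∀ x, IsMaximalPencil (gaussMap u x)) ∧
    IsFittingImmersion (gaussMap u) ∧
    (∀ x w, IsUnitTangent u x w → ∃! q, IsVelocityQuadric u x w q) ∧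
    (∀ x, ∀ q ∈ gaussMap u x, q ≠ 0 →
      ∃! w, IsUnitTangent u x w ∧ ∃ c : ℝ, 0 < c ∧ IsVelocityQuadric u x w (c • q)) ∧
    (∀ (J : Set ℝ) (γ : ℝ → S), IsOpen J → J.OrdConnected → IsUnitGeodesic u γ J →
      ∀ s ∈ J, ∀ t ∈ J, s < t → ∀ q q' : Quadric,
        IsVelocityQuadric u (γ s) (deriv (u ∘ γ) s) q →
        IsVelocityQuadric u (γ t) (deriv (u ∘ γ) t) q' → (q' - q).IsPositive) ∧
    (IsGeodesicallyComplete u →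
      ∃ Φ : ℝ → SphereBundle (gaussMap u) → SphereBundle (gaussMap u),
        IsGeodesicFlow u Φ ∧ IsFittingFlow (gaussMap u) Φ) := by
  refine ⟨fun x => ?_, hu.isFittingImmersion_gaussMap hII,
    fun x w hw => hu.existsUnique_isVelocityQuadric hw,
    fun x q hq h0 => hu.existsUnique_velocity hq h0,
    fun J γ hJ hJc hγ s hs t ht hst q q' hq hq' =>
      hγ.velocityQuadric_sub_isPositive hJ hu hII hJc hs ht hst hq hq', ?_⟩
  · rw [hu.gaussMap_eq]
    exact (hu.isTangentPlane x).isMaximalPencil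
  · exact exists_fittingFlow hu hII
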